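/- Let $\Bbbk$ be an algebraically closed field and let $A=\bigoplus_{a,b\in J}1_aA1_b$ be a locally unital, locally finite dimensional $\Bbbk$-algebra: the $1_a$ are mutually orthogonal idempotents and all $1_aA1_b$ are finite dimensional. Let $\sim$ be an equivalence relation on $J$ with finite classes, let $I=J/\sim$, and put $1_{\mathbf a}=\sum_{b\in\mathbf a}1_b$ for $\mathbf a\in I$. For a subspace $B\subseteq A$ write $B_{a,b}=1_aB1_b$ and $B_{\mathbf a,\mathbf b}=1_{\mathbf a}B1_{\mathbf b}$. Assume that $A$ has an *upper finite weakly triangular decomposition*: there are a partial order $\preceq$ on $I$ with $\{\mathbf b:\mathbf a\preceq\mathbf b\}$ finite for all $\mathbf a$, and subspaces $A^-,A^\circ,A^+$ of $A$, such that $A^\pm=\bigoplus_{b,c\in J}A^\pm_{b,c}$ and $A^\circ=\bigoplus_{\mathbf a\in I}\bigoplus_{b,c\in\mathbf a}A^\circ_{b,c}$; $A^-_{\mathbf a,\mathbf b}=0$ and $A^+_{\mathbf b,\mathbf a}=0$ unless $\mathbf a\preceq\mathbf b$; $A^-_{\mathbf a,\mathbf a}=A^+_{\mathbf a,\mathbf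 a}=\bigoplus_{c\in\mathbf a}\Bbbk1_c$; and multiplication $A^-\otimes_{\mathbb K}A^\circ\otimes_{\mathbb K}A^+\to A$ is bijective, where $\mathbb K=\bigoplus_{b\in J}\Bbbk1_b$. For $\mathbf a\in I$ let $A_{\preceq\mathbf a}$ be the quotient of $A$ by the two-sided ideal generated by the $1_{\mathbf b}$ with $\mathbf b\not\preceq\mathbf a$, let $\bar 1_{\mathbf b}$ be the image of $1_{\mathbf b}$ in it, and let $\bar A_{\mathbf a}=\bar1_{\mathbf a}A_{\preceq\mathbf a}\bar1_{\mathbf a}$. Let $L_{\mathbf a}(\lambda)$, $\lambda\in\bar\Lambda_{\mathbf a}$, be a complete set of pairwise inequivalent irreducible $\bar A_{\mathbf a}$-modules, with projective covers $P_{\mathbf a}(\lambda)$ and injective hulls $I_{\mathbf a}(\lambda)$, and let $\bar\Lambda=\bigsqcup_{\mathbf a}\bar\Lambda_{\mathbf a}$. For a finite dimensional $\bar A_{\mathbf a}$-module $V$ put $$j^{\mathbf a}_!V=A_{\preceq\mathbf a}\bar1_{\mathbf a}\otimes_{\bar A_{\mathbf a}}V,\qquad j^{\mathbf a}_*V=\bigoplus_{\mathbf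 b\in I}\mathrm{Hom}_{\bar A_{\mathbf a}}(\bar1_{\mathbf a}A_{\preceq\mathbf a}\bar1_{\mathbf b},V).$$ Let $\rho:\bar\Lambda\to I$ send $\lambda\in\bar\Lambda_{\mathbf a}$ to $\mathbf a$. Let $\mathbf B$ be the disjoint union over $\mathbf a\in I$ of the sets of blocks of $\bar A_{\mathbf a}$, ordered by $\omega\prec\omega'$ if and only if $\omega$ is a block of $\bar A_{\mathbf a}$ and $\omega'$ is a block of $\bar A_{\mathbf b}$ with $\mathbf a\prec\mathbf b$; let $\tilde\rho:\bar\Lambda\to\mathbf B$ send $\lambda\in\bar\Lambda_{\mathbf a}$ to the block of $\bar A_{\mathbf a}$ to which $L_{\mathbf a}(\lambda)$ belongs. Let $A\text{-lfdmod}$ be the category of left $A$-modules $M=\bigoplus_{a\in J}1_aM$ with all $1_aM$ finite dimensional. *Upper finite fully stratified categories (Brundan–Stroppel).* Let $\mathcal R$ be a Schurian category, i.e. a $\Bbbk$-linear category equivalent to $B\text{-lfdmod}$ for some locally unital, locally finite dimensional $B$; let $L(b)$, $b\in\mathcal B$, be a full set of pairwise inequivalent irreducible objects, and let $r:\mathcal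 B\to\Lambda$ be a map to a poset. Let $\mathcal R_{\le l}$ (resp. $\mathcal R_{<l}$) be the Serre subcategory of objects all of whose composition factors $L(b)$ have $r(b)\le l$ (resp. $r(b)<l$), let $j^l:\mathcal R_{\le l}\to\mathcal R_l=\mathcal R_{\le l}/\mathcal R_{<l}$ be the Serre quotient functor onto the stratum, and let $j^l_!$, $j^l_*$ be its left and right adjoints. The map $r$ is a stratification if it has finite fibres, every stratum is equivalent to the category of finite dimensional modules over a finite dimensional algebra, and all $j^l_!$, $j^l_*$ exist. For $l=r(b)$ the standard, proper standard, costandard and proper costandard objects are $\Delta(b)=j^l_!P_l(b)$, $\bar\Delta(b)=j^l_!j^lL(b)$, $\nabla(b)=j^l_*I_l(b)$ and $\bar\nabla(b)=j^l_*j^lL(b)$, where $P_l(b)$ and $I_l(b)$ are a projective cover and an injective hull of $j^lL(b)$ in $\mathcal R_l$. For $\varepsilon:\Lambda\to\{+,-\}$ let $\Delta_\varepsilon(b)$ be $\Delta(b)$ if $\varepsilon(r(b))=+$ and $\bar\Delta(b)$ if $\varepsilon(r(b))=-$. Then $\mathcal R$ is *upper finite fully stratified* for $r$ if $r$ is a stratification,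 all $\{m\in\Lambda:l\le m\}$ are finite, and for every $\varepsilon$ and every $b$ there is a projective object with a finite filtration with top section $\Delta_\varepsilon(b)$ and all other sections of the form $\Delta_\varepsilon(c)$ with $r(c)\ge r(b)$. It is *upper finite highest weight* if moreover every stratum is equivalent to the category of finite dimensional vector spaces. **Theorem.** 1. For each $\lambda\in\bar\Lambda_{\mathbf a}$ the $A$-module $j^{\mathbf a}_!P_{\mathbf a}(\lambda)$ has a unique irreducible quotient $L(\lambda)$, and the $L(\lambda)$, $\lambda\in\bar\Lambda$, form a full set of pairwise inequivalent irreducible objects of $A\text{-lfdmod}$. 2. $A\text{-lfdmod}$ is an upper finite fully stratified category with respect to $\rho$, and also with respect to $\tilde\rho$. For both stratifications, the standard, proper standard, costandard and proper costandard objects labelled by $\lambda\in\bar\Lambda_{\mathbf a}$ are $j^{\mathbf a}_!P_{\mathbf a}(\lambda)$, $j^{\mathbf a}_!L_{\mathbf a}(\lambda)$, $j^{\mathbf a}_*I_{\mathbf a}(\lambda)$ and $j^{\mathbf a}_*L_{\mathbf a}(\lambda)$, respectively. 3. If $\bar A_{\mathbf a}$ is semisimple for all $\mathbf a\in I$, then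 $A\text{-lfdmod}$, with the stratification $\tilde\rho$, is an upper finite highest weight category. -/

import Mathlib

open CategoryTheory CategoryTheory.Limits
open scoped TensorProduct DirectSum ModuleCat

universe u v v' w w' t

noncomputable section

/-! ### Locally unital algebras and their modules -/

/-- A locally unital, locally finite dimensional `k`-algebra structure on the (non-unital) algebra
`A`: mutually orthogonal idempotents `1_a`, `a ∈ J`, with `A = ⨁_{a, b ∈ J} 1_a A 1_b` and every
`1_a A 1_b` finite dimensional. (Directness of the sum is automatic from orthogonality.)
Equivalently: a small `k`-linear category with object set `J` and finite dimensional
morphism spaces `Hom(b, a) = 1_a A 1_b`. -/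
structure LocallyUnital (k A J : Type u) [Field k] [NonUnitalRing A] [Module k A]
    [IsScalarTower k A A] [SMulCommClass k A A] where
  /-- the idempotent `1_a` -/
  e : J → A
  idem : ∀ a, e a * e a = e a
  orth : ∀ a b, a ≠ b → e a * e b = 0
  sum_eq_top : (⨆ a, ⨆ b, (⊤ : Submodule k A).map
    (LinearMap.mulLeft k (e a) ∘ₗ LinearMap.mulRight k (e b))) = ⊤
  finite : ∀ a b, Module.Finite k ↥((⊤ : Submodule k A).map
    (LinearMap.mulLeft k (e a) ∘ₗ LinearMap.mulRight k (e b)))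

namespace LocallyUnital

section Basic

variable {k A J : Type u} [Field k] [NonUnitalRing A] [Module k A]
  [IsScalarTower k A A] [SMulCommClass k A A] (E : LocallyUnital k A J)

/-- `1_a B 1_b` for a subspace `B` of `A`. -/
def block (B : Submodule k A) (a b : J) : Submodule k A :=
  B.map (LinearMap.mulLeft k (E.e a) ∘ₗ LinearMap.mulRight k (E.e b))

/-- `1_a B` for a subspace `B` of `A`. -/
def leftPart (B : Submodule k A) (a : J) : Submodule k A :=
  B.map (LinearMap.mulLeft k (E.e a))

/-- `B 1_b` for a subspace `B` of `A`. -/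
def rightPart (B : Submodule k A) (b : J) : Submodule k A :=
  B.map (LinearMap.mulRight k (E.e b))

/-- A left module over the non-unital `k`-algebra `A` is the same as a unital left module over the
unitization `k ⊕ A`. We use this to speak about `A`-modules through Mathlib's `ModuleCat`. -/
abbrev Uni (_ : LocallyUnital k A J) : Type u := Unitization k A

/-- The idempotent `1_a`, seen in the unitization. -/
def eU (a : J) : E.Uni := Unitization.inr (E.e a)

lemma eU_mul_self (a : J) : E.eU a * E.eU a = E.eU a := by
  simp only [eU, ← Unitization.inr_mul, E.idem]

lemma eU_mul_of_ne {a b : J} (h : a ≠ b) : E.eU a * E.eU b = 0 := by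
  simp only [eU, ← Unitization.inr_mul, E.orth a b h, Unitization.inr_zero]

lemma sum_eU_mul_sum_eU {s t : Finset J} (h : s ⊆ t) :
    (∑ a ∈ t, E.eU a) * (∑ a ∈ s, E.eU a) = ∑ a ∈ s, E.eU a := by
  classical
  rw [Finset.mul_sum]
  refine Finset.sum_congr rfl fun a ha => ?_
  rw [Finset.sum_mul, Finset.sum_eq_single a]
  · exact E.eU_mul_self a
  · intro b _ hb
    exact E.eU_mul_of_ne hb
  · intro h'
    exact absurd (h ha) h'

lemma isIdempotentElem_sum (s : Finset J) : IsIdempotentElem (∑ a ∈ s, E.eU a) :=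
  E.sum_eU_mul_sum_eU (Finset.Subset.refl s)

lemma exists_sum_mul_eq (x : A) : ∃ s : Finset J, (∑ a ∈ s, E.eU a) * (x : E.Uni) = x := by
  classical
  have key : ∀ x ∈ (⨆ a, ⨆ b, (⊤ : Submodule k A).map
      (LinearMap.mulLeft k (E.e a) ∘ₗ LinearMap.mulRight k (E.e b))),
      ∃ s : Finset J, (∑ a ∈ s, E.eU a) * ((x : A) : E.Uni) = x := by
    intro x hx
    refine Submodule.iSup_induction' _ (motive := fun x _ =>
      ∃ s : Finset J, (∑ a ∈ s, E.eU a) * ((x : A) : E.Uni) = x) ?_ ?_ ?_ hx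
    · intro a x hx
      refine ⟨{a}, ?_⟩
      refine Submodule.iSup_induction' _ (motive := fun x _ =>
        (∑ a ∈ {a}, E.eU a) * ((x : A) : E.Uni) = x) ?_ ?_ ?_ hx
      · rintro b _ ⟨y, -, rfl⟩
        simp only [Finset.sum_singleton, eU, ← Unitization.inr_mul, LinearMap.comp_apply,
          LinearMap.mulLeft_apply, LinearMap.mulRight_apply, ← mul_assoc, E.idem]
      · simp
      · intro x y _ _ hx hy
        rw [Unitization.inr_add, mul_add, hx, hy]
    · exact ⟨∅, by simp⟩
    · rintro x y _ _ ⟨s, hs⟩ ⟨t, ht⟩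
      refine ⟨s ∪ t, ?_⟩
      rw [Unitization.inr_add, mul_add]
      congr 1
      · rw [← hs, ← mul_assoc, E.sum_eU_mul_sum_eU Finset.subset_union_left]
      · rw [← ht, ← mul_assoc, E.sum_eU_mul_sum_eU Finset.subset_union_right]
  exact key x (by rw [E.sum_eq_top]; exact Submodule.mem_top)

/-- The largest locally unital submodule `⨁_a 1_a M` of an `A`-module `M`: the elements fixed by
some finite sum of the orthogonal idempotents `1_a`. -/
def locUnitalPart (M : Type v) [AddCommGroup M] [Module E.Uni M] : Submodule E.Uni M where
  carrier := {m | ∃ s : Finset J, (∑ a ∈ s, E.eU a) • m = m}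
  zero_mem' := ⟨∅, by simp⟩
  add_mem' := by
    classical
    rintro m n ⟨s, hs⟩ ⟨t, ht⟩
    refine ⟨s ∪ t, ?_⟩
    rw [smul_add]
    congr 1
    · rw [← hs, ← mul_smul, E.sum_eU_mul_sum_eU Finset.subset_union_left]
    · rw [← ht, ← mul_smul, E.sum_eU_mul_sum_eU Finset.subset_union_right]
  smul_mem' := by
    classical
    rintro x m ⟨s, hs⟩
    induction x using Unitization.ind with
    | inl_add_inr c x =>
      obtain ⟨t, ht⟩ := E.exists_sum_mul_eq x
      refine ⟨s ∪ t, ?_⟩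
      rw [add_smul, smul_add]
      congr 1
      · have hc : (Unitization.inl c : E.Uni) = algebraMap k E.Uni c := rfl
        rw [hc, ← mul_smul, ← Algebra.commutes, mul_smul]
        congr 1
        rw [← hs, ← mul_smul, E.sum_eU_mul_sum_eU Finset.subset_union_left]
      · rw [← mul_smul]
        congr 1
        rw [← ht, ← mul_assoc, E.sum_eU_mul_sum_eU Finset.subset_union_right]

/-- The locally finite dimensional left `A`-modules: `M = ⨁_a 1_a M` with every `1_a M` finite
dimensional over `k`. -/
def isLfd : ObjectProperty (ModuleCat.{u} E.Uni) := fun M =>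
  (∀ m : M, ∃ s : Finset J, (∑ a ∈ s, E.eU a) • m = m) ∧
    ∀ a, Module.Finite k ↥(LinearMap.range (Algebra.lsmul k k M (E.eU a)))

/-- The category `A`-lfdmod. -/
abbrev Lfdmod : Type (u + 1) := E.isLfd.FullSubcategory

lemma isLfd_of_injective {M N : ModuleCat.{u} E.Uni} (hN : E.isLfd N) (f : M ⟶ N)
    (hf : Function.Injective f.hom) : E.isLfd M := by
  refine ⟨fun m => ?_, fun a => ?_⟩
  · obtain ⟨s, hs⟩ := hN.1 (f.hom m)
    exact ⟨s, hf (by rw [map_smul, hs])⟩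
  · have := hN.2 a
    let g : M →ₗ[k] N := f.hom.restrictScalars k
    have hg : ∀ x ∈ LinearMap.range (Algebra.lsmul k k M (E.eU a)),
        g x ∈ LinearMap.range (Algebra.lsmul k k N (E.eU a)) := by
      rintro _ ⟨x, rfl⟩
      exact ⟨f.hom x, (map_smul f.hom (E.eU a) x).symm⟩
    refine Module.Finite.of_injective (g.restrict hg) ?_
    intro x y hxy
    exact Subtype.ext (hf (congrArg Subtype.val hxy))

lemma isLfd_of_surjective {M N : ModuleCat.{u} E.Uni} (hM : E.isLfd M) (f : M ⟶ N)
    (hf : Function.Surjective f.hom) : E.isLfd N := by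
  refine ⟨fun n => ?_, fun a => ?_⟩
  · obtain ⟨m, rfl⟩ := hf n
    obtain ⟨s, hs⟩ := hM.1 m
    exact ⟨s, by rw [← map_smul, hs]⟩
  · have := hM.2 a
    let g : M →ₗ[k] N := f.hom.restrictScalars k
    have hg : ∀ x ∈ LinearMap.range (Algebra.lsmul k k M (E.eU a)),
        g x ∈ LinearMap.range (Algebra.lsmul k k N (E.eU a)) := by
      rintro _ ⟨x, rfl⟩
      exact ⟨f.hom x, (map_smul f.hom (E.eU a) x).symm⟩
    refine Module.Finite.of_surjective (g.restrict hg) ?_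
    rintro ⟨_, ⟨n, rfl⟩⟩
    obtain ⟨m, rfl⟩ := hf n
    exact ⟨⟨_, ⟨m, rfl⟩⟩, Subtype.ext (map_smul f.hom (E.eU a) m)⟩

lemma isLfd_pi {ι : Type} [Finite ι] (M : ι → ModuleCat.{u} E.Uni) (hM : ∀ i, E.isLfd (M i)) :
    E.isLfd (ModuleCat.of E.Uni (∀ i, M i)) := by
  classical
  have := Fintype.ofFinite ι
  refine ⟨fun m => ?_, fun a => ?_⟩
  · choose s hs using fun i => (hM i).1 (m i)
    refine ⟨Finset.univ.biUnion s, funext fun i => ?_⟩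
    change (∑ a ∈ Finset.univ.biUnion s, E.eU a) • (m i) = m i
    rw [← hs i, ← mul_smul, E.sum_eU_mul_sum_eU (Finset.subset_biUnion_of_mem s (Finset.mem_univ i))]
  · have := fun i => (hM i).2 a
    let φ : ↥(LinearMap.range (Algebra.lsmul k k (ModuleCat.of E.Uni (∀ i, M i)) (E.eU a))) →ₗ[k]
        (∀ i, ↥(LinearMap.range (Algebra.lsmul k k (M i) (E.eU a)))) :=
      LinearMap.pi fun i =>
        { toFun := fun x => ⟨(x.1 : ∀ i, M i) i, by
            obtain ⟨_, ⟨y, rfl⟩⟩ := x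
            exact ⟨(y : ∀ i, M i) i, rfl⟩⟩
          map_add' := fun _ _ => rfl
          map_smul' := fun _ _ => rfl }
    refine Module.Finite.of_injective φ ?_
    intro x y hxy
    refine Subtype.ext (funext fun i => ?_)
    exact congrArg Subtype.val (congrFun hxy i)

instance : E.isLfd.IsClosedUnderSubobjects where
  prop_of_mono f _ hN := E.isLfd_of_injective hN f ((ModuleCat.mono_iff_injective f).1 inferInstance)

instance : E.isLfd.IsClosedUnderQuotients where
  prop_of_epi f _ hM :=
    E.isLfd_of_surjective hM f ((ModuleCat.epi_iff_surjective f).1 inferInstance)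

instance : E.isLfd.ContainsZero where
  exists_zero := ⟨ModuleCat.of E.Uni PUnit, ModuleCat.isZero_of_subsingleton _,
    fun _ => ⟨∅, rfl⟩, fun _ => Module.Finite.of_injective (0 : _ →ₗ[k] k)
      fun _ _ _ => Subsingleton.elim _ _⟩

instance : E.isLfd.IsClosedUnderFiniteProducts where
  isClosedUnderLimitsOfShape ι _ :=
    { limitsOfShape_le := by
        rintro X ⟨p⟩
        let f : X ⟶ ModuleCat.of E.Uni (∀ i : ι, p.diag.obj ⟨i⟩) :=
          ModuleCat.ofHom (LinearMap.pi fun i => (p.π.app ⟨i⟩).hom)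
        refine E.isLfd_of_injective (E.isLfd_pi _ fun i => p.prop_diag_obj ⟨i⟩) f ?_
        rw [← ModuleCat.mono_iff_injective f]
        refine ⟨fun g h hgh => p.isLimit.hom_ext ?_⟩
        rintro ⟨i⟩
        ext z
        have := congrArg (fun φ => (φ.hom z : ∀ i : ι, p.diag.obj ⟨i⟩) i) hgh
        exact this }

end Basic

end LocallyUnital

/-! ### Stratified categories in the sense of Brundan and Stroppel -/

/-- A sign. -/
inductive Sgn : Type
  | plus
  | minus

section Covers

variable {D : Type w} [Category.{v} D]

/-- `π : P ⟶ X` is a projective cover: `P` is projective and `π` is an essential epimorphism. -/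
def IsProjCover {P X : D} (π : P ⟶ X) : Prop :=
  Projective P ∧ Epi π ∧ ∀ (Y : D) (f : Y ⟶ P), Epi (f ≫ π) → Epi f

/-- `ι : X ⟶ I` is an injective hull: `I` is injective and `ι` is an essential monomorphism. -/
def IsInjHull {X I : D} (ι : X ⟶ I) : Prop :=
  Injective I ∧ Mono ι ∧ ∀ (Y : D) (f : I ⟶ Y), Mono (ι ≫ f) → Mono f

/-- `L b`, `b ∈ B`, is a full set of pairwise inequivalent irreducible objects. -/
structure IsFullSetOfSimples [HasZeroMorphisms D] {B : Type t} (L : B → D) : Prop where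
  simple : ∀ b, Simple (L b)
  inequiv : ∀ b c, Nonempty (L b ≅ L c) → b = c
  complete : ∀ X : D, Simple X → ∃ b, Nonempty (X ≅ L b)

/-- `Y` is a subquotient of `X`: a quotient of a subobject. -/
def IsSubquotient (Y X : D) : Prop :=
  ∃ (Z : D) (i : Z ⟶ X) (p : Z ⟶ Y), Mono i ∧ Epi p

end Covers

section Stratified

variable {C : Type w} [Category.{v} C] [Abelian C]
variable {B : Type t} {Λ : Type w'} [PartialOrder Λ]

/-- A Schurian category: a `k`-linear category equivalent to `A`-lfdmod for some locally unital,
locally finite dimensional `k`-algebra `A`. -/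
def IsSchurian (k : Type u) [Field k] (C : Type w) [Category.{v} C] [Abelian C] [Linear k C] :
    Prop :=
  ∃ (A J : Type u) (_ : NonUnitalRing A) (_ : Module k A) (_ : IsScalarTower k A A)
    (_ : SMulCommClass k A A) (E : LocallyUnital k A J) (F : C ≌ E.Lfdmod),
    F.functor.Additive ∧ F.functor.Linear k

/-- The Serre subcategory `R_{≤ l}`: the objects all of whose irreducible subquotients (composition
factors) are of the form `L b` with `ρ b ≤ l`. -/
def serreLE (L : B → C) (ρ : B → Λ) (l : Λ) : ObjectProperty C :=
  fun X => ∀ b, IsSubquotient (L b) X → ρ b ≤ l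

/-- The Serre subcategory `R_{< l}`. -/
def serreLT (L : B → C) (ρ : B → Λ) (l : Λ) : ObjectProperty C :=
  fun X => ∀ b, IsSubquotient (L b) X → ρ b < l

/-- The morphisms of `R_{≤ l}` whose kernel and cokernel lie in `R_{< l}`. -/
def stratumW (L : B → C) (ρ : B → Λ) (l : Λ) :
    MorphismProperty (serreLE L ρ l).FullSubcategory :=
  fun _ _ f => serreLT L ρ l (kernel f.hom) ∧ serreLT L ρ l (cokernel f.hom)

/-- The stratum `R_l`: the Serre quotient `R_{≤ l} / R_{< l}`. -/
abbrev Stratum (L : B → C) (ρ : B → Λ) (l : Λ) := (stratumW L ρ l).Localization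

/-- The quotient functor `j^l : R_{≤ l} ⥤ R_l`. -/
abbrev stratumQ (L : B → C) (ρ : B → Λ) (l : Λ) :
    (serreLE L ρ l).FullSubcategory ⥤ Stratum L ρ l := (stratumW L ρ l).Q

/-- The stratum `R_l` is equivalent, `k`-linearly, to the category of finite dimensional modules
over the finite dimensional `k`-algebra `S`. (The `k`-linear structure of the stratum is the one
for which the quotient functor is `k`-linear.) -/
def StratumEquivFdmod (k : Type u) [Field k] [Linear k C] (L : B → C) (ρ : B → Λ) (l : Λ)
    (S : Type u) [Ring S] [Algebra k S] : Prop :=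
  ∃ F : Stratum L ρ l ≌ FGModuleCat.{u} S,
    (stratumQ L ρ l ⋙ F.functor ⋙ (ModuleCat.isFG.{u} S).ι).Additive ∧
    (stratumQ L ρ l ⋙ F.functor ⋙ (ModuleCat.isFG.{u} S).ι).Linear k

/-- `ρ : B → Λ` is a stratification of `C`, where `L b`, `b ∈ B`, are the irreducible objects:
`ρ` has finite fibres, each stratum is a finite abelian category, and the quotient functor `j^l` of
each stratum has a left adjoint `j^l_!` and a right adjoint `j^l_*`. -/
structure IsStratification (k : Type u) [Field k] [Linear k C] (L : B → C) (ρ : B → Λ) :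
    Prop where
  fullSet : IsFullSetOfSimples L
  finite_fibre : ∀ l, (ρ ⁻¹' {l}).Finite
  finite_stratum : ∀ l, ∃ (S : Type u) (_ : Ring S) (_ : Algebra k S),
    Module.Finite k S ∧ StratumEquivFdmod k L ρ l S
  exists_shriek : ∀ l, (stratumQ L ρ l).IsRightAdjoint
  exists_star : ∀ l, (stratumQ L ρ l).IsLeftAdjoint

/-- `X ≅ j^l_! M`. -/
def IsShriek (L : B → C) (ρ : B → Λ) {l : Λ} (M : Stratum L ρ l) (X : C) : Prop :=
  ∃ (F : Stratum L ρ l ⥤ (serreLE L ρ l).FullSubcategory) (_ : F ⊣ stratumQ L ρ l),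
    Nonempty (X ≅ (F.obj M).obj)

/-- `X ≅ j^l_* M`. -/
def IsStar (L : B → C) (ρ : B → Λ) {l : Λ} (M : Stratum L ρ l) (X : C) : Prop :=
  ∃ (F : Stratum L ρ l ⥤ (serreLE L ρ l).FullSubcategory) (_ : stratumQ L ρ l ⊣ F),
    Nonempty (X ≅ (F.obj M).obj)

/-- `X` is a standard object `Δ(b) = j^l_! (P_l(b))`, where `l = ρ b` and `P_l(b)` is a projective
cover of the irreducible object `L_l(b) = j^l (L b)` of the stratum `R_l`. -/
def IsStandard (L : B → C) (ρ : B → Λ) (b : B) (X : C) : Prop :=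
  ∃ (h : serreLE L ρ (ρ b) (L b)) (P : Stratum L ρ (ρ b))
    (π : P ⟶ (stratumQ L ρ (ρ b)).obj ⟨L b, h⟩), IsProjCover π ∧ IsShriek L ρ P X

/-- `X` is a proper standard object `Δ̄(b) = j^l_! (L_l(b))`. -/
def IsProperStandard (L : B → C) (ρ : B → Λ) (b : B) (X : C) : Prop :=
  ∃ h : serreLE L ρ (ρ b) (L b), IsShriek L ρ ((stratumQ L ρ (ρ b)).obj ⟨L b, h⟩) X

/-- `X` is a costandard object `∇(b) = j^l_* (I_l(b))`, where `I_l(b)` is an injective hull of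
`L_l(b)` in the stratum `R_l`. -/
def IsCostandard (L : B → C) (ρ : B → Λ) (b : B) (X : C) : Prop :=
  ∃ (h : serreLE L ρ (ρ b) (L b)) (I : Stratum L ρ (ρ b))
    (ι : (stratumQ L ρ (ρ b)).obj ⟨L b, h⟩ ⟶ I), IsInjHull ι ∧ IsStar L ρ I X

/-- `X` is a proper costandard object `∇̄(b) = j^l_* (L_l(b))`. -/
def IsProperCostandard (L : B → C) (ρ : B → Λ) (b : B) (X : C) : Prop :=
  ∃ h : serreLE L ρ (ρ b) (L b), IsStar L ρ ((stratumQ L ρ (ρ b)).obj ⟨L b, h⟩) X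

/-- `X ≅ Δ_ε(b)`, which is `Δ(b)` if `ε (ρ b) = +` and `Δ̄(b)` if `ε (ρ b) = -`. -/
def IsSignedStandard (L : B → C) (ρ : B → Λ) (ε : Λ → Sgn) (b : B) (X : C) : Prop :=
  match ε (ρ b) with
  | Sgn.plus => IsStandard L ρ b X
  | Sgn.minus => IsProperStandard L ρ b X

/-- `X` has a finite filtration all of whose sections satisfy `S`. -/
inductive HasFiniteFlag (S : C → Prop) : C → Prop
  | zero (X : C) (hX : IsZero X) : HasFiniteFlag S X
  | step (T : ShortComplex C) (hT : T.ShortExact) (h₁ : HasFiniteFlag S T.X₁) (h₃ : S T.X₃) :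
      HasFiniteFlag S T.X₂

/-- The property `(P̂Δ_ε)`: for each `b` there is a projective object `P` with a finite
`Δ_ε`-flag with `Δ_ε(b)` at the top and other sections `Δ_ε(c)` for `c` with `ρ c ≥ ρ b`. -/
def HasProjectiveFlags (L : B → C) (ρ : B → Λ) (ε : Λ → Sgn) : Prop :=
  ∀ b, ∃ T : ShortComplex C, T.ShortExact ∧ Projective T.X₂ ∧ IsSignedStandard L ρ ε b T.X₃ ∧
    HasFiniteFlag (fun X => ∃ c, ρ b ≤ ρ c ∧ IsSignedStandard L ρ ε c X) T.X₁

/-- `C`, with irreducible objects `L b` and stratification `ρ`, is an upper finite fully stratified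
category: it is Schurian, the poset `Λ` is upper finite, and `(P̂Δ_ε)` holds for every sign
function `ε`. -/
structure IsUpperFiniteFullyStratified (k : Type u) [Field k] [Linear k C] (L : B → C)
    (ρ : B → Λ) : Prop where
  schurian : IsSchurian k C
  upper_finite : ∀ l : Λ, {m : Λ | l ≤ m}.Finite
  stratification : IsStratification k L ρ
  flags : ∀ ε : Λ → Sgn, HasProjectiveFlags L ρ ε

/-- An upper finite highest weight category: an upper finite fully stratified category all of
whose strata are simple, i.e. equivalent to the category of finite dimensional vector spaces. -/
structure IsUpperFiniteHighestWeight (k : Type u) [Field k] [Linear k C] (L : B → C)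
    (ρ : B → Λ) : Prop where
  fullyStratified : IsUpperFiniteFullyStratified k L ρ
  simple_stratum : ∀ l, StratumEquivFdmod k L ρ l k

end Stratified

/-! ### Induction and coinduction from an idempotent truncation -/

section Idempotent

variable {R : Type u} [Ring R] {e : R} (he : IsIdempotentElem e)
  (V : Type v) [AddCommGroup V] [Module he.Corner V]

lemma mul_corner_mem (x : Ideal.span {e}) (h : he.Corner) : x.1 * h.1 ∈ Ideal.span {e} := by
  have hh : h.1 * e = h.1 := ((Subsemigroup.mem_corner_iff he).mp h.2).2
  rw [← hh, ← mul_assoc]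
  exact Ideal.mul_mem_left _ _ (Ideal.mem_span_singleton_self e)

/-- The relations `x h ⊗ v = x ⊗ h v` for `x ∈ Re`, `h ∈ eRe`, `v ∈ V`. -/
def balanced : Submodule R (↥(Ideal.span {e}) ⊗[ℤ] V) :=
  Submodule.span R {z | ∃ (x : Ideal.span {e}) (h : he.Corner) (v : V),
    z = (⟨x.1 * h.1, mul_corner_mem he x h⟩ : Ideal.span {e}) ⊗ₜ[ℤ] v - x ⊗ₜ[ℤ] (h • v)}

/-- The `R`-module `Re ⊗_{eRe} V`, for an `eRe`-module `V` (here `Re` is the left ideal generated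
by the idempotent `e`). -/
abbrev Induced : Type _ := (↥(Ideal.span {e}) ⊗[ℤ] V) ⧸ balanced he V

/-- `Hom_{eRe}(eR, V)`, realised as the additive maps `f : R → V` with `f (h x) = h f(x)` for all
`h ∈ eRe`, `x ∈ R`; such an `f` satisfies `f x = f (e x)` and so is the same as an
`eRe`-linear map `eR → V`. -/
def coinducedSubgroup : AddSubgroup (R →+ V) where
  carrier := {f | ∀ (h : he.Corner) (x : R), f (h.1 * x) = h • f x}
  zero_mem' := fun h x => by simp
  add_mem' := fun {f g} hf hg h x => by
    simp only [AddMonoidHom.add_apply, hf h x, hg h x, smul_add]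
  neg_mem' := fun {f} hf h x => by
    simp only [AddMonoidHom.neg_apply, hf h x, smul_neg]

/-- The `R`-module `Hom_{eRe}(eR, V)`, for an `eRe`-module `V`. -/
abbrev Coinduced : Type _ := ↥(coinducedSubgroup he V)

/-- The action of `R` on `Hom_{eRe}(eR, V)` is `(r f)(x) = f (x r)`. -/
instance : Module R (Coinduced he V) where
  smul r f := ⟨f.1.comp (AddMonoidHom.mulRight r), fun h x => by
    simp only [AddMonoidHom.comp_apply, AddMonoidHom.mulRight_apply, mul_assoc]
    exact f.2 h (x * r)⟩
  one_smul f := Subtype.ext (AddMonoidHom.ext fun x => congrArg f.1 (mul_one x))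
  mul_smul r s f := Subtype.ext (AddMonoidHom.ext fun x => congrArg f.1 (mul_assoc x r s).symm)
  smul_zero _ := rfl
  smul_add _ _ _ := rfl
  add_smul r s f := Subtype.ext (AddMonoidHom.ext fun x =>
    (congrArg f.1 (mul_add x r s)).trans (map_add f.1 _ _))
  zero_smul f := Subtype.ext (AddMonoidHom.ext fun x =>
    (congrArg f.1 (mul_zero x)).trans (map_zero f.1))

end Idempotent

/-- The blocks of a ring `S`, given by its primitive central idempotents `c`; the block algebra of
`c` is `c S`. -/
def Block (S : Type u) [Ring S] : Type u :=
  {c : S // c ∈ Set.center S ∧ IsIdempotentElem c ∧ c ≠ 0 ∧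
    ∀ d ∈ Set.center S, IsIdempotentElem d → c * d = d → d = 0 ∨ d = c}

/-! ### Weakly triangular decompositions -/

section WT

variable {k A J : Type u} [Field k] [NonUnitalRing A] [Module k A]
  [IsScalarTower k A A] [SMulCommClass k A A]

/-- The multiplication map `X ⊗ Y ⊗ Z → A`, `x ⊗ y ⊗ z ↦ x y z`, for subspaces of `A`. -/
def tripleMul (X Y Z : Submodule k A) : (X ⊗[k] (Y ⊗[k] Z)) →ₗ[k] A :=
  LinearMap.mul' k A ∘ₗ TensorProduct.map X.subtype
    (LinearMap.mul' k A ∘ₗ TensorProduct.map Y.subtype Z.subtype)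

open Classical in
/-- An upper finite weakly triangular decomposition of `A = ⨁_{a, b ∈ J} 1_a A 1_b`. Here
`I = J / ∼` is the set of classes of an equivalence relation on `J` with finite classes, given
through the surjection `cls : J → I`. -/
structure WeaklyTriangular (E : LocallyUnital k A J) (I : Type t) [PartialOrder I] where
  /-- the class of an element of `J` -/
  cls : J → I
  cls_surjective : Function.Surjective cls
  finite_class : ∀ a : I, {b | cls b = a}.Finite
  upper_finite : ∀ a : I, {b : I | a ≤ b}.Finite
  /-- the subspace `A⁻` -/
  neg : Submodule k A
  /-- the subspace `A°` -/
  zero : Submodule k A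
  /-- the subspace `A⁺` -/
  pos : Submodule k A
  neg_eq : neg = ⨆ b, ⨆ c, E.block neg b c
  pos_eq : pos = ⨆ b, ⨆ c, E.block pos b c
  zero_eq : zero = ⨆ b, ⨆ c, ⨆ _ : cls b = cls c, E.block zero b c
  /-- `A⁻_{𝐚, 𝐛} = 0` unless `𝐚 ≤ 𝐛` -/
  neg_eq_bot : ∀ b c, ¬ cls b ≤ cls c → E.block neg b c = ⊥
  /-- `A⁺_{𝐛, 𝐚} = 0` unless `𝐚 ≤ 𝐛` -/
  pos_eq_bot : ∀ b c, ¬ cls b ≤ cls c → E.block pos c b = ⊥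
  /-- `A⁻_{𝐚} = ⨁_{c ∈ 𝐚} k 1_c` -/
  neg_diag : ∀ a : I, (⨆ b, ⨆ c, ⨆ _ : cls b = a, ⨆ _ : cls c = a, E.block neg b c) =
    ⨆ c, ⨆ _ : cls c = a, Submodule.span k {E.e c}
  /-- `A⁺_{𝐚} = ⨁_{c ∈ 𝐚} k 1_c` -/
  pos_diag : ∀ a : I, (⨆ b, ⨆ c, ⨆ _ : cls b = a, ⨆ _ : cls c = a, E.block pos b c) =
    ⨆ c, ⨆ _ : cls c = a, Submodule.span k {E.e c}
  /-- Multiplication `A⁻ ⊗_𝕂 A° ⊗_𝕂 A⁺ → A` is bijective, where `𝕂 = ⨁_{b ∈ J} k 1_b`; this tensor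
  product is `⨁_{b, c ∈ J} A⁻ 1_b ⊗_k 1_b A° 1_c ⊗_k 1_c A⁺`. -/
  mul_bijective : Function.Bijective (DirectSum.toModule k (J × J) A fun p =>
    tripleMul (E.rightPart neg p.1) (E.block zero p.1 p.2) (E.leftPart pos p.2))

namespace WeaklyTriangular

variable {E : LocallyUnital k A J} {I : Type t} [PartialOrder I] (T : WeaklyTriangular E I)

/-- The idempotent `1_𝐚 = ∑_{b ∈ 𝐚} 1_b`. -/
def one (a : I) : E.Uni := ∑ b ∈ (T.finite_class a).toFinset, E.eU b

/-- The two-sided ideal generated by the idempotents `1_𝐛` with `𝐛 ≰ 𝐚`. It is contained in `A`, and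
is the same in `A` and in its unitization as `1_𝐛 = 1_𝐛 1_𝐛 1_𝐛`. -/
def idealNotLE (a : I) : TwoSidedIdeal E.Uni :=
  TwoSidedIdeal.span {x | ∃ b : I, ¬ b ≤ a ∧ x = T.one b}

/-- The quotient of the unitization of `A` by the ideal generated by the `1_𝐛`, `𝐛 ≰ 𝐚`. It
contains `A_{≤ 𝐚}`, the quotient of `A` by the same ideal, as an ideal (of codimension one). -/
abbrev quotLE (a : I) : Type u := E.Uni ⧸ (T.idealNotLE a).asIdeal

/-- The image `1̄_𝐚` of `1_𝐚` in the quotient. -/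
def oneBar (a : I) : T.quotLE a := Ideal.Quotient.mk (T.idealNotLE a).asIdeal (T.one a)

lemma oneBar_idem (a : I) : IsIdempotentElem (T.oneBar a) := by
  unfold IsIdempotentElem oneBar
  rw [← map_mul]
  exact congrArg _ (E.isIdempotentElem_sum _)

/-- The algebra `Ā_𝐚 = 1̄_𝐚 A_{≤ 𝐚} 1̄_𝐚`. -/
abbrev Abar (a : I) : Type u := (T.oneBar_idem a).Corner

instance (a : I) (V : Type v) [AddCommGroup V] [Module (T.Abar a) V] :
    Module E.Uni (Induced (T.oneBar_idem a) V) :=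
  Module.compHom _ (Ideal.Quotient.mk (T.idealNotLE a).asIdeal)

instance (a : I) (V : Type v) [AddCommGroup V] [Module (T.Abar a) V] :
    Module E.Uni (Coinduced (T.oneBar_idem a) V) :=
  Module.compHom _ (Ideal.Quotient.mk (T.idealNotLE a).asIdeal)

/-- The standardization functor on objects: `Δ(V) = A_{≤ 𝐚} 1̄_𝐚 ⊗_{Ā_𝐚} V`, as an `A`-module. -/
def standardize (a : I) (V : ModuleCat.{u} (T.Abar a)) : ModuleCat.{u} E.Uni :=
  ModuleCat.of E.Uni (Induced (T.oneBar_idem a) V)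

/-- The costandardization functor on objects:
`∇(V) = ⨁_𝐛 Hom_{Ā_𝐚}(1̄_𝐚 A_{≤ 𝐚} 1̄_𝐛, V)`, as an `A`-module. -/
def costandardize (a : I) (V : ModuleCat.{u} (T.Abar a)) : ModuleCat.{u} E.Uni :=
  ModuleCat.of E.Uni ↥(E.locUnitalPart (Coinduced (T.oneBar_idem a) V))

/-- The set `𝐁` of all blocks of the algebras `Ā_𝐚`, `𝐚 ∈ I`. -/
structure BlockPoset where
  /-- the index `𝐚` -/
  idx : I
  /-- a block of `Ā_𝐚` -/
  blk : Block (T.Abar idx)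

/-- `ω < ω'` if `ω` is a block of `Ā_𝐚`, `ω'` is a block of `Ā_𝐛`, and `𝐚 < 𝐛`. -/
instance : PartialOrder T.BlockPoset where
  le x y := x = y ∨ x.idx < y.idx
  le_refl x := Or.inl rfl
  le_trans x y z := by
    rintro (rfl | h) (rfl | h')
    · exact Or.inl rfl
    · exact Or.inr h'
    · exact Or.inr h
    · exact Or.inr (h.trans h')
  le_antisymm x y := by
    rintro (rfl | h) (h' | h')
    · rfl
    · rfl
    · exact h'.symm
    · exact absurd (h.trans h') (lt_irrefl _)

end WeaklyTriangular

end WT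

end

/-!
The triangular decomposition enters chiefly through one fact. Fix `a : I`, write `R = A_{≤ a}` and
`e = 1̄_a`, so that `e R e = Ā_a`. A basis of `A⁻` on the left and one of `A⁺` on the right give
elements `y i ∈ R e` and `w j ∈ e R` for which every element of `R e R` has a unique expression
`∑ y i (h i j) w j` with coefficients `h i j ∈ f i Ā_a g j`, for certain idempotents `f i` and
`g j` of `Ā_a` (`CornerCoords`, `WeaklyTriangular.coords`). It follows that `R e` and `e R` are
projective `Ā_a`-modules, that multiplication `R e ⊗ e R → R` is injective, and hence that

* `j_! V = R e ⊗ V` is exact in `V` (`CornerCoords.map_injective`),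
* `j_! (e N) → N` is injective for every left ideal `N` of `R`
  (`CornerCoords.lift_injective_of_injective`), and
* `e N` is projective if `N` is a left ideal generated by an idempotent
  (from `CornerCoords.projective_cornerPart`).

*Irreducible modules.* As `e (j_! V) = V`, the maximal submodules of `j_! V`, if `V ≠ 0`, correspond
to those of `V` (`WeaklyTriangular.isCoatom_iff`). So `j_! P` and `j_! S` have a unique irreducible
quotient if `P` is the projective cover of a simple `Ā_a`-module `S`. An irreducible `A`-module `M`
has `1_a M ≠ 0` for some maximal `a`, because upper sets in `I` are finite, and is then a module
over `A_{≤ a}` and the irreducible quotient of `j_! (1_a M)`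
(`WeaklyTriangular.isFullSetOfSimples_simples`).

*Strata.* Both stratifications are treated together. For the labelling `ρ` put `c = 1`, for `ρ̃`
let `c` be a block idempotent of `Ā_a`. In both cases `𝓡_{≤ l}` consists of the modules over
`A_{≤ a}` on which `c` acts as the identity of `1_a M`, and `𝓡_{< l}` of those among them with
`1_a M = 0` (`WeaklyTriangular.IsLabel.isStratum`). The truncation `M ↦ 1_a M` from `𝓡_{≤ l}` to the
finite dimensional `Ā_a`-modules on which `c` is the identity has adjoints `j_!` and `j_*`, both
fully faithful, so it is a localization, and by the universal property it is the Serre quotient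
`𝓡_{≤ l} → 𝓡_l`. Thus the adjoints of the latter are `j_!` and `j_*` as well
(`WeaklyTriangular.IsStratum.equiv`), and all four families of objects are the ones claimed.

*Flags.* Let `P = Ā_a h` be the projective cover of a simple module `S`, with `h` an idempotent.
It lifts to an idempotent `f` of `1_a A 1_a`, and `A f` is projective in `A`-lfdmod. Filter `A f` by
the submodules generated by the weight spaces in finite upper sets. By the last two of the
properties above, the section at `g` is `j_!` of a projective `Ā_g`-module
(`WeaklyTriangular.exists_std_iso_layerSub_span`), and by exactness of `j_!` it has a filtration by
modules of either kind `j_! P_g(μ)` or `j_! L_g(μ)`, as prescribed by the sign function; the top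
section is `j_! P` or `j_! S` (`WeaklyTriangular.hasProjectiveFlags`).

*Semisimple case.* A block of a semisimple algebra has a single simple module `S` up to isomorphism
(`Block.nonempty_linearEquiv`), and by Schur's lemma `Hom(S, -)` is an equivalence from the modules
in the block to finite dimensional vector spaces (`homFunctor`).
-/

noncomputable section

/-! ### Induction and coinduction along an idempotent -/

section CornerTheory

variable {R : Type u} [Ring R] {e : R} (he : IsIdempotentElem e)

namespace CornerRing

@[simp] lemma val_one : (1 : he.Corner).1 = e := rfl
@[simp] lemma val_mul (a b : he.Corner) : (a * b).1 = a.1 * b.1 := rfl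
@[simp] lemma val_add (a b : he.Corner) : (a + b).1 = a.1 + b.1 := rfl
@[simp] lemma val_zero : (0 : he.Corner).1 = 0 := rfl
lemma e_mul (a : he.Corner) : e * a.1 = a.1 := ((Subsemigroup.mem_corner_iff he).mp a.2).1
lemma mul_e (a : he.Corner) : a.1 * e = a.1 := ((Subsemigroup.mem_corner_iff he).mp a.2).2

/-- The element `e x e` of the corner ring `e R e`. -/
def mk (x : R) : he.Corner := ⟨e * x * e, x, rfl⟩

@[simp] lemma val_mk (x : R) : (mk he x).1 = e * x * e := rfl

lemma mk_val (a : he.Corner) : mk he a.1 = a :=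
  Subtype.ext (by rw [val_mk, e_mul, mul_e])

/-- Truncation `x ↦ e x e` as an additive map. -/
def mkHom : R →+ he.Corner where
  toFun := mk he
  map_zero' := Subtype.ext (by simp)
  map_add' x y := Subtype.ext (by simp [mul_add, add_mul])

instance {k : Type v} [Field k] [Algebra k R] : Algebra k he.Corner :=
  letI : Module k he.Corner :=
    { smul c a := ⟨c • a.1, c • a.1, by
        change e * (c • a.1) * e = c • a.1
        rw [mul_smul_comm, smul_mul_assoc, e_mul, mul_e]⟩
      one_smul a := Subtype.ext (one_smul k a.1)
      mul_smul c d a := Subtype.ext (mul_smul c d a.1)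
      smul_zero c := Subtype.ext (smul_zero c)
      smul_add c a b := Subtype.ext (smul_add c a.1 b.1)
      add_smul c d a := Subtype.ext (add_smul c d a.1)
      zero_smul a := Subtype.ext (zero_smul k a.1) }
  Algebra.ofModule (fun c a b => Subtype.ext (smul_mul_assoc c a.1 b.1))
    (fun c a b => Subtype.ext (mul_smul_comm c a.1 b.1))

end CornerRing

open CornerRing

/-- The subgroup `e M` of an `R`-module `M`, a module over the corner ring `e R e`. -/
def cornerPart (_ : IsIdempotentElem e) (M : Type v) [AddCommGroup M] [Module R M] :
    AddSubgroup M where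
  carrier := {m | e • m = m}
  zero_mem' := smul_zero e
  add_mem' {m n} hm hn := by
    have hm' : e • m = m := hm
    have hn' : e • n = n := hn
    change e • (m + n) = m + n
    rw [smul_add, hm', hn']
  neg_mem' {m} hm := by
    have hm' : e • m = m := hm
    change e • (-m) = -m
    rw [smul_neg, hm']

section cornerPart

variable {M : Type v} [AddCommGroup M] [Module R M]

lemma e_smul_cornerPart (m : cornerPart he M) : e • m.1 = m.1 := m.2

lemma e_smul_mem (m : M) : e • m ∈ cornerPart he M := by
  change e • e • m = e • m
  rw [← mul_smul, he.eq]

instance : Module he.Corner (cornerPart he M) where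
  smul h m := ⟨h.1 • m.1, by
    change e • h.1 • m.1 = h.1 • m.1
    rw [← mul_smul, e_mul]⟩
  one_smul m := Subtype.ext m.2
  mul_smul a b m := Subtype.ext (mul_smul a.1 b.1 m.1)
  smul_zero a := Subtype.ext (smul_zero a.1)
  smul_add a m n := Subtype.ext (smul_add a.1 m.1 n.1)
  add_smul a b m := Subtype.ext (add_smul a.1 b.1 m.1)
  zero_smul m := Subtype.ext (zero_smul R m.1)

@[simp] lemma cornerPart_smul_val (h : he.Corner) (m : cornerPart he M) :
    (h • m).1 = h.1 • m.1 := rfl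

/-- Multiplication by `e`, as a map `M → e M`. -/
def toCornerPart (m : M) : cornerPart he M := ⟨e • m, e_smul_mem he m⟩

/-- The functor `M ↦ e M` on morphisms. -/
def cornerMap {N : Type v'} [AddCommGroup N] [Module R N] (f : M →ₗ[R] N) :
    cornerPart he M →ₗ[he.Corner] cornerPart he N where
  toFun m := ⟨f m.1, by
    change e • f m.1 = f m.1
    rw [← map_smul, e_smul_cornerPart]⟩
  map_add' m n := Subtype.ext (map_add f _ _)
  map_smul' h m := Subtype.ext (map_smul f h.1 m.1)

end cornerPart

namespace Induced

variable {V : Type v} [AddCommGroup V] [Module he.Corner V]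

/-- The element `x e ⊗ v` of `R e ⊗ V`. -/
def ten (x : R) (v : V) : Induced he V :=
  Submodule.Quotient.mk
    ((⟨x * e, Ideal.mul_mem_left _ _ (Ideal.mem_span_singleton_self e)⟩ :
      ↥(Ideal.span {e})) ⊗ₜ[ℤ] v)

lemma val_mul_e {e : R} (he : IsIdempotentElem e) (x : ↥(Ideal.span {e})) : x.1 * e = x.1 := by
  obtain ⟨r, hr⟩ := Ideal.mem_span_singleton'.1 x.2
  rw [← hr, mul_assoc, he.eq]

lemma mk_tmul (x : ↥(Ideal.span {e})) (v : V) :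
    (Submodule.Quotient.mk (x ⊗ₜ[ℤ] v) : Induced he V) = ten he x.1 v := by
  unfold ten
  congr 2
  exact Subtype.ext (val_mul_e he x).symm

lemma ten_add (x : R) (v w : V) : ten he x (v + w) = ten he x v + ten he x w := by
  unfold ten
  rw [TensorProduct.tmul_add, Submodule.Quotient.mk_add]

lemma add_ten (x y : R) (v : V) : ten he (x + y) v = ten he x v + ten he y v := by
  unfold ten
  rw [← Submodule.Quotient.mk_add, ← TensorProduct.add_tmul]
  congr 2
  exact Subtype.ext (add_mul x y e)

lemma smul_ten (r x : R) (v : V) : r • ten he x v = ten he (r * x) v := by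
  unfold ten
  rw [← Submodule.Quotient.mk_smul, TensorProduct.smul_tmul']
  congr 2
  exact Subtype.ext (by simp [mul_assoc])

@[simp] lemma ten_mul_e (x : R) (v : V) : ten he (x * e) v = ten he x v := by
  unfold ten
  congr 2
  exact Subtype.ext (by simp [mul_assoc, he.eq])

lemma ten_mul_corner (x : R) (h : he.Corner) (v : V) :
    ten he (x * h.1) v = ten he x (h • v) := by
  unfold ten
  rw [Submodule.Quotient.eq]
  refine Submodule.subset_span ⟨⟨x * e, Ideal.mul_mem_left _ _ (Ideal.mem_span_singleton_self e)⟩,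
    h, v, ?_⟩
  congr 2
  exact Subtype.ext (by simp [mul_assoc, e_mul, mul_e])

@[simp] lemma ten_zero (x : R) : ten he x (0 : V) = 0 := by
  unfold ten; rw [TensorProduct.tmul_zero]; rfl

lemma ten_eq_smul (x : R) (v : V) : ten he x v = x • ten he 1 v := by
  rw [smul_ten, mul_one]

lemma ten_e (v : V) : ten he e v = ten he 1 v := by
  rw [← ten_mul_e he 1, one_mul]

@[elab_as_elim]
lemma induction {p : Induced he V → Prop} (z : Induced he V) (zero : p 0)
    (ten : ∀ x v, p (ten he x v)) (add : ∀ z w, p z → p w → p (z + w)) : p z := by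
  obtain ⟨z, rfl⟩ := Submodule.Quotient.mk_surjective _ z
  induction z using TensorProduct.induction_on with
  | zero => exact zero
  | tmul x v => rw [mk_tmul]; exact ten x.1 v
  | add z w hz hw => rw [Submodule.Quotient.mk_add]; exact add _ _ hz hw

section liftAdd

variable {P : Type w} [AddCommGroup P]

/-- The additive map on `R e ⊗_ℤ V` given by a biadditive map. -/
def liftTensor (φ : R →+ V →+ P) : ↥(Ideal.span {e}) ⊗[ℤ] V →+ P :=
  TensorProduct.liftAddHom (φ.comp (Submodule.subtype (Ideal.span {e})).toAddMonoidHom)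
    (fun r m n => by
      change φ (r • m : ↥(Ideal.span {e})).1 n = φ m.1 (r • n)
      rw [map_zsmul, Submodule.coe_smul_of_tower, map_zsmul, AddMonoidHom.smul_apply])

lemma liftTensor_tmul (φ : R →+ V →+ P) (x : ↥(Ideal.span {e})) (v : V) :
    liftTensor φ (x ⊗ₜ[ℤ] v) = φ x.1 v := rfl

lemma liftTensor_balanced (φ : R →+ V →+ P)
    (hφ : ∀ x (h : he.Corner) v, φ (x * h.1) v = φ x (h • v)) (z : ↥(Ideal.span {e}) ⊗[ℤ] V)
    (hz : z ∈ balanced he V) : liftTensor φ z = 0 := by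
  refine Submodule.closure_induction (p := fun z _ => liftTensor φ z = 0) ?_ ?_ ?_ hz
  · exact map_zero _
  · intro x y _ _ hx hy
    rw [map_add, hx, hy, add_zero]
  · rintro r _ ⟨x, h, v, rfl⟩
    rw [smul_sub, TensorProduct.smul_tmul', TensorProduct.smul_tmul', map_sub, liftTensor_tmul,
      liftTensor_tmul, sub_eq_zero]
    change φ (r * (x.1 * h.1)) v = φ (r * x.1) (h • v)
    rw [← mul_assoc, hφ]

/-- An additive map out of `R e ⊗ V`, given by a balanced biadditive map. -/
def liftAdd (φ : R →+ V →+ P) (hφ : ∀ x (h : he.Corner) v, φ (x * h.1) v = φ x (h • v)) :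
    Induced he V →+ P :=
  QuotientAddGroup.lift (balanced he V).toAddSubgroup (liftTensor φ)
    (fun z hz => liftTensor_balanced he φ hφ z hz)

lemma liftAdd_ten (φ : R →+ V →+ P) (hφ) (x : R) (v : V) :
    liftAdd he φ hφ (ten he x v) = φ x v := by
  change φ (x * e) v = φ x v
  have := hφ x 1 v
  rwa [one_smul] at this

end liftAdd

/-- The map `R e ⊗ V → V`, `x ⊗ v ↦ (e x) v`, whose restriction to `e (R e ⊗ V)` is inverse to
`v ↦ e ⊗ v`. -/
def proj : Induced he V →+ V :=
  liftAdd he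
    (AddMonoidHom.mk' (fun x => (DistribSMul.toAddMonoidHom V (mk he x)))
      (fun x y => by
        ext v
        have : mk he (x + y) = mk he x + mk he y := map_add (mkHom he) x y
        simp [this, add_smul]))
    (fun x h v => by
      change mk he (x * h.1) • v = mk he x • h • v
      rw [← mul_smul]
      congr 1
      exact Subtype.ext (by simp [mul_assoc, e_mul, mul_e]))

@[simp] lemma proj_ten (x : R) (v : V) : proj he (ten he x v) = mk he x • v :=
  liftAdd_ten he _ _ x v

lemma e_smul_eq (z : Induced he V) : e • z = ten he 1 (proj he z) := by
  induction z using induction he with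
  | zero => simp
  | ten x v =>
    rw [proj_ten, ← ten_mul_corner, smul_ten, one_mul, val_mk, ten_mul_e]
  | add z w hz hw => rw [smul_add, hz, hw, map_add, ten_add]

lemma proj_ten_one (v : V) : proj he (ten he 1 v) = v := by
  rw [proj_ten]
  have : mk he (1 : R) = 1 := Subtype.ext (by simp [he.eq])
  rw [this, one_smul]

/-- `V` is recovered from `R e ⊗ V` as `e (R e ⊗ V)`. -/
def cornerEquiv : V ≃ₗ[he.Corner] cornerPart he (Induced he V) where
  toFun v := ⟨ten he 1 v, by
    change e • ten he 1 v = _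
    rw [smul_ten, mul_one, ten_e]⟩
  map_add' v w := Subtype.ext (ten_add he 1 v w)
  map_smul' h v := Subtype.ext (by
    change ten he 1 (h • v) = h.1 • ten he 1 v
    rw [smul_ten, mul_one, ← ten_mul_corner, one_mul])
  invFun z := proj he z.1
  left_inv v := proj_ten_one he v
  right_inv z := Subtype.ext (by
    change ten he 1 (proj he z.1) = z.1
    rw [← e_smul_eq, e_smul_cornerPart])

section lift

variable {M : Type w} [AddCommGroup M] [Module R M]

/-- The biadditive map `(x, v) ↦ x f(v)`. -/
def liftBilin (f : V →ₗ[he.Corner] cornerPart he M) : R →+ V →+ M :=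
  AddMonoidHom.mk' (fun x => (DistribSMul.toAddMonoidHom M x).comp
    ((cornerPart he M).subtype.comp f.toAddMonoidHom)) (fun x y => by ext v; simp [add_smul])

lemma liftBilin_balanced (f : V →ₗ[he.Corner] cornerPart he M) (x : R) (h : he.Corner) (v : V) :
    liftBilin he f (x * h.1) v = liftBilin he f x (h • v) := by
  change (x * h.1) • (f v).1 = x • (f (h • v)).1
  rw [map_smul, cornerPart_smul_val, mul_smul]

/-- The `R`-linear map `R e ⊗ V → M` extending a map `V → e M`. -/
def lift (f : V →ₗ[he.Corner] cornerPart he M) : Induced he V →ₗ[R] M where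
  toFun := liftAdd he (liftBilin he f) (fun x h v => liftBilin_balanced he f x h v)
  map_add' := map_add _
  map_smul' r z := by
    induction z using induction he with
    | zero => simp
    | ten x v =>
      rw [smul_ten, liftAdd_ten, RingHom.id_apply, liftAdd_ten]
      exact mul_smul r x _
    | add z w hz hw => rw [smul_add, map_add, hz, hw, map_add, smul_add]

@[simp] lemma lift_ten (f : V →ₗ[he.Corner] cornerPart he M) (x : R) (v : V) :
    lift he f (ten he x v) = x • (f v).1 :=
  liftAdd_ten he (liftBilin he f) (fun x h v => liftBilin_balanced he f x h v) x v

/-- Induction is left adjoint to `M ↦ e M`. -/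
def homEquiv : (Induced he V →ₗ[R] M) ≃ (V →ₗ[he.Corner] cornerPart he M) where
  toFun g := (cornerMap he g).comp (cornerEquiv he).toLinearMap
  invFun := lift he
  left_inv g := by
    refine LinearMap.ext fun z => ?_
    induction z using induction he with
    | zero => simp
    | ten x v =>
      rw [lift_ten]
      change x • g (ten he 1 v) = _
      rw [← map_smul, smul_ten, mul_one]
    | add z w hz hw => rw [map_add, hz, hw, map_add]
  right_inv f := by
    ext v
    refine (lift_ten he f 1 v).trans ?_
    rw [one_smul]

end lift

/-- Functoriality of induction. -/
def map {W : Type v'} [AddCommGroup W] [Module he.Corner W] (f : V →ₗ[he.Corner] W) :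
    Induced he V →ₗ[R] Induced he W :=
  lift he ((cornerEquiv he).toLinearMap.comp f)

@[simp] lemma map_ten {W : Type v'} [AddCommGroup W] [Module he.Corner W]
    (f : V →ₗ[he.Corner] W) (x : R) (v : V) : map he f (ten he x v) = ten he x (f v) := by
  refine (lift_ten he _ x v).trans ?_
  change x • ten he 1 (f v) = _
  rw [smul_ten, mul_one]

lemma proj_map {W : Type v'} [AddCommGroup W] [Module he.Corner W]
    (f : V →ₗ[he.Corner] W) (z : Induced he V) : proj he (map he f z) = f (proj he z) := by
  induction z using induction he with
  | zero => simp
  | ten x v => rw [map_ten, proj_ten, proj_ten, map_smul]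
  | add z w hz hw => simp only [map_add, hz, hw]

lemma map_surjective {W : Type v'} [AddCommGroup W] [Module he.Corner W]
    (f : V →ₗ[he.Corner] W) (hf : Function.Surjective f) : Function.Surjective (map he f) := by
  intro z
  induction z using induction he with
  | zero => exact ⟨0, map_zero _⟩
  | ten x w => obtain ⟨v, rfl⟩ := hf w; exact ⟨ten he x v, map_ten he f x v⟩
  | add z w hz hw =>
    obtain ⟨a, rfl⟩ := hz
    obtain ⟨b, rfl⟩ := hw
    exact ⟨a + b, map_add _ _ _⟩

/-- Induction is right exact. -/
lemma ker_map_le {W : Type v'} [AddCommGroup W] [Module he.Corner W] {K : Type w'}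
    [AddCommGroup K] [Module he.Corner K] (i : K →ₗ[he.Corner] V) (f : V →ₗ[he.Corner] W)
    (hf : Function.Surjective f) (hi : ∀ v, f v = 0 → ∃ x, i x = v) (z : Induced he V)
    (hz : map he f z = 0) : ∃ y, map he i y = z := by
  change z ∈ LinearMap.range (map he i)
  set N := LinearMap.range (map he i) with hN
  -- a section of `Re ⊗ V / N → Re ⊗ W`
  let s : W → V := Function.surjInv hf
  have hs : ∀ w, f (s w) = w := Function.surjInv_eq hf
  have key : ∀ x (v v' : V), f v = f v' → N.mkQ (ten he x v) = N.mkQ (ten he x v') := by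
    intro x v v' h
    rw [← sub_eq_zero, ← map_sub, Submodule.mkQ_apply, Submodule.Quotient.mk_eq_zero]
    obtain ⟨y, hy⟩ := hi (v - v') (by rw [map_sub, h, sub_self])
    refine ⟨ten he x y, ?_⟩
    rw [map_ten, hy]
    have := ten_add he x (v - v') v'
    rw [sub_add_cancel] at this
    rw [this]; simp
  let φ : R →+ W →+ (Induced he V ⧸ N) :=
    AddMonoidHom.mk' (fun x => AddMonoidHom.mk' (fun w => N.mkQ (ten he x (s w)))
      (fun a b => by
        rw [← map_add, ← ten_add]
        exact key _ _ _ (by simp [hs])))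
      (fun x y => by
        ext w
        change N.mkQ _ = N.mkQ _ + N.mkQ _
        rw [add_ten, map_add])
  let g : Induced he W →+ (Induced he V ⧸ N) := liftAdd he φ (fun x h w => by
    change N.mkQ _ = N.mkQ _
    rw [ten_mul_corner]
    exact key _ _ _ (by simp [hs]))
  have hg : ∀ z, g (map he f z) = N.mkQ z := by
    intro z
    induction z using induction he with
    | zero => simp
    | ten x v =>
      rw [map_ten, liftAdd_ten]
      exact key _ _ _ (by simp [hs])
    | add z w hz hw => simp only [map_add, hz, hw]
  have := hg z
  rw [hz, map_zero] at this
  exact (Submodule.Quotient.mk_eq_zero N).1 this.symm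

end Induced

namespace Coinduced

variable {V : Type v} [AddCommGroup V] [Module he.Corner V]

lemma smul_apply (r : R) (f : Coinduced he V) (x : R) : (r • f).1 x = f.1 (x * r) := rfl

lemma map_corner_mul (f : Coinduced he V) (h : he.Corner) (x : R) : f.1 (h.1 * x) = h • f.1 x :=
  f.2 h x

lemma map_e_mul (f : Coinduced he V) (x : R) : f.1 (e * x) = f.1 x := by
  have := f.2 1 x
  rwa [one_smul] at this

variable {M : Type w} [AddCommGroup M] [Module R M]

/-- The `R`-linear map `M → Hom(eR, V)` corresponding to `e M → V`. -/
def lift (g : cornerPart he M →ₗ[he.Corner] V) : M →ₗ[R] Coinduced he V where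
  toFun m := ⟨AddMonoidHom.mk' (fun x => g (toCornerPart he (x • m)))
      (fun x y => by
        rw [← map_add]; congr 1
        exact Subtype.ext (by simp [toCornerPart, add_smul, smul_add])), fun h x => by
      change g _ = h • g _
      rw [← map_smul]; congr 1
      refine Subtype.ext ?_
      change e • (h.1 * x) • m = h.1 • e • x • m
      have h1 : e * (h.1 * x) = h.1 * (e * x) := by
        rw [← mul_assoc, ← mul_assoc, e_mul, mul_e]
      rw [← mul_smul, h1, mul_smul, mul_smul]⟩
  map_add' m n := Subtype.ext (AddMonoidHom.ext fun x => by
    change g _ = g _ + g _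
    rw [← map_add]; congr 1
    exact Subtype.ext (by simp [toCornerPart, smul_add]))
  map_smul' r m := Subtype.ext (AddMonoidHom.ext fun x => by
    change g _ = g _
    congr 1
    exact Subtype.ext (by simp [toCornerPart, mul_smul]))

/-- Coinduction is right adjoint to `M ↦ e M`. -/
def homEquiv : (cornerPart he M →ₗ[he.Corner] V) ≃ (M →ₗ[R] Coinduced he V) where
  toFun := lift he
  invFun f :=
    { toFun := fun m => (f m.1).1 1
      map_add' := fun m n => by simp
      map_smul' := fun h m => by
        change (f (h.1 • m.1)).1 1 = h • (f m.1).1 1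
        rw [map_smul, smul_apply, one_mul, ← map_corner_mul, mul_one] }
  left_inv g := by
    ext m
    change g (toCornerPart he ((1 : R) • m.1)) = g m
    congr 1
    exact Subtype.ext (by simp [toCornerPart, e_smul_cornerPart])
  right_inv f := by
    ext m x
    change (f (e • x • m)).1 1 = (f m).1 x
    rw [map_smul, map_smul, smul_apply, smul_apply, one_mul, map_e_mul]

end Coinduced

end CornerTheory

/-! ### Two-sided coordinates for a stratifying idempotent -/

section Coordinates

open CornerRing

variable {R : Type u} [Ring R] {e : R}

/-- Two-sided coordinates for the ideal `R e R`: elements `y i ∈ R e` and `w j ∈ e R`, with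
idempotents `f i, g j ∈ e R e` satisfying `y i * f i = y i` and `g j * w j = w j`, such that
`R e = ∑ y i (e R e)`, `e R = ∑ (e R e) w j`, and the sum `∑ y i (f i (e R e) g j) w j` is direct,
each `f i (e R e) g j` embedding in it. -/
structure CornerCoords (he : IsIdempotentElem e) (ι : Type v) (κ : Type w) where
  /-- generators of the right `e R e`-module `R e` -/
  y : ι → R
  /-- generators of the left `e R e`-module `e R` -/
  w : κ → R
  /-- the left idempotents -/
  f : ι → he.Corner
  /-- the right idempotents -/
  g : κ → he.Corner
  f_idem : ∀ i, f i * f i = f i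
  g_idem : ∀ j, g j * g j = g j
  y_f : ∀ i, y i * (f i).1 = y i
  g_w : ∀ j, (g j).1 * w j = w j
  span_left : ∀ x : R, ∃ a : ι →₀ he.Corner, x * e = a.sum fun i a => y i * a.1
  span_right : ∀ x : R, ∃ a : κ →₀ he.Corner, e * x = a.sum fun j a => a.1 * w j
  indep : ∀ (s : Finset ι) (t : Finset κ) (a : ι → κ → he.Corner),
    (∀ i j, f i * a i j = a i j) → (∀ i j, a i j * g j = a i j) →
    ∑ i ∈ s, ∑ j ∈ t, y i * (a i j).1 * w j = 0 → ∀ i ∈ s, ∀ j ∈ t, a i j = 0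

namespace CornerCoords

variable {he : IsIdempotentElem e} {ι : Type v} {κ : Type w} (X : CornerCoords he ι κ)

lemma e_w (j : κ) : e * X.w j = X.w j := by
  rw [← X.g_w j, ← mul_assoc, e_mul]

lemma exists_left (x : R) : ∃ a : ι →₀ he.Corner, (∀ i, X.f i * a i = a i) ∧
    x * e = a.sum fun i a => X.y i * a.1 := by
  obtain ⟨a, ha⟩ := X.span_left x
  let b : ι →₀ he.Corner := Finsupp.onFinset a.support (fun i => X.f i * a i) (fun i hi => by
    rw [Finsupp.mem_support_iff]
    rintro h
    exact hi (by rw [h, mul_zero]))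
  refine ⟨b, fun i => ?_, ?_⟩
  · change X.f i * (X.f i * a i) = X.f i * a i
    rw [← mul_assoc, X.f_idem]
  · rw [ha, Finsupp.sum, Finsupp.sum_of_support_subset b Finsupp.support_onFinset_subset _
      (fun i _ => by rw [val_zero, mul_zero])]
    refine Finset.sum_congr rfl fun i _ => ?_
    change _ = X.y i * ((X.f i).1 * (a i).1)
    rw [← mul_assoc, X.y_f]

lemma exists_right (x : R) : ∃ a : κ →₀ he.Corner, (∀ j, a j * X.g j = a j) ∧
    e * x = a.sum fun j a => a.1 * X.w j := by
  obtain ⟨a, ha⟩ := X.span_right x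
  let b : κ →₀ he.Corner := Finsupp.onFinset a.support (fun i => a i * X.g i) (fun i hi => by
    rw [Finsupp.mem_support_iff]
    rintro h
    exact hi (by rw [h, zero_mul]))
  refine ⟨b, fun i => ?_, ?_⟩
  · change (a i * X.g i) * X.g i = a i * X.g i
    rw [mul_assoc, X.g_idem]
  · rw [ha, Finsupp.sum, Finsupp.sum_of_support_subset b Finsupp.support_onFinset_subset _
      (fun i _ => by rw [val_zero, zero_mul])]
    refine Finset.sum_congr rfl fun i _ => ?_
    change _ = ((a i).1 * (X.g i).1) * X.w i
    rw [mul_assoc, X.g_w]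

/-- The `y i` are independent over `e R` on the right. -/
lemma indep_left (s : Finset ι) (b : ι → R) (he' : ∀ i, e * b i = b i)
    (hb : ∀ i, (X.f i).1 * b i = b i) (h : ∑ i ∈ s, X.y i * b i = 0) : ∀ i ∈ s, b i = 0 := by
  classical
  choose a ha hs using fun i => X.exists_right (b i)
  let t := s.biUnion fun i => (a i).support
  have hsum : ∀ i ∈ s, b i = ∑ j ∈ t, (X.f i * a i j).1 * X.w j := by
    intro i hi
    rw [← hb i, ← he' i, hs i, Finsupp.sum_of_support_subset (a i)
      (Finset.subset_biUnion_of_mem (fun i => (a i).support) hi) _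
      (fun j _ => by rw [val_zero, zero_mul]), Finset.mul_sum]
    exact Finset.sum_congr rfl fun j _ => (mul_assoc _ _ _).symm
  have key := X.indep s t (fun i j => X.f i * a i j)
    (fun i j => by rw [← mul_assoc, X.f_idem]) (fun i j => by rw [mul_assoc, ha]) (by
      rw [← h]
      refine Finset.sum_congr rfl fun i hi => ?_
      rw [hsum i hi, Finset.mul_sum]
      exact Finset.sum_congr rfl fun j _ => mul_assoc _ _ _)
  intro i hi
  rw [hsum i hi]
  exact Finset.sum_eq_zero fun j hj => by rw [key i hi j hj, val_zero, zero_mul]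

/-- The `w j` are independent over `R e` on the left. -/
lemma indep_right (t : Finset κ) (b : κ → R) (he' : ∀ j, b j * e = b j)
    (hb : ∀ j, b j * (X.g j).1 = b j) (h : ∑ j ∈ t, b j * X.w j = 0) : ∀ j ∈ t, b j = 0 := by
  classical
  choose a ha hs using fun j => X.exists_left (b j)
  let s := t.biUnion fun j => (a j).support
  have hsum : ∀ j ∈ t, b j = ∑ i ∈ s, X.y i * (a j i * X.g j).1 := by
    intro j hj
    rw [← hb j, ← he' j, hs j, Finsupp.sum_of_support_subset (a j)
      (Finset.subset_biUnion_of_mem (fun j => (a j).support) hj) _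
      (fun i _ => by rw [val_zero, mul_zero]), Finset.sum_mul]
    exact Finset.sum_congr rfl fun i _ => mul_assoc _ _ _
  have key := X.indep s t (fun i j => a j i * X.g j)
    (fun i j => by rw [← mul_assoc, ha]) (fun i j => by rw [mul_assoc, X.g_idem]) (by
      rw [← h, Finset.sum_comm]
      refine Finset.sum_congr rfl fun j hj => ?_
      rw [hsum j hj, Finset.sum_mul])
  intro j hj
  rw [hsum j hj]
  exact Finset.sum_eq_zero fun i hi => by rw [key i hi j hj, val_zero, mul_zero]

lemma left_unique (a b : ι →₀ he.Corner) (ha : ∀ i, X.f i * a i = a i)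
    (hb : ∀ i, X.f i * b i = b i)
    (h : (a.sum fun i a => X.y i * a.1) = b.sum fun i a => X.y i * a.1) : a = b := by
  classical
  rw [Finsupp.sum_of_support_subset a Finset.subset_union_left _
      (fun i _ => by rw [val_zero, mul_zero]),
    Finsupp.sum_of_support_subset b (Finset.subset_union_right (s₁ := a.support)) _
      (fun i _ => by rw [val_zero, mul_zero]), ← sub_eq_zero, ← Finset.sum_sub_distrib] at h
  have := X.indep_left _ (fun i => (a i).1 - (b i).1)
    (fun i => by rw [mul_sub, e_mul, e_mul])
    (fun i => by rw [mul_sub, ← val_mul, ← val_mul, ha, hb]) (by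
      rw [← h]; exact Finset.sum_congr rfl fun i _ => mul_sub _ _ _)
  ext i
  by_cases hi : i ∈ a.support ∪ b.support
  · exact Subtype.ext (sub_eq_zero.1 (this i hi))
  · rw [Finset.mem_union, not_or, Finsupp.notMem_support_iff, Finsupp.notMem_support_iff] at hi
    rw [hi.1, hi.2]

lemma right_unique (a b : κ →₀ he.Corner) (ha : ∀ i, a i * X.g i = a i)
    (hb : ∀ i, b i * X.g i = b i)
    (h : (a.sum fun i a => a.1 * X.w i) = b.sum fun i a => a.1 * X.w i) : a = b := by
  classical
  rw [Finsupp.sum_of_support_subset a Finset.subset_union_left _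
      (fun i _ => by rw [val_zero, zero_mul]),
    Finsupp.sum_of_support_subset b (Finset.subset_union_right (s₁ := a.support)) _
      (fun i _ => by rw [val_zero, zero_mul]), ← sub_eq_zero, ← Finset.sum_sub_distrib] at h
  have := X.indep_right _ (fun i => (a i).1 - (b i).1)
    (fun i => by rw [sub_mul, mul_e, mul_e])
    (fun i => by rw [sub_mul, ← val_mul, ← val_mul, ha, hb]) (by
      rw [← h]; exact Finset.sum_congr rfl fun i _ => sub_mul _ _ _)
  ext i
  by_cases hi : i ∈ a.support ∪ b.support
  · exact Subtype.ext (sub_eq_zero.1 (this i hi))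
  · rw [Finset.mem_union, not_or, Finsupp.notMem_support_iff, Finsupp.notMem_support_iff] at hi
    rw [hi.1, hi.2]

/-- The coordinates of `x e` with respect to the `y i`. -/
def coord (x : R) : ι →₀ he.Corner := (X.exists_left x).choose

lemma f_coord (x : R) (i : ι) : X.f i * X.coord x i = X.coord x i :=
  (X.exists_left x).choose_spec.1 i

lemma coord_sum (x : R) : ((X.coord x).sum fun i a => X.y i * a.1) = x * e :=
  (X.exists_left x).choose_spec.2.symm

lemma coord_add (x x' : R) : X.coord (x + x') = X.coord x + X.coord x' := by
  classical
  refine X.left_unique _ _ (X.f_coord _) (fun i => ?_) ?_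
  · rw [Finsupp.add_apply, mul_add, f_coord, f_coord]
  · rw [Finsupp.sum_add_index (fun i _ => by rw [val_zero, mul_zero])
      (fun i _ a b => by rw [val_add, mul_add]), coord_sum, coord_sum, coord_sum, add_mul]

/-- Coordinates are linear for the right action of `e R e`. -/
lemma coord_mul (x : R) (h : he.Corner) (i : ι) : X.coord (x * h.1) i = X.coord x i * h := by
  let b : ι →₀ he.Corner := (X.coord x).mapRange (fun a => a * h) (zero_mul h)
  have : X.coord (x * h.1) = b := by
    refine X.left_unique _ _ (X.f_coord _) (fun i => ?_) ?_
    · change X.f i * (X.coord x i * h) = X.coord x i * h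
      rw [← mul_assoc, f_coord]
    · rw [coord_sum, Finsupp.sum_mapRange_index (fun i => by rw [val_zero, mul_zero]), mul_assoc,
        mul_e]
      have := congrArg (· * h.1) (X.coord_sum x)
      rw [Finsupp.sum_mul, mul_assoc, e_mul] at this
      rw [← this]
      exact Finsupp.sum_congr fun i _ => (mul_assoc (X.y i) (X.coord x i).1 h.1)
  rw [this]; rfl

section Induced

variable {V : Type v'} [AddCommGroup V] [Module he.Corner V]

/-- Coordinates on `R e ⊗ V` with respect to the `y i`. -/
def coordV : Induced he V →+ (ι →₀ V) :=
  Induced.liftAdd he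
    (AddMonoidHom.mk' (fun x => AddMonoidHom.mk'
        (fun v => (X.coord x).mapRange (fun a => a • v) (zero_smul _ v))
        (fun v w => by ext i; simp))
      (fun x x' => by ext v i; simp [X.coord_add, add_smul]))
    (fun x h v => by
      ext i
      change X.coord (x * h.1) i • v = X.coord x i • h • v
      rw [coord_mul, mul_smul])

lemma coordV_ten (x : R) (v : V) (i : ι) : X.coordV (Induced.ten he x v) i = X.coord x i • v := by
  rw [coordV, Induced.liftAdd_ten]; rfl

lemma coordV_sum (z : Induced he V) :
    ((X.coordV z).sum fun i v => Induced.ten he (X.y i) v) = z := by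
  classical
  induction z using Induced.induction he with
  | zero => simp
  | ten x v =>
    rw [Finsupp.sum_of_support_subset (s := (X.coord x).support) _ ?_ _
      (fun i _ => (Induced.ten_zero he (X.y i) : Induced.ten he (X.y i) (0 : V) = 0))]
    · have := congrArg (fun r => Induced.ten he r v) (X.coord_sum x)
      simp only [Induced.ten_mul_e] at this
      conv_rhs => rw [← this, Finsupp.sum]
      let F : R →+ Induced he V := AddMonoidHom.mk' (fun r => Induced.ten he r v)
        (fun r r' => Induced.add_ten he r r' v)
      refine Eq.trans ?_ (map_sum F _ _).symm
      refine Finset.sum_congr rfl fun i _ => ?_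
      rw [coordV_ten]
      exact (Induced.ten_mul_corner he (X.y i) (X.coord x i) v).symm
    · intro i hi
      rw [Finsupp.mem_support_iff, coordV_ten] at hi
      rw [Finsupp.mem_support_iff]
      rintro h
      exact hi (by rw [h]; exact zero_smul he.Corner v)
  | add z w hz hw =>
    rw [map_add, Finsupp.sum_add_index
      (fun i _ => (Induced.ten_zero he (X.y i) : Induced.ten he (X.y i) (0 : V) = 0))
      (fun i _ a b => Induced.ten_add he _ a b), hz, hw]

lemma f_coordV (z : Induced he V) (i : ι) : X.f i • X.coordV z i = X.coordV z i := by
  induction z using Induced.induction he with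
  | zero => simp
  | ten x v => rw [coordV_ten, ← mul_smul, f_coord]
  | add z w hz hw => rw [map_add, Finsupp.add_apply, smul_add, hz, hw]

lemma coordV_map {W : Type w'} [AddCommGroup W] [Module he.Corner W]
    (φ : V →ₗ[he.Corner] W)
    (z : Induced he V) (i : ι) : X.coordV (Induced.map he φ z) i = φ (X.coordV z i) := by
  induction z using Induced.induction he with
  | zero => simp
  | ten x v => rw [Induced.map_ten, coordV_ten, coordV_ten, map_smul]
  | add z w hz hw => simp only [map_add, Finsupp.add_apply, hz, hw]

lemma eq_zero_of_coordV (z : Induced he V) (h : ∀ i, X.coordV z i = 0) : z = 0 := by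
  rw [← X.coordV_sum z]
  exact Finset.sum_eq_zero fun i _ => by
    change Induced.ten he (X.y i) (X.coordV z i) = 0
    rw [h i, Induced.ten_zero]

/-- Induction is exact, as `R e` is a projective right `e R e`-module. -/
lemma map_injective (X : CornerCoords he ι κ) {W : Type w'} [AddCommGroup W] [Module he.Corner W]
    (φ : V →ₗ[he.Corner] W)
    (hφ : Function.Injective φ) : Function.Injective (Induced.map he φ) := by
  rw [injective_iff_map_eq_zero]
  intro z hz
  refine X.eq_zero_of_coordV z fun i => hφ ?_
  rw [← coordV_map, hz, map_zero, map_zero, Finsupp.coe_zero, Pi.zero_apply]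

end Induced

/-- Multiplication `R e ⊗ e R → R` is injective. -/
lemma lift_id_injective (X : CornerCoords he ι κ) : Function.Injective
    (Induced.lift he (M := R) (LinearMap.id : cornerPart he R →ₗ[he.Corner] cornerPart he R)) := by
  rw [injective_iff_map_eq_zero]
  intro z hz
  refine X.eq_zero_of_coordV z ?_
  have h1 := X.coordV_sum z
  have h2 : ∑ i ∈ (X.coordV z).support, X.y i * (X.coordV z i).1 = 0 := by
    rw [← hz]
    conv_rhs => rw [← h1]
    rw [Finsupp.sum, map_sum]
    refine Finset.sum_congr rfl fun i _ => ?_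
    rw [Induced.lift_ten]; rfl
  have := X.indep_left _ (fun i => (X.coordV z i).1) (fun i => (X.coordV z i).2)
    (fun i => congrArg Subtype.val (X.f_coordV z i)) h2
  intro i
  by_cases hi : i ∈ (X.coordV z).support
  · exact Subtype.ext (this i hi)
  · exact Finsupp.notMem_support_iff.1 hi

/-- For a left ideal `N` of `R`, multiplication `R e ⊗ e N → N` is injective. -/
lemma lift_injective_of_injective (X : CornerCoords he ι κ) {N : Type v'} [AddCommGroup N] [Module R N]
    (φ : N →ₗ[R] R)
    (hφ : ∀ n ∈ cornerPart he N, φ n = 0 → n = 0) : Function.Injective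
    (Induced.lift he (M := N) (LinearMap.id : cornerPart he N →ₗ[he.Corner] cornerPart he N)) := by
  have h1 : Function.Injective (cornerMap he φ) := by
    rw [injective_iff_map_eq_zero]
    intro n hn
    exact Subtype.ext (hφ n.1 n.2 (congrArg Subtype.val hn))
  have h2 := X.lift_id_injective.comp (X.map_injective _ h1)
  refine Function.Injective.of_comp (f := φ) ?_
  convert h2 using 1
  funext z
  change φ _ = Induced.lift he _ (Induced.map he _ z)
  induction z using Induced.induction he with
  | zero => simp
  | ten x v =>
    rw [Induced.lift_ten, Induced.map_ten, Induced.lift_ten, map_smul]; rfl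
  | add z w hz hw => simp only [map_add, hz, hw]

/-- The left `e R e`-module `e R` is projective. -/
lemma projective_cornerPart (X : CornerCoords he ι κ) :
    Module.Projective he.Corner (cornerPart he R) := by
  classical
  choose a ha hs using X.exists_right
  have hadd : ∀ x x', a (x + x') = a x + a x' := fun x x' => by
    refine X.right_unique _ _ (ha _) (fun i => ?_) ?_
    · rw [Finsupp.add_apply, add_mul, ha, ha]
    · rw [Finsupp.sum_add_index (fun i _ => by rw [val_zero, zero_mul])
        (fun i _ a b => by rw [val_add, add_mul]), ← hs, ← hs, ← hs, mul_add]
  have hmul : ∀ (h : he.Corner) x, a (h.1 * x) = h • a (e * x) := fun h x => by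
    refine X.right_unique _ _ (ha _) (fun i => ?_) ?_
    · rw [Finsupp.smul_apply, smul_eq_mul, mul_assoc, ha]
    · rw [Finsupp.sum_smul_index' (fun i => by rw [val_zero, zero_mul]), ← hs, ← mul_assoc, e_mul]
      have := congrArg (h.1 * ·) (hs (e * x))
      rw [Finsupp.mul_sum] at this
      rw [← mul_assoc, ← mul_assoc, mul_e, mul_e] at this
      rw [this]
      exact Finsupp.sum_congr fun i _ => (mul_assoc _ _ _).symm
  let s : cornerPart he R →ₗ[he.Corner] (κ →₀ he.Corner) :=
    { toFun := fun x => a x.1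
      map_add' := fun x x' => hadd _ _
      map_smul' := fun h x => by
        change a (h.1 * x.1) = h • a x.1
        rw [hmul]
        congr 2
        exact x.2 }
  let p : (κ →₀ he.Corner) →ₗ[he.Corner] cornerPart he R :=
    Finsupp.linearCombination he.Corner (fun j => (⟨X.w j, X.e_w j⟩ : cornerPart he R))
  refine Module.Projective.of_split s p ?_
  ext x
  change (Finsupp.linearCombination he.Corner _ (a x.1) : cornerPart he R).1 = x.1
  rw [Finsupp.linearCombination_apply, Finsupp.sum, AddSubgroup.val_finsetSum]
  have := hs x.1
  rw [show e * x.1 = x.1 from x.2] at this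
  exact this.symm

end CornerCoords

end Coordinates

/-! ### The triangular basis theorem -/

section PBW

variable {k A J : Type u} [Field k] [NonUnitalRing A] [Module k A]
  [IsScalarTower k A A] [SMulCommClass k A A]

namespace LocallyUnital

variable (E : LocallyUnital k A J)

variable {E}

lemma e_mul_of_mem_block {B : Submodule k A} {a b : J} {z : A} (hz : z ∈ E.block B a b) :
    E.e a * z = z := by
  obtain ⟨x, -, rfl⟩ := hz
  change E.e a * (E.e a * (x * E.e b)) = E.e a * (x * E.e b)
  rw [← mul_assoc, E.idem]

lemma mul_e_of_mem_block {B : Submodule k A} {a b : J} {z : A} (hz : z ∈ E.block B a b) :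
    z * E.e b = z := by
  obtain ⟨x, -, rfl⟩ := hz
  change E.e a * (x * E.e b) * E.e b = E.e a * (x * E.e b)
  rw [mul_assoc, mul_assoc, E.idem]

lemma e_mul_of_mem_leftPart {B : Submodule k A} {a : J} {z : A} (hz : z ∈ E.leftPart B a) :
    E.e a * z = z := by
  obtain ⟨x, -, rfl⟩ := hz
  change E.e a * (E.e a * x) = E.e a * x
  rw [← mul_assoc, E.idem]

lemma mul_e_of_mem_rightPart {B : Submodule k A} {b : J} {z : A} (hz : z ∈ E.rightPart B b) :
    z * E.e b = z := by
  obtain ⟨x, -, rfl⟩ := hz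
  change (x * E.e b) * E.e b = x * E.e b
  rw [mul_assoc, E.idem]

lemma mul_e_mem_block {B : Submodule k A} {a : J} {z : A} (hz : z ∈ E.leftPart B a) (b : J) :
    z * E.e b ∈ E.block B a b := by
  obtain ⟨x, hx, rfl⟩ := hz
  exact ⟨x, hx, (mul_assoc _ _ _).symm⟩

lemma e_mul_mem_block {B : Submodule k A} {b : J} {z : A} (hz : z ∈ E.rightPart B b) (a : J) :
    E.e a * z ∈ E.block B a b := by
  obtain ⟨x, hx, rfl⟩ := hz
  exact ⟨x, hx, rfl⟩

end LocallyUnital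

namespace WeaklyTriangular

open LocallyUnital

variable {E : LocallyUnital k A J} {I : Type t} [PartialOrder I] (T : WeaklyTriangular E I)

lemma block_zero_eq_bot {p q : J} (h : T.cls p ≠ T.cls q) {z : A} (hz : z ∈ E.block T.zero p q) :
    z = 0 := by
  obtain ⟨x, hx, rfl⟩ := hz
  rw [T.zero_eq] at hx
  change E.e p * (x * E.e q) = 0
  refine Submodule.iSup_induction (p := _) (motive := fun x => E.e p * (x * E.e q) = 0) hx ?_ ?_ ?_
  · intro b x hx
    refine Submodule.iSup_induction (p := _) (motive := fun x => E.e p * (x * E.e q) = 0)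
      hx ?_ ?_ ?_
    · intro c x hx
      by_cases hbc : T.cls b = T.cls c
      · simp only [hbc, iSup_pos] at hx
        rw [← e_mul_of_mem_block hx, ← mul_e_of_mem_block hx]
        by_cases hp : p = b
        · have hq : c ≠ q := by
            rintro rfl; exact h (hp ▸ hbc)
          simp only [mul_assoc, E.orth c q hq, mul_zero]
        · simp only [← mul_assoc, E.orth p b hp, zero_mul]
      · simp only [hbc, iSup_neg, not_false_eq_true] at hx
        rw [Submodule.mem_bot] at hx
        rw [hx, zero_mul, mul_zero]
    · rw [zero_mul, mul_zero]
    · intro x y hx hy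
      rw [add_mul, mul_add, hx, hy, add_zero]
  · rw [zero_mul, mul_zero]
  · intro x y hx hy
    rw [add_mul, mul_add, hx, hy, add_zero]

lemma sandwich_diag {p q : J} {g : I} {z : A} (hz : z ∈ ⨆ c, ⨆ _ : T.cls c = g,
    Submodule.span k {E.e c}) : ∃ l : k, E.e p * (z * E.e q) = l • (E.e p * E.e q) := by
  refine Submodule.iSup_induction (p := _)
    (motive := fun z => ∃ l : k, E.e p * (z * E.e q) = l • (E.e p * E.e q)) hz ?_ ?_ ?_
  · intro c x hx
    by_cases hc : T.cls c = g
    · simp only [hc, iSup_pos] at hx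
      obtain ⟨l, rfl⟩ := Submodule.mem_span_singleton.1 hx
      by_cases hp : p = c
      · subst hp
        exact ⟨l, by rw [smul_mul_assoc, mul_smul_comm, ← mul_assoc, E.idem]⟩
      · exact ⟨0, by rw [smul_mul_assoc, mul_smul_comm, ← mul_assoc, E.orth p c hp, zero_mul,
          smul_zero, zero_smul]⟩
    · simp only [hc, iSup_neg, not_false_eq_true] at hx
      rw [Submodule.mem_bot] at hx
      exact ⟨0, by rw [hx, zero_mul, mul_zero, zero_smul]⟩
  · exact ⟨0, by rw [zero_mul, mul_zero, zero_smul]⟩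
  · rintro x y ⟨l, hl⟩ ⟨m, hm⟩
    exact ⟨l + m, by rw [add_mul, mul_add, hl, hm, add_smul]⟩

lemma pos_block_diag {p q : J} (h : T.cls p = T.cls q) {w : A} (hw : w ∈ E.block T.pos p q) :
    ∃ l : k, w = l • (E.e p * E.e q) := by
  have : w ∈ ⨆ b, ⨆ c, ⨆ _ : T.cls b = T.cls q, ⨆ _ : T.cls c = T.cls q,
      E.block T.pos b c := by
    refine Submodule.mem_iSup_of_mem p (Submodule.mem_iSup_of_mem q ?_)
    simpa only [h, iSup_pos] using hw
  rw [T.pos_diag] at this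
  obtain ⟨l, hl⟩ := T.sandwich_diag (p := p) (q := q) this
  exact ⟨l, by rw [← hl, mul_e_of_mem_block hw, e_mul_of_mem_block hw]⟩

lemma neg_block_diag {p q : J} (h : T.cls p = T.cls q) {w : A} (hw : w ∈ E.block T.neg p q) :
    ∃ l : k, w = l • (E.e p * E.e q) := by
  have : w ∈ ⨆ b, ⨆ c, ⨆ _ : T.cls b = T.cls q, ⨆ _ : T.cls c = T.cls q,
      E.block T.neg b c := by
    refine Submodule.mem_iSup_of_mem p (Submodule.mem_iSup_of_mem q ?_)
    simpa only [h, iSup_pos] using hw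
  rw [T.neg_diag] at this
  obtain ⟨l, hl⟩ := T.sandwich_diag (p := p) (q := q) this
  exact ⟨l, by rw [← hl, mul_e_of_mem_block hw, e_mul_of_mem_block hw]⟩

lemma neg_eq_zero {b p : J} (h : ¬ T.cls b ≤ T.cls p) {y : A} (hy : y ∈ E.rightPart T.neg p) :
    E.e b * y = 0 := by
  have := e_mul_mem_block hy b
  rwa [T.neg_eq_bot b p h] at this

lemma pos_eq_zero {q d : J} (h : ¬ T.cls d ≤ T.cls q) {w : A} (hw : w ∈ E.leftPart T.pos q) :
    w * E.e d = 0 := by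
  have := mul_e_mem_block hw d
  rwa [T.pos_eq_bot d q h] at this

/-- Every element of `A` is a sum of products `y z w`, with `y ∈ A⁻ 1_p`, `z ∈ 1_p A° 1_q` and
`w ∈ 1_q A⁺`. -/
lemma pbw_induction {P : A → Prop} (zero : P 0) (add : ∀ x y, P x → P y → P (x + y))
    (mul : ∀ p q, T.cls p = T.cls q → ∀ y ∈ E.rightPart T.neg p, ∀ z ∈ E.block T.zero p q,
      ∀ w ∈ E.leftPart T.pos q, P (y * (z * w))) (x : A) : P x := by
  classical
  obtain ⟨d, rfl⟩ := T.mul_bijective.2 x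
  induction d using DirectSum.induction_on with
  | zero => rw [map_zero]; exact zero
  | add a b ha hb => rw [map_add]; exact add _ _ ha hb
  | of i t =>
    have : DirectSum.of (fun p : J × J => ↥(E.rightPart T.neg p.1) ⊗[k]
        (↥(E.block T.zero p.1 p.2) ⊗[k] ↥(E.leftPart T.pos p.2))) i t =
      DirectSum.lof k (J × J) _ i t := rfl
    rw [this, DirectSum.toModule_lof]
    induction t using TensorProduct.induction_on with
    | zero => rw [map_zero]; exact zero
    | add a b ha hb => rw [map_add]; exact add _ _ (ha rfl) (hb rfl)
    | tmul y t =>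
      induction t using TensorProduct.induction_on with
      | zero => rw [TensorProduct.tmul_zero, map_zero]; exact zero
      | add a b ha hb =>
        rw [TensorProduct.tmul_add, map_add]; exact add _ _ (ha rfl) (hb rfl)
      | tmul z w =>
        change P (y.1 * (z.1 * w.1))
        by_cases h : T.cls i.1 = T.cls i.2
        · exact mul i.1 i.2 h y.1 y.2 z.1 z.2 w.1 w.2
        · rw [T.block_zero_eq_bot h z.2, zero_mul, mul_zero]
          exact zero

/-- The span of all `x 1_h x'` with the class of `h` in `S`. -/
def idl (S : Set I) : Submodule k A :=
  Submodule.span k {x | ∃ h : J, T.cls h ∈ S ∧ ∃ a b : A, x = a * (E.e h * b)}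

lemma mul_mem_idl {S : Set I} {h : J} (hh : T.cls h ∈ S) (a b : A) :
    a * (E.e h * b) ∈ T.idl S :=
  Submodule.subset_span ⟨h, hh, a, b, rfl⟩

lemma mul_idl {S : Set I} {x : A} (hx : x ∈ T.idl S) (a : A) : a * x ∈ T.idl S := by
  induction hx using Submodule.span_induction with
  | mem x hx =>
    obtain ⟨h, hh, b, c, rfl⟩ := hx
    rw [← mul_assoc]
    exact T.mul_mem_idl hh _ _
  | zero => rw [mul_zero]; exact zero_mem _
  | add x y _ _ hx hy => rw [mul_add]; exact add_mem hx hy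
  | smul c x _ hx => rw [mul_smul_comm]; exact Submodule.smul_mem _ _ hx

lemma idl_mul {S : Set I} {x : A} (hx : x ∈ T.idl S) (a : A) : x * a ∈ T.idl S := by
  induction hx using Submodule.span_induction with
  | mem x hx =>
    obtain ⟨h, hh, b, c, rfl⟩ := hx
    rw [mul_assoc, mul_assoc]
    exact T.mul_mem_idl hh _ _
  | zero => rw [zero_mul]; exact zero_mem _
  | add x y _ _ hx hy => rw [add_mul]; exact add_mem hx hy
  | smul c x _ hx => rw [smul_mul_assoc]; exact Submodule.smul_mem _ _ hx

/-- The span of all `A⁻ 1_p A°`. -/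
def negZero (p q : J) : Submodule k A :=
  Submodule.span k {x | ∃ y ∈ E.rightPart T.neg p, ∃ z ∈ E.block T.zero p q, x = y * z}

/-- The span of all `A° 1_q A⁺`. -/
def zeroPos (p q : J) : Submodule k A :=
  Submodule.span k {x | ∃ z ∈ E.block T.zero p q, ∃ w ∈ E.leftPart T.pos q, x = z * w}

/-- The part of `A` spanned by the `A⁻ 1_p A° 1_q A⁺` with the class of `p` and `q` in `S`. -/
def layer (S : Set I) : Submodule k A :=
  Submodule.span k {x | ∃ p q, T.cls p = T.cls q ∧ T.cls p ∈ S ∧ ∃ y ∈ E.rightPart T.neg p,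
    ∃ z ∈ E.block T.zero p q, ∃ w ∈ E.leftPart T.pos q, x = y * (z * w)}

lemma mul_e_mem (x : A) (q : J) :
    x * E.e q ∈ (⨆ p, ⨆ _ : T.cls p = T.cls q, T.negZero p q) ⊔ T.idl (Set.Ioi (T.cls q)) := by
  induction x using T.pbw_induction with
  | zero => rw [zero_mul]; exact zero_mem _
  | add x y hx hy => rw [add_mul]; exact add_mem hx hy
  | mul p q' h y hy z hz w hw =>
    by_cases h1 : T.cls q ≤ T.cls q'
    · rcases h1.eq_or_lt with h2 | h2
      · obtain ⟨l, hl⟩ := T.pos_block_diag h2.symm (mul_e_mem_block hw q)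
        rw [mul_assoc, mul_assoc, hl]
        refine Submodule.mem_sup_left ?_
        by_cases hq : q' = q
        · subst hq
          refine Submodule.mem_iSup_of_mem p ?_
          simp only [h, iSup_pos]
          rw [E.idem, mul_smul_comm, mul_smul_comm, mul_e_of_mem_block hz]
          exact Submodule.smul_mem _ _ (Submodule.subset_span ⟨y, hy, z, hz, rfl⟩)
        · rw [E.orth _ _ hq, smul_zero, mul_zero, mul_zero]
          exact zero_mem _
      · refine Submodule.mem_sup_right ?_
        rw [← e_mul_of_mem_leftPart hw]
        have : y * (z * (E.e q' * w)) * E.e q = (y * z) * (E.e q' * (w * E.e q)) := by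
          simp only [mul_assoc]
        rw [this]
        exact T.mul_mem_idl h2 _ _
    · rw [mul_assoc, mul_assoc, T.pos_eq_zero h1 hw, mul_zero, mul_zero]
      exact zero_mem _

lemma e_mul_mem (x : A) (p : J) :
    E.e p * x ∈ (⨆ q, ⨆ _ : T.cls p = T.cls q, T.zeroPos p q) ⊔ T.idl (Set.Ioi (T.cls p)) := by
  induction x using T.pbw_induction with
  | zero => rw [mul_zero]; exact zero_mem _
  | add x y hx hy => rw [mul_add]; exact add_mem hx hy
  | mul p' q h y hy z hz w hw =>
    rw [← mul_assoc]
    by_cases h1 : T.cls p ≤ T.cls p'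
    · rcases h1.eq_or_lt with h2 | h2
      · obtain ⟨l, hl⟩ := T.neg_block_diag h2 (e_mul_mem_block hy p)
        rw [hl]
        refine Submodule.mem_sup_left ?_
        by_cases hq : p = p'
        · subst hq
          refine Submodule.mem_iSup_of_mem q ?_
          simp only [h, iSup_pos]
          rw [E.idem, smul_mul_assoc, ← mul_assoc, e_mul_of_mem_block hz]
          exact Submodule.smul_mem _ _ (Submodule.subset_span ⟨z, hz, w, hw, rfl⟩)
        · rw [E.orth _ _ hq, smul_zero, zero_mul]
          exact zero_mem _
      · refine Submodule.mem_sup_right ?_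
        rw [← mul_e_of_mem_rightPart hy]
        have : E.e p * (y * E.e p') * (z * w) = (E.e p * y) * (E.e p' * (z * w)) := by
          simp only [mul_assoc]
        rw [this]
        exact T.mul_mem_idl h2 _ _
    · rw [T.neg_eq_zero h1 hy, zero_mul]
      exact zero_mem _

lemma e_mul_mul_e_mem (x : A) {p q : J} (hpq : T.cls p = T.cls q) :
    E.e p * (x * E.e q) ∈ E.block T.zero p q ⊔ T.idl (Set.Ioi (T.cls p)) := by
  have key : ∀ x ∈ (⨆ q, ⨆ _ : T.cls p = T.cls q, T.zeroPos p q) ⊔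
      T.idl (Set.Ioi (T.cls p)), x * E.e q ∈ E.block T.zero p q ⊔ T.idl (Set.Ioi (T.cls p)) := by
    intro x hx
    refine (show _ ≤ (E.block T.zero p q ⊔ T.idl (Set.Ioi (T.cls p))).comap
      (LinearMap.mulRight k (E.e q)) from ?_) hx
    refine sup_le (iSup_le fun q' => iSup_le fun hq' => Submodule.span_le.2 ?_) ?_
    · rintro _ ⟨z, hz, w, hw, rfl⟩
      change z * w * E.e q ∈ E.block T.zero p q ⊔ T.idl (Set.Ioi (T.cls p))
      rw [mul_assoc]
      obtain ⟨l, hl⟩ := T.pos_block_diag (hq'.symm.trans hpq) (mul_e_mem_block hw q)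
      rw [hl]
      refine Submodule.mem_sup_left ?_
      by_cases hq : q' = q
      · subst hq
        rw [E.idem, mul_smul_comm, mul_e_of_mem_block hz]
        exact Submodule.smul_mem _ _ hz
      · rw [E.orth _ _ hq, smul_zero, mul_zero]
        exact zero_mem _
    · intro x hx
      exact Submodule.mem_sup_right (T.idl_mul hx _)
  rw [← mul_assoc]
  exact key _ (T.e_mul_mem x p)

lemma wellFounded_gt (T : WeaklyTriangular E I) : WellFounded (fun a b : I => b < a) := by
  have h : ∀ a : I, IsWellFounded {b // a ≤ b} (fun x y => y < x) := fun a =>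
    have : Finite {b // a ≤ b} := (T.upper_finite a).to_subtype
    inferInstance
  refine ⟨fun a => ?_⟩
  have key : ∀ x : {b // a ≤ b}, Acc (fun a b : I => b < a) x.1 := fun x => by
    induction x using (h a).wf.induction with
    | _ x ih => exact ⟨_, fun y hy => ih ⟨y, x.2.trans hy.le⟩ hy⟩
  exact key ⟨a, le_rfl⟩

lemma layer_mono {S S' : Set I} (h : S ⊆ S') : T.layer S ≤ T.layer S' :=
  Submodule.span_mono fun _ ⟨p, q, h1, h2, h3⟩ => ⟨p, q, h1, h h2, h3⟩

/-- The ideal generated by an upper set of idempotents is spanned by the corresponding layers. -/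
lemma idl_le_layer (g : I) : T.idl (Set.Ici g) ≤ T.layer (Set.Ici g) := by
  induction g using T.wellFounded_gt.induction with
  | _ g ih =>
  have hgt : T.idl (Set.Ioi g) ≤ T.layer (Set.Ici g) := by
    refine Submodule.span_le.2 ?_
    rintro _ ⟨h, hh, a, b, rfl⟩
    exact T.layer_mono (Set.Ici_subset_Ici.2 (le_of_lt hh))
      (ih (T.cls h) hh (T.mul_mem_idl (Set.mem_Ici.2 le_rfl) a b))
  refine Submodule.span_le.2 ?_
  rintro _ ⟨h, hh, a, b, rfl⟩
  rcases (Set.mem_Ici.1 hh).eq_or_lt with rfl | hlt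
  swap
  · exact hgt (T.mul_mem_idl hlt a b)
  rw [← E.idem, mul_assoc, ← mul_assoc]
  -- `a 1_h` and `1_h b`, modulo higher layers
  obtain ⟨s, hs, r, hr, hsr⟩ := Submodule.mem_sup.1 (T.mul_e_mem a h)
  obtain ⟨s', hs', r', hr', hsr'⟩ := Submodule.mem_sup.1 (T.e_mul_mem b h)
  rw [← hsr, ← hsr', add_mul, mul_add]
  refine add_mem (add_mem ?_ ?_) ?_
  · clear hsr hsr'
    refine (show _ ≤ (T.layer (Set.Ici (T.cls h))).comap (LinearMap.mulRight k s') from ?_) hs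
    refine iSup_le fun p => iSup_le fun hp => Submodule.span_le.2 ?_
    rintro _ ⟨y, hy, z, hz, rfl⟩
    change y * z * s' ∈ T.layer (Set.Ici (T.cls h))
    refine (show _ ≤ (T.layer (Set.Ici (T.cls h))).comap (LinearMap.mulLeft k (y * z)) from ?_) hs'
    refine iSup_le fun q => iSup_le fun hq => Submodule.span_le.2 ?_
    rintro _ ⟨z', hz', w, hw, rfl⟩
    change y * z * (z' * w) ∈ T.layer (Set.Ici (T.cls h))
    have h1 : y * z * (z' * w) = y * ((E.e p * ((z * z') * E.e q)) * w) := by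
      conv_lhs => rw [← e_mul_of_mem_block hz, ← mul_e_of_mem_block hz']
      simp only [mul_assoc]
    rw [h1]
    obtain ⟨z₀, hz₀, r₀, hr₀, h0⟩ := Submodule.mem_sup.1
      (T.e_mul_mul_e_mem (z * z') (hp.trans hq))
    rw [← h0, add_mul, mul_add]
    refine add_mem ?_ ?_
    · exact Submodule.subset_span ⟨p, q, hp.trans hq, by rw [hp]; exact Set.mem_Ici.2 le_rfl,
        y, hy, z₀, hz₀, w, hw, rfl⟩
    · rw [hp] at hr₀
      exact hgt (T.mul_idl (T.idl_mul hr₀ _) _)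
  · exact hgt (T.mul_idl hr' _)
  · exact hgt (T.idl_mul hr _)

end WeaklyTriangular

end PBW

/-! ### Coordinates in the truncated algebras -/

section QuotCoords

open CornerRing

variable {k A J : Type u} [Field k] [NonUnitalRing A] [Module k A]
  [IsScalarTower k A A] [SMulCommClass k A A]

namespace WeaklyTriangular

open LocallyUnital

variable {E : LocallyUnital k A J} {I : Type t} [PartialOrder I] (T : WeaklyTriangular E I)

/-- The quotient map onto the quotient of the unitization. -/
def qmk (c : I) : E.Uni →+* T.quotLE c := Ideal.Quotient.mk (T.idealNotLE c).asIdeal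

lemma qmk_surjective (c : I) : Function.Surjective (T.qmk c) := Ideal.Quotient.mk_surjective

/-- The restriction of the quotient map to `A`, as a linear map. -/
def amk (c : I) : A →ₗ[k] T.quotLE c :=
  (Ideal.Quotient.mkₐ k (T.idealNotLE c).asIdeal).toLinearMap ∘ₗ Unitization.inrHom k k A

lemma amk_apply (c : I) (x : A) : T.amk c x = T.qmk c (x : E.Uni) := rfl

lemma amk_mul (c : I) (x y : A) : T.amk c (x * y) = T.amk c x * T.amk c y := by
  rw [amk_apply, Unitization.inr_mul, map_mul]; rfl

lemma qmk_eq_zero_iff {c : I} {x : E.Uni} : T.qmk c x = 0 ↔ x ∈ T.idealNotLE c :=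
  Ideal.Quotient.eq_zero_iff_mem

lemma mem_class {a : I} {b : J} : b ∈ (T.finite_class a).toFinset ↔ T.cls b = a := by
  simp

lemma eU_mul_one {a : I} {b : J} (h : T.cls b = a) : E.eU b * T.one a = E.eU b := by
  unfold one
  rw [Finset.mul_sum, Finset.sum_eq_single b]
  · exact E.eU_mul_self b
  · intro c _ hc
    exact E.eU_mul_of_ne hc.symm
  · intro hb
    exact absurd (T.mem_class.2 h) hb

lemma one_mul_eU {a : I} {b : J} (h : T.cls b = a) : T.one a * E.eU b = E.eU b := by
  unfold one
  rw [Finset.sum_mul, Finset.sum_eq_single b]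
  · exact E.eU_mul_self b
  · intro c _ hc
    exact E.eU_mul_of_ne hc
  · intro hb
    exact absurd (T.mem_class.2 h) hb

lemma eU_mem_idealNotLE {c : I} {d : J} (h : ¬ T.cls d ≤ c) : E.eU d ∈ T.idealNotLE c := by
  rw [← T.eU_mul_one rfl]
  exact TwoSidedIdeal.mul_mem_left _ _ _ (TwoSidedIdeal.subset_span ⟨_, h, rfl⟩)

/-- Multiplying by an element of `A` stays in `A`. -/
lemma exists_mul_inr (u : E.Uni) (x : A) : ∃ z : A, u * (x : E.Uni) = (z : E.Uni) :=
  ⟨u.fst • x + u.snd * x, by ext <;> simp⟩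

lemma exists_inr_mul (u : E.Uni) (x : A) : ∃ z : A, (x : E.Uni) * u = (z : E.Uni) :=
  ⟨u.fst • x + x * u.snd, by ext <;> simp⟩

lemma exists_sandwich (u u' : E.Uni) (d : J) :
    ∃ a b : A, u * E.eU d * u' = ((a * (E.e d * b) : A) : E.Uni) := by
  obtain ⟨a, ha⟩ := exists_mul_inr (E := E) u (E.e d)
  obtain ⟨b, hb⟩ := exists_inr_mul (E := E) u' (E.e d)
  refine ⟨a, b, ?_⟩
  have h1 : u * E.eU d * u' = (u * E.eU d) * (E.eU d * (E.eU d * u')) := by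
    rw [← mul_assoc (E.eU d) (E.eU d) u', E.eU_mul_self, mul_assoc u (E.eU d) (E.eU d * u'),
      ← mul_assoc (E.eU d) (E.eU d) u', E.eU_mul_self, mul_assoc]
  rw [h1]
  change (u * (E.e d : E.Uni)) * (E.eU d * ((E.e d : E.Uni) * u')) = _
  rw [ha, hb, Unitization.inr_mul, Unitization.inr_mul]
  rfl

/-- An element of `A` in the two-sided ideal generated by the `1_b`, `b ≰ c`. -/
lemma mem_idl_of_mem_idealNotLE {c : I} {x : E.Uni} (hx : x ∈ T.idealNotLE c) :
    ∃ z ∈ T.idl {g | ¬ g ≤ c}, x = ((z : A) : E.Uni) := by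
  unfold idealNotLE at hx
  rw [TwoSidedIdeal.mem_span_iff_mem_addSubgroup_closure] at hx
  induction hx using AddSubgroup.closure_induction with
  | mem x hx =>
    obtain ⟨_, ⟨u, -, _, ⟨b, hb, rfl⟩, rfl⟩, u', -, rfl⟩ := hx
    have : ∀ d ∈ (T.finite_class b).toFinset, ∃ z ∈ T.idl {g | ¬ g ≤ c},
        u * E.eU d * u' = ((z : A) : E.Uni) := by
      intro d hd
      obtain ⟨a, a', h⟩ := exists_sandwich (E := E) u u' d
      exact ⟨_, T.mul_mem_idl (by rw [T.mem_class.1 hd]; exact hb) a a', h⟩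
    choose! z hz hzu using this
    refine ⟨∑ d ∈ (T.finite_class b).toFinset, z d, Submodule.sum_mem _ hz, ?_⟩
    change u * T.one b * u' = _
    unfold one
    rw [Finset.mul_sum, Finset.sum_mul, Finset.sum_congr rfl hzu]
    exact (map_sum (Unitization.inrHom k k A) _ _).symm
  | zero => exact ⟨0, zero_mem _, rfl⟩
  | add x y _ _ hx hy =>
    obtain ⟨z, hz, rfl⟩ := hx
    obtain ⟨w, hw, rfl⟩ := hy
    exact ⟨z + w, add_mem hz hw, (Unitization.inr_add _ _ _).symm⟩
  | neg x _ hx =>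
    obtain ⟨z, hz, rfl⟩ := hx
    exact ⟨-z, neg_mem hz, (Unitization.inr_neg _ _).symm⟩

lemma amk_eq_zero_of_mem_idl {c : I} {S : Set I} (hS : ∀ g ∈ S, ¬ g ≤ c) {x : A}
    (hx : x ∈ T.idl S) : T.amk c x = 0 := by
  refine (show T.idl S ≤ LinearMap.ker (T.amk c) from Submodule.span_le.2 ?_) hx
  rintro _ ⟨h, hh, a, b, rfl⟩
  change T.amk c (a * (E.e h * b)) = 0
  have : T.amk c (E.e h) = 0 := T.qmk_eq_zero_iff.2 (T.eU_mem_idealNotLE (hS _ hh))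
  rw [amk_mul, amk_mul, this, zero_mul, mul_zero]

lemma idl_notLE_le_layer (c : I) : T.idl {g | ¬ g ≤ c} ≤ T.layer {g | ¬ g ≤ c} := by
  refine Submodule.span_le.2 ?_
  rintro _ ⟨h, hh, a, b, rfl⟩
  refine T.layer_mono ?_ (T.idl_le_layer (T.cls h) (T.mul_mem_idl (Set.mem_Ici.2 le_rfl) a b))
  intro g hg hgc
  exact hh (le_trans hg hgc)

lemma amk_e_mul {c : I} {p : J} (hp : T.cls p = c) {x : A} (hx : E.e p * x = x) :
    T.oneBar c * T.amk c x = T.amk c x := by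
  rw [← hx, amk_mul, ← mul_assoc]
  congr 1
  change T.qmk c _ * T.qmk c _ = T.qmk c _
  rw [← map_mul]
  exact congrArg _ (T.one_mul_eU hp)

lemma amk_mul_e {c : I} {p : J} (hp : T.cls p = c) {x : A} (hx : x * E.e p = x) :
    T.amk c x * T.oneBar c = T.amk c x := by
  rw [← hx, amk_mul, mul_assoc]
  congr 1
  change T.qmk c _ * T.qmk c _ = T.qmk c _
  rw [← map_mul]
  exact congrArg _ (T.eU_mul_one hp)

/-- A basis of `A⁻ 1_p`. -/
abbrev negBasis (p : J) := Module.Basis.ofVectorSpace k (E.rightPart T.neg p)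

/-- A basis of `1_q A⁺`. -/
abbrev posBasis (q : J) := Module.Basis.ofVectorSpace k (E.leftPart T.pos q)

/-- The index type of the union of the bases of the `A⁻ 1_p`. -/
abbrev NegIdx := Σ p : J, Module.Basis.ofVectorSpaceIndex k (E.rightPart T.neg p)

/-- The index type of the union of the bases of the `1_q A⁺`. -/
abbrev PosIdx := Σ p : J, Module.Basis.ofVectorSpaceIndex k (E.leftPart T.pos p)

/-- The coordinate at `i` of an element of `A⁻ 1_p`, which is zero unless `i` belongs to the
basis of `A⁻ 1_p`. -/
def negCoord (i : T.NegIdx) (p : J) : E.rightPart T.neg p →ₗ[k] k :=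
  Finsupp.lapply i ∘ₗ Finsupp.lmapDomain k k (Sigma.mk p) ∘ₗ (T.negBasis p).repr.toLinearMap

/-- The coordinate at `j` of an element of `1_q A⁺`. -/
def posCoord (j : T.PosIdx) (q : J) : E.leftPart T.pos q →ₗ[k] k :=
  Finsupp.lapply j ∘ₗ Finsupp.lmapDomain k k (Sigma.mk q) ∘ₗ (T.posBasis q).repr.toLinearMap

open Classical in
lemma negCoord_basis (i i' : T.NegIdx) :
    T.negCoord i i'.1 (T.negBasis i'.1 i'.2) = if i' = i then 1 else 0 := by
  change Finsupp.mapDomain (Sigma.mk i'.1) ((T.negBasis i'.1).repr (T.negBasis i'.1 i'.2)) i = _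
  rw [Module.Basis.repr_self, Finsupp.mapDomain_single, Finsupp.single_apply]

open Classical in
lemma posCoord_basis (i i' : T.PosIdx) :
    T.posCoord i i'.1 (T.posBasis i'.1 i'.2) = if i' = i then 1 else 0 := by
  change Finsupp.mapDomain (Sigma.mk i'.1) ((T.posBasis i'.1).repr (T.posBasis i'.1 i'.2)) i = _
  rw [Module.Basis.repr_self, Finsupp.mapDomain_single, Finsupp.single_apply]

lemma negCoord_of_ne (i : T.NegIdx) (p : J) (h : p ≠ i.1) (y : E.rightPart T.neg p) :
    T.negCoord i p y = 0 := by
  change Finsupp.mapDomain (Sigma.mk p) ((T.negBasis p).repr y) i = 0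
  refine Finsupp.mapDomain_of_notMem_range _ _ ?_
  rintro ⟨x, rfl⟩
  exact h rfl

/-- The coefficient of `y_i ⊗ - ⊗ w_j`, with values in `A`. -/
def coeffMap (i : T.NegIdx) (j : T.PosIdx) :
    (⨁ p : J × J, ↥(E.rightPart T.neg p.1) ⊗[k]
      (↥(E.block T.zero p.1 p.2) ⊗[k] ↥(E.leftPart T.pos p.2))) →ₗ[k] A :=
  letI := Classical.decEq (J × J)
  DirectSum.toModule k (J × J) A fun p =>
    TensorProduct.lift ((LinearMap.lsmul k A).comp (T.negCoord i p.1) |>.compl₂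
      (TensorProduct.lift ((((LinearMap.lsmul k A).comp (T.posCoord j p.2)).compl₂
        (E.block T.zero p.1 p.2).subtype).flip)))

/-- The multiplication isomorphism of the triangular decomposition. -/
abbrev mulMap : (⨁ p : J × J, ↥(E.rightPart T.neg p.1) ⊗[k]
    (↥(E.block T.zero p.1 p.2) ⊗[k] ↥(E.leftPart T.pos p.2))) →ₗ[k] A :=
  letI := Classical.decEq (J × J)
  DirectSum.toModule k (J × J) A fun p =>
    tripleMul (E.rightPart T.neg p.1) (E.block T.zero p.1 p.2) (E.leftPart T.pos p.2)

/-- The summand `y ⊗ z ⊗ w`. -/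
def pureTensor {p q : J} (y : E.rightPart T.neg p) (z : E.block T.zero p q)
    (w : E.leftPart T.pos q) : ⨁ p : J × J, ↥(E.rightPart T.neg p.1) ⊗[k]
      (↥(E.block T.zero p.1 p.2) ⊗[k] ↥(E.leftPart T.pos p.2)) :=
  letI := Classical.decEq (J × J)
  DirectSum.lof k (J × J) (fun p => ↥(E.rightPart T.neg p.1) ⊗[k]
      (↥(E.block T.zero p.1 p.2) ⊗[k] ↥(E.leftPart T.pos p.2))) (p, q) (y ⊗ₜ[k] (z ⊗ₜ[k] w))

lemma mulMap_pureTensor {p q : J} (y : E.rightPart T.neg p) (z : E.block T.zero p q)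
    (w : E.leftPart T.pos q) : T.mulMap (T.pureTensor y z w) = y.1 * (z.1 * w.1) := by
  classical
  unfold mulMap pureTensor
  rw [DirectSum.toModule_lof]; rfl

lemma coeffMap_pureTensor (i : T.NegIdx) (j : T.PosIdx) {p q : J} (y : E.rightPart T.neg p)
    (z : E.block T.zero p q) (w : E.leftPart T.pos q) :
    T.coeffMap i j (T.pureTensor y z w) = T.negCoord i p y • T.posCoord j q w • z.1 := by
  classical
  unfold coeffMap pureTensor
  rw [DirectSum.toModule_lof]; rfl

lemma mulMap_injective : Function.Injective T.mulMap := by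
  convert T.mul_bijective.1

lemma exists_of_mem_layer {c : I} {i : T.NegIdx} (hi : T.cls i.1 = c) (j : T.PosIdx) {x : A}
    (hx : x ∈ T.layer {g | ¬ g ≤ c}) : ∃ η, T.mulMap η = x ∧ T.coeffMap i j η = 0 := by
  induction hx using Submodule.span_induction with
  | mem x hx =>
    obtain ⟨p, q, -, hp, y, hy, z, hz, w, hw, rfl⟩ := hx
    refine ⟨T.pureTensor ⟨y, hy⟩ ⟨z, hz⟩ ⟨w, hw⟩, T.mulMap_pureTensor _ _ _, ?_⟩
    rw [coeffMap_pureTensor, negCoord_of_ne, zero_smul]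
    rintro rfl
    exact hp hi.le
  | zero => exact ⟨0, map_zero _, map_zero _⟩
  | add x y _ _ hx hy =>
    obtain ⟨η, h1, h2⟩ := hx
    obtain ⟨η', h1', h2'⟩ := hy
    exact ⟨η + η', by rw [map_add, h1, h1'], by rw [map_add, h2, h2', add_zero]⟩
  | smul l x _ hx =>
    obtain ⟨η, h1, h2⟩ := hx
    exact ⟨l • η, by rw [map_smul, h1], by rw [map_smul, h2, smul_zero]⟩

/-- A sum of products `y z w` of basis elements `y`, `w` in the class `c` that lies in the ideal
generated by the `1_b`, `b ≰ c`, is trivial. -/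
lemma eq_zero_of_sum_mem {c : I} (s : Finset T.NegIdx) (t : Finset T.PosIdx)
    (hs : ∀ i ∈ s, T.cls i.1 = c) (z : ∀ (i : T.NegIdx) (j : T.PosIdx), E.block T.zero i.1 j.1)
    (h : T.amk c (∑ i ∈ s, ∑ j ∈ t, (T.negBasis i.1 i.2).1 * ((z i j).1 *
      (T.posBasis j.1 j.2).1)) = 0) : ∀ i ∈ s, ∀ j ∈ t, (z i j).1 = 0 := by
  classical
  intro i hi j hj
  obtain ⟨x, hx, hxe⟩ := T.mem_idl_of_mem_idealNotLE (T.qmk_eq_zero_iff.1 h)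
  replace hxe := Unitization.inr_injective (R := k) hxe
  rw [← hxe] at hx
  obtain ⟨η, h1, h2⟩ := T.exists_of_mem_layer (hs i hi) j (T.idl_notLE_le_layer c hx)
  have h3 : η = ∑ i ∈ s, ∑ j ∈ t,
      T.pureTensor (T.negBasis i.1 i.2) (z i j) (T.posBasis j.1 j.2) := by
    apply T.mulMap_injective
    rw [h1, map_sum]
    refine Finset.sum_congr rfl fun i _ => ?_
    rw [map_sum]
    exact Finset.sum_congr rfl fun j _ => (T.mulMap_pureTensor _ _ _).symm
  rw [h3, map_sum, Finset.sum_eq_single i, map_sum, Finset.sum_eq_single j,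
    coeffMap_pureTensor, negCoord_basis, posCoord_basis, if_pos rfl, if_pos rfl, one_smul,
    one_smul] at h2
  · exact h2
  · intro j' _ hj'
    rw [coeffMap_pureTensor, posCoord_basis, if_neg hj', zero_smul, smul_zero]
  · intro h; exact absurd hj h
  · intro i' _ hi'
    rw [map_sum]
    refine Finset.sum_eq_zero fun j' _ => ?_
    rw [coeffMap_pureTensor, negCoord_basis, if_neg hi', zero_smul]
  · intro h; exact absurd hi h

/-- The image of `1_p` in the corner ring of its class. -/
def cornerE (c : I) (p : {p : J // T.cls p = c}) : T.Abar c :=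
  ⟨T.amk c (E.e p), by
    rw [Subsemigroup.mem_corner_iff (T.oneBar_idem c)]
    exact ⟨T.amk_e_mul p.2 (E.idem _), T.amk_mul_e p.2 (E.idem _)⟩⟩

lemma oneBar_eq_sum (c : I) : T.oneBar c = ∑ q ∈ (T.finite_class c).toFinset, T.amk c (E.e q) :=
  map_sum (T.qmk c) _ _

lemma exists_amk (c : I) {p q : J} (hp : T.cls p = c) (hq : T.cls q = c) (x : T.quotLE c)
    (h1 : T.amk c (E.e p) * x = x) (h2 : x * T.amk c (E.e q) = x) :
    ∃ z ∈ E.block T.zero p q, T.amk c z = x := by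
  obtain ⟨u, rfl⟩ := T.qmk_surjective c x
  obtain ⟨a, ha⟩ := exists_mul_inr (E := E) u (E.e q)
  have h3 : T.qmk c u = T.amk c (E.e p * (a * E.e q)) := by
    have h4 : T.qmk c u * T.amk c (E.e q) = T.amk c a := by
      change T.qmk c u * T.qmk c _ = T.qmk c _
      rw [← map_mul]
      exact congrArg _ ha
    rw [amk_mul, amk_mul, ← h4, h2, h2, h1]
  obtain ⟨z, hz, r, hr, hzr⟩ := Submodule.mem_sup.1 (T.e_mul_mul_e_mem a (hp.trans hq.symm))
  refine ⟨z, hz, ?_⟩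
  rw [h3, ← hzr, map_add, T.amk_eq_zero_of_mem_idl (fun g hg => ?_) hr, add_zero]
  rw [← hp]
  exact not_le_of_gt hg

lemma mem_corner_amk {c : I} {p q : J} (hp : T.cls p = c) (hq : T.cls q = c) {z : A}
    (hz : z ∈ E.block T.zero p q) : T.amk c z ∈ Subsemigroup.corner (T.oneBar c) := by
  rw [Subsemigroup.mem_corner_iff (T.oneBar_idem c)]
  exact ⟨T.amk_e_mul hp (e_mul_of_mem_block hz), T.amk_mul_e hq (mul_e_of_mem_block hz)⟩

/-- The two-sided coordinates of `A_{≤ c}` at the idempotent `1_c`, which express that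
`A_{≤ c} 1_c A_{≤ c}` is `A⁻ 1_c ⊗ Ā_c ⊗ 1_c A⁺`. -/
def coords (c : I) : CornerCoords (T.oneBar_idem c) {i : T.NegIdx // T.cls i.1 = c}
    {j : T.PosIdx // T.cls j.1 = c} where
  y i := T.amk c (T.negBasis i.1.1 i.1.2).1
  w j := T.amk c (T.posBasis j.1.1 j.1.2).1
  f i := T.cornerE c ⟨i.1.1, i.2⟩
  g j := T.cornerE c ⟨j.1.1, j.2⟩
  f_idem i := Subtype.ext (by
    change T.amk c _ * T.amk c _ = T.amk c _
    rw [← amk_mul, E.idem])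
  g_idem i := Subtype.ext (by
    change T.amk c _ * T.amk c _ = T.amk c _
    rw [← amk_mul, E.idem])
  y_f i := by
    change T.amk c _ * T.amk c _ = T.amk c _
    rw [← amk_mul, mul_e_of_mem_rightPart (T.negBasis i.1.1 i.1.2).2]
  g_w j := by
    change T.amk c _ * T.amk c _ = T.amk c _
    rw [← amk_mul, e_mul_of_mem_leftPart (T.posBasis j.1.1 j.1.2).2]
  span_left x := by
    classical
    let P : AddSubgroup (T.quotLE c) := (Finsupp.liftAddHom
      (fun i : {i : T.NegIdx // T.cls i.1 = c} =>
        (AddMonoidHom.mulLeft (T.amk c (T.negBasis i.1.1 i.1.2).1)).comp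
          (AddSubgroup.subtype (NonUnitalRing.corner (T.oneBar c)).toAddSubgroup))).range
    suffices h : x * T.oneBar c ∈ P by
      obtain ⟨a, ha⟩ := h
      exact ⟨a, ha.symm⟩
    have hP : ∀ p (hp : T.cls p = c), ∀ y ∈ E.rightPart T.neg p, ∀ q (hq : T.cls q = c),
        ∀ z ∈ E.block T.zero p q, T.amk c (y * z) ∈ P := by
      intro p hp y hy q hq z hz
      have h1 := (T.negBasis p).linearCombination_repr ⟨y, hy⟩
      rw [Finsupp.linearCombination_apply, Finsupp.sum] at h1
      have h2 := congrArg Subtype.val h1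
      rw [AddSubmonoidClass.coe_finsetSum] at h2
      change _ = y at h2
      rw [← h2, Finset.sum_mul, map_sum]
      refine sum_mem fun i _ => ?_
      refine ⟨Finsupp.single ⟨⟨p, i⟩, hp⟩ ⟨T.amk c ((T.negBasis p).repr ⟨y, hy⟩ i • z),
        T.mem_corner_amk hp hq (Submodule.smul_mem _ _ hz)⟩, ?_⟩
      rw [Finsupp.liftAddHom_apply_single]
      change T.amk c _ * T.amk c _ = _
      rw [← amk_mul, mul_smul_comm]
      change _ = T.amk c (_ • (T.negBasis p i).1 * z)
      rw [smul_mul_assoc]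
    rw [oneBar_eq_sum, Finset.mul_sum]
    refine sum_mem fun q hq => ?_
    obtain ⟨u, rfl⟩ := T.qmk_surjective c x
    obtain ⟨a, ha⟩ := exists_mul_inr (E := E) u (E.e q)
    have h3 : T.qmk c u * T.amk c (E.e q) = T.amk c (a * E.e q) := by
      have : T.qmk c u * T.amk c (E.e q) = T.amk c a := by
        change T.qmk c u * T.qmk c _ = T.qmk c _
        rw [← map_mul]
        exact congrArg _ ha
      rw [amk_mul, ← this, mul_assoc, ← amk_mul, E.idem]
    rw [h3]
    obtain ⟨s, hs, r, hr, hsr⟩ := Submodule.mem_sup.1 (T.mul_e_mem a q)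
    rw [← hsr, map_add, T.amk_eq_zero_of_mem_idl (fun g hg => ?_) hr, add_zero]
    swap
    · rw [← T.mem_class.1 hq]
      exact not_le_of_gt hg
    refine Submodule.iSup_induction (p := _) (motive := fun s => T.amk c s ∈ P) hs ?_ ?_ ?_
    · intro p s hs
      by_cases hp : T.cls p = T.cls q
      · simp only [hp, iSup_pos] at hs
        have key : ∀ s ∈ T.negZero p q, T.amk c s ∈ P := by
          intro s hs
          refine Submodule.closure_induction (p := fun s _ => T.amk c s ∈ P) ?_ ?_ ?_ hs
          · rw [map_zero]; exact zero_mem _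
          · intro a b _ _ ha hb
            rw [map_add]; exact add_mem ha hb
          · rintro l _ ⟨y, hy, z, hz, rfl⟩
            rw [← smul_mul_assoc]
            exact hP p (hp.trans (T.mem_class.1 hq)) _ (Submodule.smul_mem _ _ hy) q
              (T.mem_class.1 hq) z hz
        exact key s hs
      · simp only [hp, iSup_neg, not_false_eq_true] at hs
        rw [(Submodule.mem_bot k).1 hs, map_zero]
        exact zero_mem _
    · rw [map_zero]; exact zero_mem _
    · intro a b ha hb
      rw [map_add]; exact add_mem ha hb
  span_right x := by
    classical
    let P : AddSubgroup (T.quotLE c) := (Finsupp.liftAddHom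
      (fun i : {i : T.PosIdx // T.cls i.1 = c} =>
        (AddMonoidHom.mulRight (T.amk c (T.posBasis i.1.1 i.1.2).1)).comp
          (AddSubgroup.subtype (NonUnitalRing.corner (T.oneBar c)).toAddSubgroup))).range
    suffices h : T.oneBar c * x ∈ P by
      obtain ⟨a, ha⟩ := h
      exact ⟨a, ha.symm⟩
    have hP : ∀ p (hp : T.cls p = c), ∀ q (hq : T.cls q = c), ∀ y ∈ E.leftPart T.pos q,
        ∀ z ∈ E.block T.zero p q, T.amk c (z * y) ∈ P := by
      intro p hp q hq y hy z hz
      have h1 := (T.posBasis q).linearCombination_repr ⟨y, hy⟩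
      rw [Finsupp.linearCombination_apply, Finsupp.sum] at h1
      have h2 := congrArg Subtype.val h1
      rw [AddSubmonoidClass.coe_finsetSum] at h2
      change _ = y at h2
      rw [← h2, Finset.mul_sum, map_sum]
      refine sum_mem fun i _ => ?_
      refine ⟨Finsupp.single ⟨⟨q, i⟩, hq⟩ ⟨T.amk c ((T.posBasis q).repr ⟨y, hy⟩ i • z),
        T.mem_corner_amk hp hq (Submodule.smul_mem _ _ hz)⟩, ?_⟩
      rw [Finsupp.liftAddHom_apply_single]
      change T.amk c _ * T.amk c _ = _
      rw [← amk_mul, smul_mul_assoc]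
      change _ = T.amk c (z * (_ • (T.posBasis q i).1))
      rw [mul_smul_comm]
    rw [oneBar_eq_sum, Finset.sum_mul]
    refine sum_mem fun q hq => ?_
    obtain ⟨u, rfl⟩ := T.qmk_surjective c x
    obtain ⟨a, ha⟩ := exists_inr_mul (E := E) u (E.e q)
    have h3 : T.amk c (E.e q) * T.qmk c u = T.amk c (E.e q * a) := by
      have : T.amk c (E.e q) * T.qmk c u = T.amk c a := by
        change T.qmk c _ * T.qmk c _ = T.qmk c _
        rw [← map_mul]
        exact congrArg _ ha
      rw [amk_mul, ← this, ← mul_assoc, ← amk_mul, E.idem]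
    rw [h3]
    obtain ⟨s, hs, r, hr, hsr⟩ := Submodule.mem_sup.1 (T.e_mul_mem a q)
    rw [← hsr, map_add, T.amk_eq_zero_of_mem_idl (fun g hg => ?_) hr, add_zero]
    swap
    · rw [← T.mem_class.1 hq]
      exact not_le_of_gt hg
    refine Submodule.iSup_induction (p := _) (motive := fun s => T.amk c s ∈ P) hs ?_ ?_ ?_
    · intro p s hs
      by_cases hp : T.cls q = T.cls p
      · simp only [hp, iSup_pos] at hs
        have key : ∀ s ∈ T.zeroPos q p, T.amk c s ∈ P := by
          intro s hs
          refine Submodule.closure_induction (p := fun s _ => T.amk c s ∈ P) ?_ ?_ ?_ hs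
          · rw [map_zero]; exact zero_mem _
          · intro a b _ _ ha hb
            rw [map_add]; exact add_mem ha hb
          · rintro l _ ⟨z, hz, y, hy, rfl⟩
            rw [← mul_smul_comm]
            exact hP q (T.mem_class.1 hq) p (hp.symm.trans (T.mem_class.1 hq)) _
              (Submodule.smul_mem _ _ hy) z hz
        exact key s hs
      · simp only [hp, iSup_neg, not_false_eq_true] at hs
        rw [(Submodule.mem_bot k).1 hs, map_zero]
        exact zero_mem _
    · rw [map_zero]; exact zero_mem _
    · intro a b ha hb
      rw [map_add]; exact add_mem ha hb
  indep s t a ha1 ha2 h := by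
    classical
    have hz : ∀ i j, ∃ z : E.block T.zero i.1.1 j.1.1, T.amk c z = (a i j).1 := by
      intro i j
      obtain ⟨z, hz, h⟩ := T.exists_amk c i.2 j.2 (a i j).1
        (congrArg Subtype.val (ha1 i j)) (congrArg Subtype.val (ha2 i j))
      exact ⟨⟨z, hz⟩, h⟩
    choose z hz using hz
    have := T.eq_zero_of_sum_mem (c := c) (s.map (Function.Embedding.subtype _))
      (t.map (Function.Embedding.subtype _)) (fun i hi => by
        obtain ⟨i, -, rfl⟩ := Finset.mem_map.1 hi
        exact i.2)
      (fun i j => if h : T.cls i.1 = c ∧ T.cls j.1 = c then z ⟨i, h.1⟩ ⟨j, h.2⟩ else 0) (by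
        rw [← h, Finset.sum_map, map_sum]
        refine Finset.sum_congr rfl fun i _ => ?_
        rw [Finset.sum_map, map_sum]
        refine Finset.sum_congr rfl fun j _ => ?_
        rw [amk_mul, amk_mul, mul_assoc, ← hz i j]
        congr 3
        change (dite _ _ _ : E.block T.zero i.1.1 j.1.1).1 = _
        exact congrArg Subtype.val (dif_pos (c := T.cls i.1.1 = c ∧ T.cls j.1.1 = c) ⟨i.2, j.2⟩))
    intro i hi j hj
    have h0 := this i.1 (Finset.mem_map_of_mem _ hi) j.1 (Finset.mem_map_of_mem _ hj)
    rw [dif_pos ⟨i.2, j.2⟩] at h0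
    refine Subtype.ext ?_
    rw [← hz i j]
    change T.amk c (z i j).1 = 0
    rw [h0, map_zero]

end WeaklyTriangular

end QuotCoords

/-! ### Modules over the truncated algebras -/

section Truncation

open CornerRing

variable {k A J : Type u} [Field k] [NonUnitalRing A] [Module k A]
  [IsScalarTower k A A] [SMulCommClass k A A]

namespace WeaklyTriangular

open LocallyUnital

variable {E : LocallyUnital k A J} {I : Type t} [PartialOrder I] (T : WeaklyTriangular E I)

/-- If the idempotents whose class lies above those of `b` and `d` kill `M`, then so does
`1_b A 1_d`. -/
lemma eU_smul_smul_eU_smul {M : Type v} [AddCommGroup M] [Module E.Uni M] {b d : J}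
    (hM : ∀ h, T.cls b ≤ T.cls h → T.cls d ≤ T.cls h → ∀ m : M, E.eU h • m = 0)
    (u : E.Uni) (m : M) : E.eU b • u • E.eU d • m = 0 := by
  obtain ⟨x, hx⟩ := exists_mul_inr (E := E) u (E.e d)
  have key : ∀ x : A, E.eU b • (x : E.Uni) • E.eU d • m = 0 := by
    intro x
    induction x using T.pbw_induction with
    | zero => rw [Unitization.inr_zero, zero_smul, smul_zero]
    | add x y hx hy => rw [Unitization.inr_add, add_smul, smul_add, hx, hy, add_zero]
    | mul p q hpq y hy z hz w hw =>
      by_cases hb : T.cls b ≤ T.cls p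
      · by_cases hd : T.cls d ≤ T.cls q
        · have : ((y * (z * w) : A) : E.Uni) =
              ((y * z : A) : E.Uni) * (E.eU q * ((w : A) : E.Uni)) := by
            rw [eU, ← Unitization.inr_mul, e_mul_of_mem_leftPart hw, ← Unitization.inr_mul,
              mul_assoc]
          rw [this, mul_smul, mul_smul, hM q (hpq ▸ hb) hd, smul_zero, smul_zero]
        · have : ((y * (z * w) : A) : E.Uni) * E.eU d = 0 := by
            rw [eU, ← Unitization.inr_mul, mul_assoc, mul_assoc, T.pos_eq_zero hd hw, mul_zero,
              mul_zero, Unitization.inr_zero]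
          rw [← mul_smul _ (E.eU d), this, zero_smul, smul_zero]
      · have : E.eU b * ((y * (z * w) : A) : E.Uni) = 0 := by
          rw [eU, ← Unitization.inr_mul, ← mul_assoc, T.neg_eq_zero hb hy, zero_mul,
            Unitization.inr_zero]
        rw [← mul_smul (E.eU b), this, zero_smul]
  have h1 : u • E.eU d • m = (x : E.Uni) • E.eU d • m := by
    rw [← mul_smul, ← hx]
    change _ = (u * E.eU d) • E.eU d • m
    rw [← mul_smul, mul_assoc, E.eU_mul_self]
  rw [h1, key]

/-- `M` is a module over `A_{≤ a}`. -/
def Killed (a : I) (M : Type v) [AddCommGroup M] [Module E.Uni M] : Prop :=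
  ∀ x ∈ T.idealNotLE a, ∀ m : M, x • m = 0

lemma killed_iff {a : I} {M : Type v} [AddCommGroup M] [Module E.Uni M] :
    T.Killed a M ↔ ∀ b : J, ¬ T.cls b ≤ a → ∀ m : M, E.eU b • m = 0 := by
  refine ⟨fun h b hb m => h _ (T.eU_mem_idealNotLE hb) m, fun h x hx m => ?_⟩
  unfold idealNotLE at hx
  rw [TwoSidedIdeal.mem_span_iff_mem_addSubgroup_closure] at hx
  induction hx using AddSubgroup.closure_induction with
  | mem x hx =>
    obtain ⟨_, ⟨u, -, _, ⟨b, hb, rfl⟩, rfl⟩, u', -, rfl⟩ := hx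
    change (u * T.one b * u') • m = 0
    rw [mul_smul, mul_smul, one, Finset.sum_smul, Finset.sum_eq_zero, smul_zero]
    intro d hd
    exact h d (by rwa [T.mem_class.1 hd]) _
  | zero => rw [zero_smul]
  | add x y _ _ hx hy => rw [add_smul, hx, hy, add_zero]
  | neg x _ hx => rw [neg_smul, hx, neg_zero]

section quotModule

variable {T} {a : I} {M : Type v} [AddCommGroup M] [Module E.Uni M]

/-- The action of the quotient of the unitization on a module killed by the ideal. -/
@[reducible] def quotModule (h : T.Killed a M) : Module (T.quotLE a) M :=
  Module.IsTorsionBySet.module (I := (T.idealNotLE a).asIdeal) (fun m x => h x.1 x.2 m)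

end quotModule

/-- The objects of `A_{≤ a}`-lfdmod on which an element `c` of `Ā_a` acts as the identity of
`1_a M`. -/
def truncProp (a : I) (c : T.Abar a) : ObjectProperty E.Lfdmod := fun X =>
  T.Killed a X.obj ∧ ∀ x : E.Uni, T.qmk a x = c.1 → ∀ m : X.obj, x • m = T.one a • m

/-- The finite dimensional `Ā_a`-modules on which `c` acts as the identity. -/
def fdProp (a : I) (c : T.Abar a) : ObjectProperty (ModuleCat.{u} (T.Abar a)) := fun V =>
  Module.Finite (T.Abar a) V ∧ ∀ v : V, c • v = v

/-- The whole of `1_a A 1_b`. -/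
abbrev _root_.LocallyUnital.hom (E : LocallyUnital k A J) (a b : J) : Submodule k A :=
  (⊤ : Submodule k A).map (LinearMap.mulLeft k (E.e a) ∘ₗ LinearMap.mulRight k (E.e b))

lemma mul_mul_mem_hom (a b : J) (x : A) : E.e a * (x * E.e b) ∈ E.hom a b :=
  ⟨x, Submodule.mem_top, rfl⟩

lemma exists_mem_hom (p q : J) (u : E.Uni) :
    ∃ z ∈ E.hom p q, E.eU p * (u * E.eU q) = ((z : A) : E.Uni) := by
  obtain ⟨x, hx⟩ := exists_mul_inr (E := E) u (E.e q)
  refine ⟨E.e p * (x * E.e q), mul_mul_mem_hom p q x, ?_⟩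
  have : u * E.eU q = (x : E.Uni) * E.eU q := by
    rw [← hx]
    change _ = (u * E.eU q) * E.eU q
    rw [mul_assoc, E.eU_mul_self]
  rw [this, Unitization.inr_mul, Unitization.inr_mul]
  rfl

lemma one_idem (a : I) : IsIdempotentElem (T.one a) := E.isIdempotentElem_sum _

lemma sum_sandwich (a : I) (u : E.Uni) : T.one a * u * T.one a =
    ∑ p ∈ (T.finite_class a).toFinset, ∑ q ∈ (T.finite_class a).toFinset,
      E.eU p * (u * E.eU q) := by
  rw [one, mul_assoc, Finset.sum_mul]
  refine Finset.sum_congr rfl fun p _ => ?_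
  rw [Finset.mul_sum, Finset.mul_sum]

instance finite_corner_one (a : I) : Module.Finite k (T.one_idem a).Corner := by
  classical
  let N : Submodule k E.Uni := (T.finite_class a).toFinset.sup fun p =>
    (T.finite_class a).toFinset.sup fun q => (E.hom p q).map (Unitization.inrHom k k A)
  have hN : Module.Finite k N := by
    rw [Module.Finite.iff_fg]
    refine Submodule.fg_finset_sup _ _ fun p _ => Submodule.fg_finset_sup _ _ fun q _ => ?_
    exact Submodule.FG.map _ (Module.Finite.iff_fg.1 (E.finite p q))
  have hmem : ∀ h : (T.one_idem a).Corner, h.1 ∈ N := by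
    intro h
    have h1 : h.1 = T.one a * h.1 * T.one a := by rw [e_mul, mul_e]
    rw [h1, sum_sandwich]
    refine Submodule.sum_mem _ fun p hp => Submodule.sum_mem _ fun q hq => ?_
    obtain ⟨z, hz, h2⟩ := exists_mem_hom (E := E) p q h.1
    rw [h2]
    have h3 : (E.hom p q).map (Unitization.inrHom k k A) ≤ N :=
      le_trans (Finset.le_sup (f := fun q => (E.hom p q).map (Unitization.inrHom k k A)) hq)
        (Finset.le_sup (f := fun p => (T.finite_class a).toFinset.sup fun q =>
          (E.hom p q).map (Unitization.inrHom k k A)) hp)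
    exact h3 ⟨z, hz, rfl⟩
  let φ : (T.one_idem a).Corner →ₗ[k] N :=
    { toFun := fun h => ⟨h.1, hmem h⟩
      map_add' := fun _ _ => rfl
      map_smul' := fun _ _ => rfl }
  exact Module.Finite.of_injective φ fun x y h => Subtype.ext (congrArg (fun z : N => z.1) h)

/-- The quotient map `1_a A 1_a → Ā_a`. -/
def cornerQmk (a : I) : (T.one_idem a).Corner →ₐ[k] T.Abar a :=
  AlgHom.ofLinearMap
    { toFun := fun h => ⟨T.qmk a h.1, h.1, by
        change T.qmk a (T.one a) * T.qmk a h.1 * T.qmk a (T.one a) = _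
        rw [← map_mul, ← map_mul, e_mul, mul_e]⟩
      map_add' := fun x y => Subtype.ext (map_add (T.qmk a) x.1 y.1)
      map_smul' := fun _ _ => rfl }
    rfl fun x y => Subtype.ext (map_mul (T.qmk a) x.1 y.1)

lemma cornerQmk_surjective (a : I) : Function.Surjective (T.cornerQmk a) := by
  intro h
  obtain ⟨u, hu⟩ := T.qmk_surjective a h.1
  refine ⟨CornerRing.mk (T.one_idem a) u, Subtype.ext ?_⟩
  change T.qmk a (T.one a * u * T.one a) = h.1
  rw [map_mul, map_mul, hu]
  exact (congrArg (· * T.oneBar a) (e_mul (T.oneBar_idem a) h)).trans (mul_e (T.oneBar_idem a) h)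

instance finite_Abar (a : I) : Module.Finite k (T.Abar a) :=
  Module.Finite.of_surjective (T.cornerQmk a).toLinearMap (T.cornerQmk_surjective a)

lemma finite_of_finite {a : I} (V : ModuleCat.{u} (T.Abar a)) [Module.Finite (T.Abar a) V] :
    Module.Finite k V := Module.Finite.trans (T.Abar a) V

/-- `j_! V` is locally finite dimensional. -/
lemma isLfd_standardize (a : I) (V : ModuleCat.{u} (T.Abar a)) (hV : Module.Finite (T.Abar a) V) :
    E.isLfd (T.standardize a V) := by
  classical
  constructor
  · have : E.locUnitalPart (Induced (T.oneBar_idem a) V) = ⊤ := by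
      rw [eq_top_iff]
      rintro z -
      induction z using Induced.induction with
      | zero => exact zero_mem _
      | add z w hz hw => exact add_mem hz hw
      | ten x v =>
        obtain ⟨u, rfl⟩ := T.qmk_surjective a x
        have h1 : Induced.ten (T.oneBar_idem a) (T.qmk a u) v =
            ∑ q ∈ (T.finite_class a).toFinset, T.qmk a (u * E.eU q) •
              Induced.ten (T.oneBar_idem a) 1 v := by
          rw [← Finset.sum_smul, ← map_sum, ← Finset.mul_sum, Induced.smul_ten, mul_one, map_mul]
          exact (Induced.ten_mul_e _ _ _).symm
        rw [h1]
        refine sum_mem fun q _ => ?_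
        obtain ⟨y, hy⟩ := exists_mul_inr (E := E) u (E.e q)
        obtain ⟨s, hs⟩ := E.exists_sum_mul_eq y
        refine ⟨s, ?_⟩
        change T.qmk a (∑ d ∈ s, E.eU d) • T.qmk a (u * E.eU q) •
          Induced.ten (T.oneBar_idem a) 1 v = _
        rw [← mul_smul, ← map_mul]
        congr 2
        exact (congrArg _ hy).trans (hs.trans hy.symm)
    have h2 : ∀ m : Induced (T.oneBar_idem a) V, m ∈ E.locUnitalPart _ := fun m => by
      rw [this]; trivial
    exact h2
  · intro b
    obtain ⟨s, hs⟩ := Module.finite_def.1 hV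
    let Lq : J → V → A →ₗ[k] (T.standardize a V) := fun q v =>
      { toFun := fun x => Induced.ten (T.oneBar_idem a) (T.amk a x) v
        map_add' := fun x y => by rw [map_add]; exact Induced.add_ten _ _ _ _
        map_smul' := fun l x => by
          have h1 : T.amk a (l • x) = T.qmk a (algebraMap k E.Uni l) * T.amk a x := by
            rw [map_smul, Algebra.smul_def]; rfl
          rw [h1, ← Induced.smul_ten]; rfl }
    let N : Submodule k (T.standardize a V) := (T.finite_class a).toFinset.sup fun q =>
      s.sup fun v => (E.hom b q).map (Lq q v)
    have hN : Module.Finite k N := by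
      rw [Module.Finite.iff_fg]
      refine Submodule.fg_finset_sup _ _ fun p _ => Submodule.fg_finset_sup _ _ fun q _ => ?_
      exact Submodule.FG.map _ (Module.Finite.iff_fg.1 (E.finite b p))
    have hmem : ∀ q ∈ (T.finite_class a).toFinset, ∀ v ∈ s, ∀ u : E.Uni,
        (Induced.ten (T.oneBar_idem a) (T.qmk a (E.eU b * (u * E.eU q))) v :
          T.standardize a V) ∈ N := by
      intro q hq v hv u
      obtain ⟨z, hz, h2⟩ := exists_mem_hom (E := E) b q u
      rw [h2]
      have h3 : (E.hom b q).map (Lq q v) ≤ N :=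
        le_trans (Finset.le_sup (f := fun v => (E.hom b q).map (Lq q v)) hv)
          (Finset.le_sup (f := fun q => s.sup fun v => (E.hom b q).map (Lq q v)) hq)
      exact h3 ⟨z, hz, rfl⟩
    refine Submodule.finiteDimensional_of_le (S₂ := N) ?_
    suffices h : ∀ z : Induced (T.oneBar_idem a) V,
        N.carrier (T.qmk a (E.eU b) • z) by
      rintro _ ⟨z, rfl⟩
      exact h z
    intro z
    change (show T.standardize a V from (T.qmk a (E.eU b) • z)) ∈ N
    induction z using Induced.induction with
    | zero => rw [smul_zero]; exact zero_mem _
    | add z w hz hw => rw [smul_add]; exact add_mem hz hw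
    | ten x v =>
      have hv : v ∈ Submodule.span (T.Abar a) (s : Set V) := by rw [hs]; trivial
      induction hv using Submodule.closure_induction generalizing x with
      | zero => rw [Induced.ten_zero, smul_zero]; exact zero_mem _
      | add v w _ _ hv hw => rw [Induced.ten_add, smul_add]; exact add_mem (hv x) (hw x)
      | smul_mem h v hv =>
        rw [← Induced.ten_mul_corner, Induced.smul_ten]
        obtain ⟨u, hu⟩ := T.qmk_surjective a (x * h.1)
        have h1 : Induced.ten (T.oneBar_idem a) (T.qmk a (E.eU b) * (x * h.1)) v =
            ∑ q ∈ (T.finite_class a).toFinset,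
              Induced.ten (T.oneBar_idem a) (T.qmk a (E.eU b * (u * E.eU q))) v := by
          rw [← Induced.ten_mul_e, ← hu]
          let F : T.quotLE a →+ Induced (T.oneBar_idem a) V := AddMonoidHom.mk'
            (fun r => Induced.ten (T.oneBar_idem a) r v) (fun r r' => Induced.add_ten _ r r' v)
          refine Eq.trans ?_ (map_sum F _ _)
          change Induced.ten _ _ _ = Induced.ten _ _ _
          congr 1
          rw [← map_sum, ← Finset.mul_sum, ← Finset.mul_sum, map_mul, map_mul, mul_assoc]
          rfl
        rw [h1]
        exact Submodule.sum_mem _ fun q hq => hmem q hq v hv u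

lemma coinduced_map_smul {a : I} {V : ModuleCat.{u} (T.Abar a)}
    (f : Coinduced (T.oneBar_idem a) V) (l : k) (x : T.quotLE a) :
    f.1 (l • x) = l • f.1 x := by
  have h1 := Coinduced.map_corner_mul (T.oneBar_idem a) f (l • 1) x
  rw [smul_assoc, one_smul] at h1
  rw [← h1, ← Coinduced.map_e_mul (T.oneBar_idem a) f (l • x)]
  congr 1
  change _ = l • T.oneBar a * x
  rw [mul_smul_comm, smul_mul_assoc]

lemma coinduced_smul_eq_zero {a : I} {V : ModuleCat.{u} (T.Abar a)}
    (f : Coinduced (T.oneBar_idem a) V) (b : J)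
    (hf : ∀ p ∈ (T.finite_class a).toFinset, ∀ z ∈ E.hom p b,
      f.1 (T.amk a z * T.qmk a (E.eU b)) = 0) :
    T.qmk a (E.eU b) • f = 0 := by
  refine Subtype.ext (AddMonoidHom.ext fun y => ?_)
  change f.1 (y * T.qmk a (E.eU b)) = 0
  obtain ⟨u, rfl⟩ := T.qmk_surjective a y
  have h1 : T.oneBar a * (T.qmk a u * T.qmk a (E.eU b)) =
      ∑ p ∈ (T.finite_class a).toFinset, T.qmk a (E.eU p * (u * E.eU b)) := by
    change T.qmk a _ * (T.qmk a _ * _) = _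
    rw [← map_mul, ← map_mul, one, Finset.sum_mul, map_sum]
  rw [← Coinduced.map_e_mul (T.oneBar_idem a), h1, map_sum]
  refine Finset.sum_eq_zero fun p hp => ?_
  obtain ⟨z, hz, h2⟩ := exists_mem_hom (E := E) p b u
  have h4 : T.amk a z * T.qmk a (E.eU b) = T.qmk a (E.eU p * (u * E.eU b)) := by
    rw [amk_apply, ← h2, ← map_mul, mul_assoc, mul_assoc, E.eU_mul_self]
  rw [← h4, hf p hp z hz]

/-- The restriction of `f ∈ Hom_{Ā_a}(1̄_a A_{≤ a}, V)` to `1_p A 1_b`. -/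
def coinducedRestrict {a : I} {V : ModuleCat.{u} (T.Abar a)} (f : Coinduced (T.oneBar_idem a) V)
    (p b : J) : E.hom p b →ₗ[k] V where
  toFun x := f.1 (T.amk a x.1)
  map_add' x y := by rw [Submodule.coe_add, map_add, map_add]
  map_smul' l x := by
    rw [Submodule.coe_smul, map_smul]
    exact T.coinduced_map_smul f l _

lemma coinducedRestrict_smul {a : I} {V : ModuleCat.{u} (T.Abar a)}
    (f : Coinduced (T.oneBar_idem a) V) (l : k) (p b : J) :
    T.coinducedRestrict (T.qmk a (algebraMap k E.Uni l) • f) p b =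
      l • T.coinducedRestrict f p b := by
  ext x
  change f.1 (T.amk a x.1 * T.qmk a (algebraMap k E.Uni l)) = l • f.1 (T.amk a x.1)
  rw [← T.coinduced_map_smul, Algebra.smul_def, Algebra.commutes]
  rfl

/-- `j_* V` is locally finite dimensional. -/
lemma isLfd_costandardize (a : I) (V : ModuleCat.{u} (T.Abar a))
    (hV : Module.Finite (T.Abar a) V) : E.isLfd (T.costandardize a V) := by
  constructor
  · rintro ⟨f, s, hs⟩
    exact ⟨s, Subtype.ext hs⟩
  · intro b
    have := T.finite_of_finite V
    have := fun q => E.finite q b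
    let φ : T.costandardize a V →ₗ[k]
        ((q : (T.finite_class a).toFinset) → (E.hom q.1 b →ₗ[k] V)) :=
      { toFun := fun f q => T.coinducedRestrict f.1 q.1 b
        map_add' := fun f g => rfl
        map_smul' := fun l f => funext fun q => T.coinducedRestrict_smul f.1 l q.1 b }
    refine Module.Finite.of_injective (φ ∘ₗ Submodule.subtype _) ?_
    rw [injective_iff_map_eq_zero]
    rintro ⟨f', ⟨f, rfl⟩⟩ hf
    refine Subtype.ext (Subtype.ext (T.coinduced_smul_eq_zero f.1 b fun p hp z hz => ?_))
    exact LinearMap.congr_fun (congrFun hf ⟨p, hp⟩) ⟨z, hz⟩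

lemma killed_standardize (a : I) (V : ModuleCat.{u} (T.Abar a)) :
    T.Killed a (T.standardize a V) := fun x hx z => by
  have key : ∀ z : Induced (T.oneBar_idem a) V, T.qmk a x • z = 0 := fun z => by
    rw [T.qmk_eq_zero_iff.2 hx, zero_smul]
  exact key z

lemma killed_costandardize (a : I) (V : ModuleCat.{u} (T.Abar a)) :
    T.Killed a (T.costandardize a V) := fun x hx z => by
  have key : ∀ z : Coinduced (T.oneBar_idem a) V, T.qmk a x • z = 0 := fun z => by
    rw [T.qmk_eq_zero_iff.2 hx, zero_smul]
  exact Subtype.ext (key z.1)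

lemma c_smul_standardize {a : I} {c : T.Abar a} (V : ModuleCat.{u} (T.Abar a))
    (hc : ∀ v : V, c • v = v) (z : Induced (T.oneBar_idem a) V) :
    c.1 • z = T.oneBar a • z := by
  have h1 := Induced.e_smul_eq (T.oneBar_idem a) z
  have h2 : c.1 • z = c.1 • T.oneBar a • z := by rw [← mul_smul, mul_e]
  have h3 := Induced.ten_mul_corner (T.oneBar_idem a) 1 c (Induced.proj _ z)
  rw [one_mul, hc] at h3
  rw [h2, h1, Induced.smul_ten, mul_one, h3]

lemma c_smul_coinduced {a : I} {c : T.Abar a} (V : ModuleCat.{u} (T.Abar a))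
    (hc : ∀ v : V, c • v = v) (f : Coinduced (T.oneBar_idem a) V) :
    c.1 • f = T.oneBar a • f := by
  have key : ∀ (h : T.Abar a) (x : T.quotLE a),
      (h.1 • f).1 x = CornerRing.mk (T.oneBar_idem a) x • h • f.1 1 := by
    intro h x
    have h1 := Coinduced.map_corner_mul (T.oneBar_idem a) f
      (CornerRing.mk (T.oneBar_idem a) x * h) 1
    rw [mul_smul] at h1
    rw [← h1, Coinduced.smul_apply, ← Coinduced.map_e_mul (T.oneBar_idem a), mul_one, val_mul,
      val_mk, mul_assoc _ _ h.1, e_mul, mul_assoc]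
  refine Subtype.ext (AddMonoidHom.ext fun x => ?_)
  have h2 := key 1 x
  rw [key, hc]
  rw [one_smul] at h2
  exact h2.symm

lemma truncProp_standardize {a : I} {c : T.Abar a} (V : ModuleCat.{u} (T.Abar a))
    (hV : T.fdProp a c V) :
    T.truncProp a c ⟨T.standardize a V, T.isLfd_standardize a V hV.1⟩ := by
  refine ⟨T.killed_standardize a V, fun x hx m => ?_⟩
  have key : ∀ z : Induced (T.oneBar_idem a) V, T.qmk a x • z = T.oneBar a • z := fun z => by
    rw [hx, T.c_smul_standardize V hV.2]
  exact key m

lemma truncProp_costandardize {a : I} {c : T.Abar a} (V : ModuleCat.{u} (T.Abar a))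
    (hV : T.fdProp a c V) :
    T.truncProp a c ⟨T.costandardize a V, T.isLfd_costandardize a V hV.1⟩ := by
  have key : ∀ (x : E.Uni), T.qmk a x = c.1 → ∀ z : Coinduced (T.oneBar_idem a) V,
      T.qmk a x • z = T.oneBar a • z := fun x hx z => by
    rw [hx, T.c_smul_coinduced V hV.2]
  exact ⟨T.killed_costandardize a V, fun x hx m => Subtype.ext (key x hx m.1)⟩

end WeaklyTriangular

end Truncation

/-! ### The truncation functor and its adjoints -/

section TruncationFunctor

open CornerRing

variable {k A J : Type u} [Field k] [NonUnitalRing A] [Module k A]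
  [IsScalarTower k A A] [SMulCommClass k A A]

namespace WeaklyTriangular

variable {E : LocallyUnital k A J} {I : Type t} [PartialOrder I] (T : WeaklyTriangular E I)

/-- The category of the modules satisfying `truncProp a c`. -/
abbrev Tr (a : I) (c : T.Abar a) := (T.truncProp a c).FullSubcategory

/-- The category of the finite dimensional `Ā_a`-modules on which `c` acts as the identity. -/
abbrev Fd (a : I) (c : T.Abar a) := (T.fdProp a c).FullSubcategory

section

variable {T} {a : I} {c : T.Abar a}

instance (X : T.Tr a c) : Module (T.quotLE a) X.obj.obj := quotModule X.property.1

lemma qmk_smul (X : T.Tr a c) (x : E.Uni) (m : X.obj.obj) : T.qmk a x • m = x • m := rfl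

/-- The linear map underlying a morphism. -/
abbrev Tr.lin {X Y : T.Tr a c} (f : X ⟶ Y) : X.obj.obj →ₗ[E.Uni] Y.obj.obj := f.hom.hom.hom

/-- A morphism is linear over the quotient of the unitization. -/
def Tr.linQuot {X Y : T.Tr a c} (f : X ⟶ Y) : X.obj.obj →ₗ[T.quotLE a] Y.obj.obj where
  toFun := Tr.lin f
  map_add' := map_add (Tr.lin f)
  map_smul' r m := by
    obtain ⟨x, rfl⟩ := T.qmk_surjective a r
    exact map_smul (Tr.lin f) x m

/-- The `Ā_a`-module `1_a X`. -/
def Tr.corner (X : T.Tr a c) : ModuleCat.{u} (T.Abar a) :=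
  ModuleCat.of (T.Abar a) (cornerPart (T.oneBar_idem a) X.obj.obj)

lemma Tr.coe_smul_corner (X : T.Tr a c) (l : k) (m : X.corner) :
    ((l • m : X.corner) : cornerPart (T.oneBar_idem a) X.obj.obj).1 =
      l • (m : cornerPart (T.oneBar_idem a) X.obj.obj).1 := by
  have hm := e_smul_cornerPart (T.oneBar_idem a) (m : cornerPart (T.oneBar_idem a) X.obj.obj)
  have h1 : (algebraMap k (T.Abar a) l).1 = T.qmk a (algebraMap k E.Uni l) * T.oneBar a := by
    change (algebraMap k (T.Abar a) l).1 = (algebraMap k (T.quotLE a) l) * T.oneBar a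
    rw [← Algebra.smul_def, Algebra.algebraMap_eq_smul_one]
    rfl
  have h2 : (algebraMap k (T.Abar a) l).1 • (m : cornerPart (T.oneBar_idem a) X.obj.obj).1 =
      T.qmk a (algebraMap k E.Uni l) • (m : cornerPart (T.oneBar_idem a) X.obj.obj).1 := by
    rw [h1, mul_smul, hm]
  exact h2

lemma Tr.finite_corner (X : T.Tr a c) : Module.Finite (T.Abar a) X.corner := by
  have := X.obj.property.2
  let ι : X.corner →ₗ[k] X.obj.obj :=
    { toFun := fun m => (m : cornerPart (T.oneBar_idem a) X.obj.obj).1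
      map_add' := fun _ _ => rfl
      map_smul' := fun l m => Tr.coe_smul_corner X l m }
  let N : Submodule k X.obj.obj := (T.finite_class a).toFinset.sup fun b =>
    LinearMap.range (Algebra.lsmul k k X.obj.obj (E.eU b))
  have hN : Module.Finite k N := by
    rw [Module.Finite.iff_fg]
    exact Submodule.fg_finset_sup _ _ fun p _ => Module.Finite.iff_fg.1 (X.obj.property.2 p)
  have hι : ∀ m, ι m ∈ N := by
    intro m
    have h1 : ι m = T.one a • ι m :=
      (e_smul_cornerPart (T.oneBar_idem a) (m : cornerPart (T.oneBar_idem a) X.obj.obj)).symm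
    rw [h1, one, Finset.sum_smul]
    refine Submodule.sum_mem _ fun b hb => ?_
    exact Finset.le_sup (f := fun b => LinearMap.range (Algebra.lsmul k k X.obj.obj (E.eU b))) hb
      ⟨ι m, rfl⟩
  have : Module.Finite k X.corner :=
    Module.Finite.of_injective (LinearMap.codRestrict N ι hι) fun x y h =>
      Subtype.ext (congrArg (fun z : N => z.1) h)
  exact Module.Finite.of_restrictScalars_finite k (T.Abar a) X.corner

lemma Tr.fdProp_corner (X : T.Tr a c) : T.fdProp a c X.corner := by
  refine ⟨X.finite_corner, fun v => Subtype.ext ?_⟩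
  obtain ⟨x, hx⟩ := T.qmk_surjective a c.1
  have h1 := X.property.2 x hx (v : cornerPart (T.oneBar_idem a) X.obj.obj).1
  change c.1 • (v : cornerPart (T.oneBar_idem a) X.obj.obj).1 = _
  rw [← hx, qmk_smul, h1]
  exact e_smul_cornerPart (T.oneBar_idem a) (v : cornerPart (T.oneBar_idem a) X.obj.obj)

end

variable (a : I) (c : T.Abar a)

/-- The functor `X ↦ 1_a X`. -/
def trunc : T.Tr a c ⥤ T.Fd a c where
  obj X := ⟨X.corner, X.fdProp_corner⟩
  map f := ObjectProperty.homMk (ModuleCat.ofHom (cornerMap (T.oneBar_idem a) (Tr.linQuot f)))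

variable {a c}

/-- The module `j_! V`, as an object of the truncated category. -/
def shriekObj (V : T.Fd a c) : T.Tr a c :=
  ⟨⟨T.standardize a V.obj, T.isLfd_standardize a V.obj V.property.1⟩,
    T.truncProp_standardize V.obj V.property⟩

/-- The module `j_* V`, as an object of the truncated category. -/
def starObj (V : T.Fd a c) : T.Tr a c :=
  ⟨⟨T.costandardize a V.obj, T.isLfd_costandardize a V.obj V.property.1⟩,
    T.truncProp_costandardize V.obj V.property⟩

/-- Linear maps out of an induced module, over `A` and over its quotient. -/
def linInduced (V : T.Fd a c) (X : T.Tr a c) :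
    (T.shriekObj V ⟶ X) ≃ (Induced (T.oneBar_idem a) V.obj →ₗ[T.quotLE a] X.obj.obj) where
  toFun f :=
    { toFun := Tr.lin f
      map_add' := map_add (Tr.lin f)
      map_smul' := fun r m => by
        obtain ⟨x, rfl⟩ := T.qmk_surjective a r
        exact map_smul (Tr.lin f) x m }
  invFun g := ObjectProperty.homMk (ObjectProperty.homMk (ModuleCat.ofHom
    { toFun := g
      map_add' := map_add g
      map_smul' := fun x m => map_smul g (T.qmk a x) m }))
  left_inv f := rfl
  right_inv g := rfl

/-- Linear maps into a coinduced module, over `A` and over its quotient. The image of a locally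
unital module is automatically in the locally unital part. -/
def linCoinduced (V : T.Fd a c) (X : T.Tr a c) :
    (X.obj.obj →ₗ[T.quotLE a] Coinduced (T.oneBar_idem a) V.obj) ≃ (X ⟶ T.starObj V) where
  toFun g := ObjectProperty.homMk (ObjectProperty.homMk (ModuleCat.ofHom
    { toFun := fun m => ⟨g m, by
        obtain ⟨s, hs⟩ := X.obj.property.1 m
        refine ⟨s, ?_⟩
        exact (map_smul g (T.qmk a (∑ a ∈ s, E.eU a)) m).symm.trans (congrArg g hs)⟩
      map_add' := fun m n => Subtype.ext (map_add g m n)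
      map_smul' := fun x m => Subtype.ext (map_smul g (T.qmk a x) m) }))
  invFun f :=
    { toFun := fun m => (Tr.lin f m).1
      map_add' := fun m n => congrArg Subtype.val (map_add (Tr.lin f) m n)
      map_smul' := fun r m => by
        obtain ⟨x, rfl⟩ := T.qmk_surjective a r
        exact congrArg Subtype.val (map_smul (Tr.lin f) x m) }
  left_inv g := rfl
  right_inv f := rfl

/-- Morphisms between finite dimensional `Ā_a`-modules as linear maps. -/
def linFd (V W : T.Fd a c) : (V.obj →ₗ[T.Abar a] W.obj) ≃ (V ⟶ W) where
  toFun g := ObjectProperty.homMk (ModuleCat.ofHom g)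
  invFun f := f.hom.hom
  left_inv _ := rfl
  right_inv _ := rfl

/-- `Hom(j_! V, X) = Hom(V, 1_a X)`. -/
def shriekEquiv (V : T.Fd a c) (X : T.Tr a c) :
    (T.shriekObj V ⟶ X) ≃ (V ⟶ (T.trunc a c).obj X) :=
  ((T.linInduced V X).trans (Induced.homEquiv (T.oneBar_idem a))).trans
    (T.linFd V ((T.trunc a c).obj X))

/-- `Hom(1_a X, V) = Hom(X, j_* V)`. -/
def starEquiv (X : T.Tr a c) (V : T.Fd a c) :
    ((T.trunc a c).obj X ⟶ V) ≃ (X ⟶ T.starObj V) :=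
  ((T.linFd ((T.trunc a c).obj X) V).symm.trans (Coinduced.homEquiv (T.oneBar_idem a))).trans
    (T.linCoinduced V X)

lemma shriekEquiv_naturality (V : T.Fd a c) (X Y : T.Tr a c) (g : X ⟶ Y)
    (h : T.shriekObj V ⟶ X) :
    T.shriekEquiv V Y (h ≫ g) = T.shriekEquiv V X h ≫ (T.trunc a c).map g := rfl

lemma starEquiv_naturality (X Y : T.Tr a c) (V : T.Fd a c) (f : X ⟶ Y)
    (g : (T.trunc a c).obj Y ⟶ V) :
    T.starEquiv X V ((T.trunc a c).map f ≫ g) = f ≫ T.starEquiv Y V g := by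
  refine ObjectProperty.hom_ext _ (ObjectProperty.hom_ext _ (ModuleCat.hom_ext ?_))
  refine LinearMap.ext fun m => Subtype.ext (Subtype.ext (AddMonoidHom.ext fun x => ?_))
  change g.hom.hom _ = g.hom.hom _
  congr 1
  refine Subtype.ext ?_
  change Tr.linQuot f (T.oneBar a • x • m) = T.oneBar a • x • Tr.linQuot f m
  rw [map_smul, map_smul]

variable (a c)

/-- The functor `j_!`. -/
def shriek : T.Fd a c ⥤ T.Tr a c :=
  Adjunction.leftAdjointOfEquiv (G := T.trunc a c) T.shriekEquiv T.shriekEquiv_naturality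

/-- `j_!` is left adjoint to truncation. -/
def shriekAdj : T.shriek a c ⊣ T.trunc a c :=
  Adjunction.adjunctionOfEquivLeft T.shriekEquiv T.shriekEquiv_naturality

/-- The functor `j_*`. -/
def star : T.Fd a c ⥤ T.Tr a c :=
  Adjunction.rightAdjointOfEquiv (F := T.trunc a c) T.starEquiv T.starEquiv_naturality

/-- `j_*` is right adjoint to truncation. -/
def starAdj : T.trunc a c ⊣ T.star a c :=
  Adjunction.adjunctionOfEquivRight T.starEquiv T.starEquiv_naturality

/-- `V ≅ 1_a j_! V`. -/
def truncShriekIso (V : T.Fd a c) : V ≅ (T.trunc a c).obj (T.shriekObj V) :=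
  ObjectProperty.isoMk _ (LinearEquiv.toModuleIso
    (show V.obj ≃ₗ[T.Abar a] (T.shriekObj V).corner from
      { toFun := Induced.cornerEquiv (V := V.obj) (T.oneBar_idem a)
        invFun := (Induced.cornerEquiv (V := V.obj) (T.oneBar_idem a)).symm
        left_inv := (Induced.cornerEquiv (V := V.obj) (T.oneBar_idem a)).left_inv
        right_inv := (Induced.cornerEquiv (V := V.obj) (T.oneBar_idem a)).right_inv
        map_add' := (Induced.cornerEquiv (V := V.obj) (T.oneBar_idem a)).map_add'
        map_smul' := fun h v => by
          refine Subtype.ext ?_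
          obtain ⟨x, hx⟩ := T.qmk_surjective a h.1
          refine (congrArg Subtype.val
            ((Induced.cornerEquiv (V := V.obj) (T.oneBar_idem a)).map_smul' h v)).trans ?_
          change h.1 • Induced.ten (T.oneBar_idem a) 1 v =
            h.1 • (show (T.shriekObj V).obj.obj from Induced.ten (T.oneBar_idem a) 1 v)
          rw [← hx]
          rfl }))

lemma shriekAdj_unit_app (V : T.Fd a c) :
    (T.shriekAdj a c).unit.app V = (T.truncShriekIso a c V).hom := by
  unfold shriekAdj
  rw [Adjunction.adjunctionOfEquivLeft_unit_app]
  rfl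

instance : IsIso (T.shriekAdj a c).unit := by
  have : ∀ V, IsIso ((T.shriekAdj a c).unit.app V) := fun V => by
    rw [shriekAdj_unit_app]; exact Iso.isIso_hom _
  exact NatIso.isIso_of_isIso_app _

instance : (T.shriek a c).Full := (T.shriekAdj a c).fullyFaithfulLOfIsIsoUnit.full

instance : (T.shriek a c).Faithful := (T.shriekAdj a c).fullyFaithfulLOfIsIsoUnit.faithful

end WeaklyTriangular

end TruncationFunctor

/-! ### Elementwise reasoning in `A`-lfdmod -/

section Elementwise

variable {k A J : Type u} [Field k] [NonUnitalRing A] [Module k A]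
  [IsScalarTower k A A] [SMulCommClass k A A]

namespace LocallyUnital

variable {E : LocallyUnital k A J}

namespace Lfdmod

/-- The linear map underlying a morphism of `A`-lfdmod. -/
abbrev lin {X Y : E.Lfdmod} (f : X ⟶ Y) : X.obj →ₗ[E.Uni] Y.obj := f.hom.hom

/-- The morphism given by a linear map. -/
abbrev ofLin {X Y : E.Lfdmod} (f : X.obj →ₗ[E.Uni] Y.obj) : X ⟶ Y :=
  ObjectProperty.homMk (ModuleCat.ofHom f)

lemma hom_ext_lin {X Y : E.Lfdmod} {f g : X ⟶ Y} (h : ∀ x, lin f x = lin g x) : f = g :=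
  ObjectProperty.hom_ext _ (ModuleCat.hom_ext (LinearMap.ext h))

/-- A submodule, as an object of `A`-lfdmod. -/
abbrev sub (X : E.Lfdmod) (N : Submodule E.Uni X.obj) : E.Lfdmod :=
  ⟨ModuleCat.of E.Uni N, E.isLfd_of_injective X.property (ModuleCat.ofHom N.subtype)
    N.injective_subtype⟩

/-- The inclusion of a submodule. -/
abbrev subι (X : E.Lfdmod) (N : Submodule E.Uni X.obj) : X.sub N ⟶ X := ofLin N.subtype

/-- A quotient module, as an object of `A`-lfdmod. -/
abbrev quo (X : E.Lfdmod) (N : Submodule E.Uni X.obj) : E.Lfdmod :=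
  ⟨ModuleCat.of E.Uni (X.obj ⧸ N), E.isLfd_of_surjective X.property (ModuleCat.ofHom N.mkQ)
    N.mkQ_surjective⟩

/-- The projection to a quotient module. -/
abbrev quoπ (X : E.Lfdmod) (N : Submodule E.Uni X.obj) : X ⟶ X.quo N := ofLin N.mkQ

/-- The isomorphism given by a linear equivalence. -/
abbrev isoOfLin {X Y : E.Lfdmod} (f : X.obj ≃ₗ[E.Uni] Y.obj) : X ≅ Y :=
  ObjectProperty.isoMk _ f.toModuleIso

/-- The linear equivalence given by an isomorphism. -/
abbrev linOfIso {X Y : E.Lfdmod} (f : X ≅ Y) : X.obj ≃ₗ[E.Uni] Y.obj :=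
  (E.isLfd.ι.mapIso f).toLinearEquiv

lemma mono_iff {X Y : E.Lfdmod} (f : X ⟶ Y) : Mono f ↔ Function.Injective (lin f) := by
  constructor
  · intro hf
    rw [← LinearMap.ker_eq_bot, eq_bot_iff]
    intro x hx
    have h1 : X.subι (LinearMap.ker (lin f)) = 0 := by
      rw [← cancel_mono f, zero_comp]
      exact hom_ext_lin fun y => y.2
    exact congrArg (fun g : X.sub (LinearMap.ker (lin f)) ⟶ X => lin g ⟨x, hx⟩) h1
  · intro hf
    have : Mono (E.isLfd.ι.map f) := (ModuleCat.mono_iff_injective _).2 hf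
    exact E.isLfd.ι.mono_of_mono_map this

lemma epi_iff {X Y : E.Lfdmod} (f : X ⟶ Y) : Epi f ↔ Function.Surjective (lin f) := by
  constructor
  · intro hf
    rw [← LinearMap.range_eq_top, eq_top_iff]
    intro y _
    have h1 : Y.quoπ (LinearMap.range (lin f)) = 0 := by
      rw [← cancel_epi f]
      exact hom_ext_lin fun x => (Submodule.Quotient.mk_eq_zero _).2 ⟨x, rfl⟩
    have h2 := congrArg (fun g : Y ⟶ Y.quo (LinearMap.range (lin f)) => lin g y) h1
    exact (Submodule.Quotient.mk_eq_zero _).1 h2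
  · intro hf
    have : Epi (E.isLfd.ι.map f) := (ModuleCat.epi_iff_surjective _).2 hf
    exact E.isLfd.ι.epi_of_epi_map this

lemma isZero_iff {X : E.Lfdmod} : IsZero X ↔ ∀ x : X.obj, x = 0 := by
  constructor
  · intro h x
    exact congrArg (fun g : X ⟶ X => lin g x) (h.eq_of_src (𝟙 X) 0)
  · intro h
    rw [IsZero.iff_id_eq_zero]
    exact hom_ext_lin fun x => h _

lemma simple_iff {X : E.Lfdmod} : Simple X ↔ IsSimpleModule E.Uni X.obj := by
  constructor
  · intro h
    have hne : ∃ x : X.obj, x ≠ 0 := by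
      by_contra! h'
      exact Simple.not_isZero X (isZero_iff.2 h')
    obtain ⟨x, hx⟩ := hne
    have : Nontrivial X.obj := ⟨x, 0, hx⟩
    refine (isSimpleModule_iff _ _).2 { eq_bot_or_eq_top := fun N => ?_ }
    by_cases hN : X.subι N = 0
    · left
      rw [eq_bot_iff]
      intro y hy
      exact congrArg (fun g : X.sub N ⟶ X => lin g ⟨y, hy⟩) hN
    · right
      have hm : Mono (X.subι N) := (mono_iff _).2 N.injective_subtype
      have := isIso_of_mono_of_nonzero hN
      rw [eq_top_iff]
      intro y _
      obtain ⟨z, rfl⟩ := (epi_iff (X.subι N)).1 inferInstance y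
      exact z.2
  · intro h
    have hs := (isSimpleModule_iff _ _).1 h
    refine ⟨fun {Y} f hf => ⟨fun hi h0 => ?_, fun h0 => ?_⟩⟩
    · have := IsSimpleModule.nontrivial E.Uni X.obj
      obtain ⟨x, hx⟩ := exists_ne (0 : X.obj)
      obtain ⟨y, rfl⟩ := (epi_iff f).1 inferInstance x
      exact hx (congrArg (fun g : Y ⟶ X => lin g y) h0)
    · have he : Epi f := by
        rw [epi_iff, ← LinearMap.range_eq_top]
        refine (hs.eq_bot_or_eq_top _).resolve_left fun h1 => h0 (hom_ext_lin fun y => ?_)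
        have : lin f y ∈ LinearMap.range (lin f) := ⟨y, rfl⟩
        rw [h1] at this
        exact this
      exact isIso_of_mono_of_epi f

lemma exists_sub_of_isSubquotient {X Y : E.Lfdmod} (h : IsSubquotient Y X) :
    ∃ (N : Submodule E.Uni X.obj) (p : N →ₗ[E.Uni] Y.obj), Function.Surjective p := by
  obtain ⟨Z, i, p, hi, hp⟩ := h
  let e := LinearEquiv.ofInjective (lin i) ((mono_iff i).1 hi)
  exact ⟨LinearMap.range (lin i), (lin p).comp e.symm.toLinearMap,
    ((epi_iff p).1 hp).comp e.symm.surjective⟩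

lemma isSubquotient_of_sub {X Y : E.Lfdmod} (N : Submodule E.Uni X.obj) (p : N →ₗ[E.Uni] Y.obj)
    (hp : Function.Surjective p) : IsSubquotient Y X :=
  ⟨X.sub N, X.subι N, ofLin p, (mono_iff _).2 N.injective_subtype, (epi_iff _).2 hp⟩

/-- Short exact sequences in `A`-lfdmod, elementwise. -/
lemma shortExact_of_lin (S : ShortComplex E.Lfdmod) (hf : Function.Injective (lin S.f))
    (hg : Function.Surjective (lin S.g)) (hfg : ∀ x, lin S.g x = 0 → ∃ y, lin S.f y = x) :
    S.ShortExact := by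
  have hm : Mono S.f := (mono_iff _).2 hf
  have he : Epi S.g := (epi_iff _).2 hg
  refine { exact := ?_ }
  refine ShortComplex.exact_of_f_is_kernel S (KernelFork.IsLimit.ofι' S.f S.zero ?_)
  intro Z h hh
  have h0 : ∀ z, lin S.g (lin h z) = 0 := fun z =>
    congrArg (fun g : Z ⟶ S.X₃ => lin g z) hh
  let e := LinearEquiv.ofInjective (lin S.f) hf
  refine ⟨ofLin (e.symm.toLinearMap.comp (LinearMap.codRestrict _ (lin h)
    fun z => hfg _ (h0 z))), hom_ext_lin fun z => ?_⟩
  have := e.apply_symm_apply ⟨lin h z, hfg _ (h0 z)⟩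
  exact congrArg Subtype.val this

lemma exists_kernel_elem {X Y : E.Lfdmod} (f : X ⟶ Y) (x : X.obj) (hx : lin f x = 0) :
    ∃ z, lin (kernel.ι f) z = x := by
  have h : X.subι (LinearMap.ker (lin f)) ≫ f = 0 := hom_ext_lin fun y => y.2
  refine ⟨lin (kernel.lift f _ h) ⟨x, hx⟩, ?_⟩
  exact congrArg (fun g : X.sub (LinearMap.ker (lin f)) ⟶ X => lin g ⟨x, hx⟩)
    (kernel.lift_ι f _ h)

lemma kernel_ι_apply {X Y : E.Lfdmod} (f : X ⟶ Y) (z) : lin f (lin (kernel.ι f) z) = 0 :=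
  congrArg (fun g : kernel f ⟶ Y => lin g z) (kernel.condition f)

lemma kernel_ι_injective {X Y : E.Lfdmod} (f : X ⟶ Y) : Function.Injective (lin (kernel.ι f)) :=
  (mono_iff _).1 inferInstance

lemma exists_of_cokernel {X Y : E.Lfdmod} (f : X ⟶ Y) (y : Y.obj)
    (hy : lin (cokernel.π f) y = 0) : ∃ x, lin f x = y := by
  have h : f ≫ Y.quoπ (LinearMap.range (lin f)) = 0 :=
    hom_ext_lin fun x => (Submodule.Quotient.mk_eq_zero _).2 ⟨x, rfl⟩
  have h1 := congrArg (fun g : Y ⟶ Y.quo (LinearMap.range (lin f)) => lin g y)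
    (cokernel.π_desc f _ h)
  have h2 : lin (cokernel.desc f _ h) (lin (cokernel.π f) y) = Submodule.Quotient.mk y := h1
  rw [hy, map_zero] at h2
  exact (Submodule.Quotient.mk_eq_zero _).1 h2.symm

lemma cokernel_π_apply {X Y : E.Lfdmod} (f : X ⟶ Y) (x) :
    lin (cokernel.π f) (lin f x) = 0 :=
  congrArg (fun g : X ⟶ cokernel f => lin g x) (cokernel.condition f)

lemma cokernel_π_surjective {X Y : E.Lfdmod} (f : X ⟶ Y) :
    Function.Surjective (lin (cokernel.π f)) :=
  (epi_iff _).1 inferInstance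

/-- A direct summand of a projective module is a projective object of `A`-lfdmod. -/
lemma projective_of_module (X : E.Lfdmod) (hX : ∀ {Y Z : ModuleCat.{u} E.Uni}
    (p : Y →ₗ[E.Uni] Z) (f : X.obj →ₗ[E.Uni] Z), Function.Surjective p →
    ∃ g : X.obj →ₗ[E.Uni] Y, ∀ x, p (g x) = f x) : Projective X := by
  refine ⟨fun {Z Y} f p hp => ?_⟩
  obtain ⟨g, hg⟩ := hX (lin p) (lin f) ((epi_iff p).1 hp)
  exact ⟨ofLin g, hom_ext_lin hg⟩

end Lfdmod

end LocallyUnital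

end Elementwise

/-! ### Projective covers, injective hulls and equivalences -/

section Covers

variable {C : Type w} [Category.{v} C] {D : Type w'} [Category.{v'} D]

lemma IsProjCover.comp_iso {P X Y : C} {π : P ⟶ X} (h : IsProjCover π) (e : X ≅ Y) :
    IsProjCover (π ≫ e.hom) := by
  obtain ⟨h1, h2, h3⟩ := h
  refine ⟨h1, inferInstance, fun Z f hf => h3 Z f ?_⟩
  have : f ≫ π = (f ≫ π ≫ e.hom) ≫ e.inv := by simp
  rw [this]
  exact epi_comp _ _

lemma IsProjCover.map_equivalence {P X : C} {π : P ⟶ X} (h : IsProjCover π) (Ψ : C ≌ D) :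
    IsProjCover (Ψ.functor.map π) := by
  obtain ⟨h1, h2, h3⟩ := h
  refine ⟨(Ψ.map_projective_iff P).2 h1, inferInstance, fun Y f hf => ?_⟩
  have h4 : Epi (Ψ.inverse.map f ≫ Ψ.unitIso.inv.app P) := by
    refine h3 _ _ ?_
    have h5 : (Ψ.inverse.map f ≫ Ψ.unitIso.inv.app P) ≫ π =
        Ψ.inverse.map (f ≫ Ψ.functor.map π) ≫ Ψ.unitIso.inv.app X := by simp
    rw [h5]
    exact epi_comp _ _
  have h6 : Epi (Ψ.inverse.map f) := by
    have : Ψ.inverse.map f = (Ψ.inverse.map f ≫ Ψ.unitIso.inv.app P) ≫ Ψ.unitIso.hom.app P := by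
      simp
    rw [this]
    exact epi_comp _ _
  exact Ψ.inverse.epi_of_epi_map h6

lemma IsInjHull.iso_comp {X Y Q : C} {ι : X ⟶ Q} (h : IsInjHull ι) (e : Y ≅ X) :
    IsInjHull (e.hom ≫ ι) := by
  obtain ⟨h1, h2, h3⟩ := h
  refine ⟨h1, inferInstance, fun Z f hf => h3 Z f ?_⟩
  have : ι ≫ f = e.inv ≫ ((e.hom ≫ ι) ≫ f) := by simp
  rw [this]
  exact mono_comp _ _

lemma IsInjHull.map_equivalence {X Q : C} {ι : X ⟶ Q} (h : IsInjHull ι) (Ψ : C ≌ D) :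
    IsInjHull (Ψ.functor.map ι) := by
  obtain ⟨h1, h2, h3⟩ := h
  refine ⟨(Ψ.map_injective_iff Q).2 h1, inferInstance, fun Y f hf => ?_⟩
  have h4 : Mono (Ψ.unitIso.hom.app Q ≫ Ψ.inverse.map f) := by
    refine h3 _ _ ?_
    have h5 : ι ≫ Ψ.unitIso.hom.app Q ≫ Ψ.inverse.map f =
        Ψ.unitIso.hom.app X ≫ Ψ.inverse.map (Ψ.functor.map ι ≫ f) := by simp
    rw [h5]
    exact mono_comp _ _
  have h6 : Mono (Ψ.inverse.map f) := by
    have : Ψ.inverse.map f = Ψ.unitIso.inv.app Q ≫ (Ψ.unitIso.hom.app Q ≫ Ψ.inverse.map f) := by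
      simp
    rw [this]
    exact mono_comp _ _
  exact Ψ.inverse.mono_of_mono_map h6

/-- Full subcategories given by equivalent properties are adjoint to each other. -/
def fullSubcategoryAdj {P Q : ObjectProperty C} (h : P ≤ Q) (h' : Q ≤ P) :
    ObjectProperty.ιOfLE h ⊣ ObjectProperty.ιOfLE h' :=
  Adjunction.mkOfHomEquiv
    { homEquiv := fun X Y =>
        { toFun := fun f => ObjectProperty.homMk f.hom
          invFun := fun f => ObjectProperty.homMk f.hom
          left_inv := fun _ => rfl
          right_inv := fun _ => rfl } }

end Covers

/-! ### The strata -/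

section Strata

open CornerRing LocallyUnital

variable {k A J : Type u} [Field k] [NonUnitalRing A] [Module k A]
  [IsScalarTower k A A] [SMulCommClass k A A]

namespace WeaklyTriangular

variable {E : LocallyUnital k A J} {I : Type t} [PartialOrder I] (T : WeaklyTriangular E I)

lemma truncProp_of_injective {a : I} {c : T.Abar a} {X Y : E.Lfdmod} (f : X ⟶ Y)
    (hf : Function.Injective (Lfdmod.lin f)) (hY : T.truncProp a c Y) : T.truncProp a c X := by
  refine ⟨fun x hx m => hf ?_, fun x hx m => hf ?_⟩
  · rw [map_smul, map_zero, hY.1 x hx]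
  · rw [map_smul, map_smul, hY.2 x hx]

lemma truncProp_of_surjective {a : I} {c : T.Abar a} {X Y : E.Lfdmod} (f : X ⟶ Y)
    (hf : Function.Surjective (Lfdmod.lin f)) (hX : T.truncProp a c X) : T.truncProp a c Y := by
  refine ⟨fun x hx m => ?_, fun x hx m => ?_⟩ <;> obtain ⟨m, rfl⟩ := hf m
  · rw [← map_smul, hX.1 x hx, map_zero]
  · rw [← map_smul, ← map_smul, hX.2 x hx]

lemma mem_corner_iff {a : I} {c : T.Abar a} (X : T.Tr a c) (m : X.obj.obj) :
    m ∈ cornerPart (T.oneBar_idem a) X.obj.obj ↔ T.one a • m = m := Iff.rfl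

lemma one_smul_one_smul {M : Type v} [AddCommGroup M] [Module E.Uni M] (a : I) (m : M) :
    T.one a • T.one a • m = T.one a • m := by
  rw [← mul_smul]
  congr 1
  exact E.isIdempotentElem_sum _

lemma isIso_trunc_iff {a : I} {c : T.Abar a} {X Y : T.Tr a c} (f : X ⟶ Y) :
    IsIso ((T.trunc a c).map f) ↔
      (∀ m : (kernel f.hom).obj, T.one a • m = m → m = 0) ∧
      ∀ m : (cokernel f.hom).obj, T.one a • m = m → m = 0 := by
  have h1 : IsIso ((T.trunc a c).map f) ↔
      Function.Bijective (cornerMap (T.oneBar_idem a) (Tr.linQuot f)) := by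
    rw [← ObjectProperty.isIso_hom_iff]
    exact ConcreteCategory.isIso_iff_bijective _
  rw [h1]
  constructor
  · rintro ⟨hi, hs⟩
    constructor
    · intro m hm
      refine Lfdmod.kernel_ι_injective f.hom ?_
      rw [map_zero]
      have h2 : Lfdmod.lin (kernel.ι f.hom) m ∈ cornerPart (T.oneBar_idem a) X.obj.obj := by
        rw [mem_corner_iff, ← map_smul, hm]
      have h3 := @hi ⟨_, h2⟩ 0 (Subtype.ext (by
        rw [map_zero]; exact Lfdmod.kernel_ι_apply f.hom m))
      exact congrArg Subtype.val h3
    · intro m hm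
      obtain ⟨y, rfl⟩ := Lfdmod.cokernel_π_surjective f.hom m
      have h2 : T.one a • y ∈ cornerPart (T.oneBar_idem a) Y.obj.obj := by
        rw [mem_corner_iff, one_smul_one_smul]
      obtain ⟨x, hx⟩ := hs ⟨_, h2⟩
      rw [← hm, ← map_smul]
      have h3 : Lfdmod.lin f.hom x.1 = T.one a • y := congrArg Subtype.val hx
      rw [← h3, Lfdmod.cokernel_π_apply]
  · rintro ⟨hk, hc⟩
    constructor
    · rw [injective_iff_map_eq_zero]
      rintro ⟨m, hm⟩ h0
      obtain ⟨z, hz⟩ := Lfdmod.exists_kernel_elem f.hom m (congrArg Subtype.val h0)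
      have h2 : T.one a • z = z := Lfdmod.kernel_ι_injective f.hom (by
        rw [map_smul, hz]; exact hm)
      refine Subtype.ext ?_
      change m = 0
      rw [← hz, hk z h2, map_zero]
    · rintro ⟨y, hy⟩
      have h2 := hc (Lfdmod.lin (cokernel.π f.hom) y) (by
        rw [← map_smul]; exact congrArg _ hy)
      obtain ⟨x, hx⟩ := Lfdmod.exists_of_cokernel f.hom y h2
      refine ⟨⟨T.one a • x, T.one_smul_one_smul a x⟩, Subtype.ext ?_⟩
      refine (map_smul (Lfdmod.lin f.hom) (T.one a) x).trans ?_
      rw [hx]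
      exact hy

variable {B : Type w} {Λ : Type w'} [PartialOrder Λ]

/-- The Serre subcategories at `l` are those of the modules over `A_{≤ a}` on whose truncation `c`
acts as the identity, and of the modules whose truncation vanishes. -/
structure IsStratum (L : B → E.Lfdmod) (ρ : B → Λ) (l : Λ) (a : I) (c : T.Abar a) : Prop where
  le_iff : ∀ X, serreLE L ρ l X ↔ T.truncProp a c X
  lt_iff : ∀ X, T.truncProp a c X →
    (serreLT L ρ l X ↔ ∀ m : X.obj, T.one a • m = m → m = 0)

namespace IsStratum

variable {T} {L : B → E.Lfdmod} {ρ : B → Λ} {l : Λ} {a : I} {c : T.Abar a}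
  (H : T.IsStratum L ρ l a c)

/-- The truncation functor on the Serre subcategory. -/
def functor : (serreLE L ρ l).FullSubcategory ⥤ T.Fd a c :=
  ObjectProperty.ιOfLE (fun X => (H.le_iff X).1) ⋙ T.trunc a c

/-- The left adjoint of truncation. -/
def shriek : T.Fd a c ⥤ (serreLE L ρ l).FullSubcategory :=
  T.shriek a c ⋙ ObjectProperty.ιOfLE (fun X => (H.le_iff X).2)

/-- The right adjoint of truncation. -/
def star : T.Fd a c ⥤ (serreLE L ρ l).FullSubcategory :=
  T.star a c ⋙ ObjectProperty.ιOfLE (fun X => (H.le_iff X).2)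

/-- The left adjunction. -/
def shriekAdj : H.shriek ⊣ H.functor := (T.shriekAdj a c).comp (fullSubcategoryAdj _ _)

/-- The right adjunction. -/
def starAdj : H.functor ⊣ H.star := (fullSubcategoryAdj _ _).comp (T.starAdj a c)

lemma stratumW_eq :
    stratumW L ρ l = (MorphismProperty.isomorphisms (T.Fd a c)).inverseImage H.functor := by
  ext X Y f
  let f' := (ObjectProperty.ιOfLE (fun X => (H.le_iff X).1)).map f
  refine Iff.trans ?_ (T.isIso_trunc_iff f').symm
  refine and_congr (H.lt_iff _ ?_) (H.lt_iff _ ?_)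
  · exact T.truncProp_of_injective (kernel.ι f.hom) (Lfdmod.kernel_ι_injective f.hom)
      ((H.le_iff _).1 X.property)
  · exact T.truncProp_of_surjective (cokernel.π f.hom) (Lfdmod.cokernel_π_surjective f.hom)
      ((H.le_iff _).1 Y.property)

instance : H.shriek.Full := by unfold shriek; infer_instance

instance : H.shriek.Faithful := by unfold shriek; infer_instance

/-- Truncation exhibits the category of finite dimensional modules as the Serre quotient. -/
lemma isLocalization : H.functor.IsLocalization (stratumW L ρ l) := by
  rw [H.stratumW_eq]
  exact H.shriekAdj.isLocalization'

/-- The stratum is equivalent to the category of finite dimensional `Ā_a`-modules on which `c`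
acts as the identity. -/
def equiv : Stratum L ρ l ≌ T.Fd a c :=
  letI := H.isLocalization
  Localization.equivalenceFromModel H.functor (stratumW L ρ l)

/-- The quotient functor corresponds to truncation. -/
def qIso : stratumQ L ρ l ⋙ H.equiv.functor ≅ H.functor :=
  letI := H.isLocalization
  Localization.qCompEquivalenceFromModelFunctorIso H.functor (stratumW L ρ l)

/-- The quotient functor corresponds to truncation. -/
def invIso : H.functor ⋙ H.equiv.inverse ≅ stratumQ L ρ l :=
  letI := H.isLocalization
  Localization.compEquivalenceFromModelInverseIso H.functor (stratumW L ρ l)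

/-- The left adjoint of the quotient functor. -/
def shriekQAdj : H.equiv.functor ⋙ H.shriek ⊣ stratumQ L ρ l :=
  (H.equiv.toAdjunction.comp H.shriekAdj).ofNatIsoRight H.invIso

/-- The right adjoint of the quotient functor. -/
def starQAdj : stratumQ L ρ l ⊣ H.equiv.functor ⋙ H.star :=
  (H.starAdj.comp H.equiv.symm.toAdjunction).ofNatIsoLeft H.invIso

lemma isRightAdjoint (H : T.IsStratum L ρ l a c) : (stratumQ L ρ l).IsRightAdjoint :=
  H.shriekQAdj.isRightAdjoint

lemma isLeftAdjoint (H : T.IsStratum L ρ l a c) : (stratumQ L ρ l).IsLeftAdjoint :=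
  H.starQAdj.isLeftAdjoint

lemma isShriek {M : Stratum L ρ l} {V : T.Fd a c} (e : H.equiv.functor.obj M ≅ V) :
    IsShriek L ρ M (T.shriekObj V).obj :=
  ⟨H.equiv.functor ⋙ H.shriek, H.shriekQAdj,
    ⟨(serreLE L ρ l).ι.mapIso (H.shriek.mapIso e.symm)⟩⟩

lemma isStar {M : Stratum L ρ l} {V : T.Fd a c} (e : H.equiv.functor.obj M ≅ V) :
    IsStar L ρ M (T.starObj V).obj :=
  ⟨H.equiv.functor ⋙ H.star, H.starQAdj,
    ⟨(serreLE L ρ l).ι.mapIso (H.star.mapIso e.symm)⟩⟩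

lemma stratumEquivFdmod (H : T.IsStratum L ρ l a c) {S : Type u} [Ring S] [Algebra k S]
    (e : T.Fd a c ≌ FGModuleCat.{u} S)
    (he : (T.trunc a c ⋙ e.functor ⋙ (ModuleCat.isFG.{u} S).ι).Additive)
    (he' : (T.trunc a c ⋙ e.functor ⋙ (ModuleCat.isFG.{u} S).ι).Linear k) :
    StratumEquivFdmod k L ρ l S := by
  let F := ObjectProperty.ιOfLE (fun X => (H.le_iff X).1) ⋙
    (T.trunc a c ⋙ e.functor ⋙ (ModuleCat.isFG.{u} S).ι)
  let i : F ≅ stratumQ L ρ l ⋙ (H.equiv.trans e).functor ⋙ (ModuleCat.isFG.{u} S).ι :=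
    Functor.isoWhiskerRight H.qIso.symm (e.functor ⋙ (ModuleCat.isFG.{u} S).ι)
  have h1 : F.Additive := ⟨fun {X Y f g} => he.map_add
    (f := (ObjectProperty.ιOfLE (fun X => (H.le_iff X).1)).map f)
    (g := (ObjectProperty.ιOfLE (fun X => (H.le_iff X).1)).map g)⟩
  have h2 : F.Linear k := ⟨fun {X Y} f r => he'.map_smul
    ((ObjectProperty.ιOfLE (fun X => (H.le_iff X).1)).map f) r⟩
  exact ⟨H.equiv.trans e, Functor.additive_of_iso i, Functor.linear_of_iso k i⟩

end IsStratum

variable {T} {L : B → E.Lfdmod} {ρ : B → Λ}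

/-- A module in `R_{≤ l}`, as an object of the truncated category. -/
abbrev IsStratum.toTr {l : Λ} {a : I} {c : T.Abar a} (H : T.IsStratum L ρ l a c) {X : E.Lfdmod}
    (hX : serreLE L ρ l X) : T.Tr a c := ⟨X, (H.le_iff X).1 hX⟩

/-- The image of an object in the stratum is its truncation. -/
def IsStratum.objIso {l : Λ} {a : I} {c : T.Abar a} (H : T.IsStratum L ρ l a c) {X : E.Lfdmod}
    (hX : serreLE L ρ l X) :
    H.equiv.functor.obj ((stratumQ L ρ l).obj ⟨X, hX⟩) ≅ (T.trunc a c).obj (H.toTr hX) :=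
  H.qIso.app ⟨X, hX⟩

variable {b : B} {a : I} {c : T.Abar a}

lemma IsStratum.isProperStandard (H : T.IsStratum L ρ (ρ b) a c)
    (hb : serreLE L ρ (ρ b) (L b)) {S : T.Fd a c} (e : (T.trunc a c).obj (H.toTr hb) ≅ S)
    : IsProperStandard L ρ b (T.shriekObj S).obj :=
  ⟨hb, H.isShriek (H.objIso hb ≪≫ e)⟩

lemma IsStratum.isProperCostandard (H : T.IsStratum L ρ (ρ b) a c)
    (hb : serreLE L ρ (ρ b) (L b)) {S : T.Fd a c} (e : (T.trunc a c).obj (H.toTr hb) ≅ S)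
    : IsProperCostandard L ρ b (T.starObj S).obj :=
  ⟨hb, H.isStar (H.objIso hb ≪≫ e)⟩

lemma IsStratum.isStandard (H : T.IsStratum L ρ (ρ b) a c)
    (hb : serreLE L ρ (ρ b) (L b)) {S : T.Fd a c} (e : (T.trunc a c).obj (H.toTr hb) ≅ S)
    {P : T.Fd a c} {π : P ⟶ S} (hπ : IsProjCover π) :
    IsStandard L ρ b (T.shriekObj P).obj :=
  ⟨hb, H.equiv.inverse.obj P, _,
    (hπ.map_equivalence H.equiv.symm).comp_iso
      (H.equiv.inverse.mapIso (H.objIso hb ≪≫ e).symm ≪≫ (H.equiv.unitIso.app _).symm),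
    H.isShriek (H.equiv.counitIso.app P)⟩

lemma IsStratum.isCostandard (H : T.IsStratum L ρ (ρ b) a c)
    (hb : serreLE L ρ (ρ b) (L b)) {S : T.Fd a c} (e : (T.trunc a c).obj (H.toTr hb) ≅ S)
    {Q : T.Fd a c} {ι : S ⟶ Q} (hι : IsInjHull ι) :
    IsCostandard L ρ b (T.starObj Q).obj :=
  ⟨hb, H.equiv.inverse.obj Q, _,
    (hι.map_equivalence H.equiv.symm).iso_comp
      (H.equiv.unitIso.app _ ≪≫ H.equiv.inverse.mapIso (H.objIso hb ≪≫ e)),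
    H.isStar (H.equiv.counitIso.app Q)⟩

end WeaklyTriangular

end Strata

/-! ### Finite dimensional algebras: idempotents -/

section FiniteDimensional

open Polynomial

variable {k : Type v} {R : Type u} [Field k] [Ring R] [Algebra k R]

lemma aeval_idempotent {f : R} (hf : IsIdempotentElem f) {p : k[X]} (h0 : p.eval 0 = 0)
    (h1 : p.eval 1 = 1) : aeval f p = f := by
  have hd : (X - C 0) * (X - C 1) ∣ p - X := by
    refine IsCoprime.mul_dvd (isCoprime_X_sub_C_of_isUnit_sub (by simp)) ?_ ?_ <;>
      rw [dvd_iff_isRoot] <;> simp [h0, h1]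
  obtain ⟨q, hq⟩ := hd
  have h2 : p = X + (X - C 0) * (X - C 1) * q := by rw [← hq]; ring
  rw [h2]
  simp only [map_add, map_mul, map_sub, aeval_X, map_zero, map_one, sub_zero, mul_sub,
    mul_one, hf.eq, sub_self, zero_mul, add_zero]

lemma aeval_smul_eq {M : Type w} [AddCommGroup M] [Module R M] {x : R} {s : M} (hs : x • s = s)
    {p : k[X]} (h1 : p.eval 1 = 1) : aeval x p • s = s := by
  have hd : X - C 1 ∣ p - 1 := by rw [dvd_iff_isRoot]; simp [h1]
  obtain ⟨q, hq⟩ := hd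
  have h2 : p = q * (X - C 1) + 1 := by rw [mul_comm, ← hq]; ring
  rw [h2]
  simp only [map_add, map_mul, map_sub, aeval_X, map_one, add_smul, mul_smul, sub_smul,
    one_smul, hs, sub_self, smul_zero, zero_add]

lemma exists_aeval_eq_mul (x : R) {p : k[X]} (h0 : p.eval 0 = 0) :
    ∃ y, aeval x p = x * y ∧ aeval x p = y * x := by
  obtain ⟨q, rfl⟩ : X - C 0 ∣ p := by rw [dvd_iff_isRoot]; exact h0
  refine ⟨aeval x q, by simp, ?_⟩
  rw [mul_comm]
  simp

/-- In a finite dimensional algebra some polynomial `p` in `x` with `p(0) = 0` and `p(1) = 1` is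
idempotent: the projection to the part where `x` is invertible along its nilpotent part. -/
lemma exists_idempotent_aeval [Module.Finite k R] (x : R) :
    ∃ p : k[X], p.eval 0 = 0 ∧ p.eval 1 = 1 ∧ IsIdempotentElem (aeval x p) := by
  have hx : IsIntegral k x := Algebra.IsIntegral.isIntegral x
  have hm : minpoly k x ≠ 0 := minpoly.ne_zero hx
  let m : k[X] := minpoly k x * (X * (X - C 1))
  have hm0 : m ≠ 0 := mul_ne_zero hm (mul_ne_zero X_ne_zero (X_sub_C_ne_zero 1))
  have hmx : aeval x m = 0 := by simp [m]
  obtain ⟨q, hq, hq0⟩ := exists_eq_pow_rootMultiplicity_mul_and_not_dvd m hm0 0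
  set n := rootMultiplicity 0 m
  have hn : 0 < n := (rootMultiplicity_pos hm0).2 (by simp [m])
  have hq1 : q.eval 1 = 0 := by
    have h1 : m.eval 1 = 0 := by simp [m]
    rw [hq] at h1
    simpa using h1
  have hcop : IsCoprime ((X - C 0) ^ n) q := by
    refine IsCoprime.pow_left ?_
    exact (irreducible_X_sub_C (0 : k)).coprime_iff_not_dvd.2 hq0
  obtain ⟨u, v, huv⟩ := hcop
  refine ⟨u * (X - C 0) ^ n, by simp [hn.ne'], ?_, ?_⟩
  · have := congrArg (eval 1) huv
    simpa [hq1] using this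
  · have h1 : u * (X - C 0) ^ n * (u * (X - C 0) ^ n) = u * (X - C 0) ^ n - u * v * m := by
      rw [hq]
      have : u * (X - C 0) ^ n = 1 - v * q := by rw [← huv]; ring
      nth_rewrite 2 [this]
      ring
    unfold IsIdempotentElem
    rw [← map_mul, h1, map_sub, map_mul _ _ m, hmx, mul_zero, sub_zero]

/-- `x ↦ x • s` is a projective cover of the simple module generated by `s = f s` by `R f`: if
the left ideal `R n f` maps onto it, then it is `R f`. -/
structure IsCoverIdem (f : R) {M : Type w} [AddCommGroup M] [Module R M] (s : M) : Prop where
  idem : IsIdempotentElem f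
  smul_eq : f • s = s
  ne_zero : s ≠ 0
  superfluous : ∀ n : R, n • s = s → ∃ r : R, r * n * f = f

/-- Projective covers exist over finite dimensional algebras: take for `f` an idempotent with
`f s = s` and `R f` of minimal dimension. -/
lemma exists_isCoverIdem (k : Type v) [Field k] [Algebra k R] [Module.Finite k R] {M : Type w}
    [AddCommGroup M] [Module R M] {s : M} (hs : s ≠ 0) : ∃ f : R, IsCoverIdem f s := by
  let d : R → ℕ := fun f => Module.finrank k ((Ideal.span {f}).restrictScalars k)
  have hne : {f : R | IsIdempotentElem f ∧ f • s = s}.Nonempty :=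
    ⟨1, IsIdempotentElem.one, one_smul R s⟩
  obtain ⟨f, ⟨hf, hfs⟩, hmin⟩ := WellFounded.has_min (measure d).wf _ hne
  refine ⟨f, hf, hfs, hs, fun n hn => ?_⟩
  obtain ⟨p, h0, h1, hp⟩ := exists_idempotent_aeval (k := k) (f * n * f)
  obtain ⟨y, -, hy⟩ := exists_aeval_eq_mul (f * n * f) h0
  set g := aeval (f * n * f) p
  have hxs : (f * n * f) • s = s := by rw [mul_smul, mul_smul, hfs, hn, hfs]
  have hgs : g • s = s := aeval_smul_eq hxs h1
  have hle : (Ideal.span {g}).restrictScalars k ≤ (Ideal.span {f}).restrictScalars k := by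
    change Ideal.span {g} ≤ Ideal.span {f}
    rw [Ideal.span_singleton_le_iff_mem, hy, ← mul_assoc]
    exact Ideal.mul_mem_left _ _ (Ideal.mem_span_singleton_self f)
  have hd : d f ≤ d g := not_lt.1 (hmin g ⟨hp, hgs⟩)
  have heq := Submodule.eq_of_le_of_finrank_le hle hd
  have hfg : f ∈ (Ideal.span {g}).restrictScalars k := by
    rw [heq]; exact Ideal.mem_span_singleton_self f
  obtain ⟨r, hr⟩ := Ideal.mem_span_singleton'.1 hfg
  refine ⟨r * y * f, ?_⟩
  calc r * y * f * n * f = r * (y * (f * n * f)) := by noncomm_ring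
    _ = f := by rw [← hy, hr]

section Simple

variable {M : Type w} [AddCommGroup M] [Module R M] [IsSimpleModule R M]
  {N : Type w'} [AddCommGroup N] [Module R N] [IsSimpleModule R N]

lemma exists_smul_eq_of_ne_zero {s : M} (hs : s ≠ 0) (t : M) : ∃ r : R, r • s = t := by
  have h : Submodule.span R {s} = ⊤ :=
    (eq_bot_or_eq_top _).resolve_left (by rwa [Submodule.span_singleton_eq_bot])
  exact Submodule.mem_span_singleton.1 (h ▸ Submodule.mem_top : t ∈ Submodule.span R {s})

/-- Only the simple module covered by `R f` is not killed by `f`. -/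
lemma IsCoverIdem.nonempty_linearEquiv {f : R} {s : M} (h : IsCoverIdem f s) {t : N}
    (ht : f • t ≠ 0) : Nonempty (M ≃ₗ[R] N) := by
  let α := LinearMap.toSpanSingleton R M s
  let β := LinearMap.toSpanSingleton R N (f • t)
  have hα : Function.Surjective α := fun m => exists_smul_eq_of_ne_zero (R := R) h.ne_zero m
  have hβ : Function.Surjective β := fun m => exists_smul_eq_of_ne_zero (R := R) ht m
  have hker : LinearMap.ker α ≤ LinearMap.ker β := by
    intro r hr
    have hr' : r • s = 0 := hr
    by_contra hne
    have hne' : r • f • t ≠ 0 := hne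
    obtain ⟨r', hr''⟩ := exists_smul_eq_of_ne_zero (R := R) hne' (f • t)
    obtain ⟨q, hq⟩ := h.superfluous (1 - r' * r) (by
      rw [sub_smul, one_smul, mul_smul, hr', smul_zero, sub_zero])
    refine ht ?_
    rw [← hq, mul_smul, mul_smul, sub_smul, one_smul, mul_smul, hr'', sub_self, smul_zero]
  let γ : M →ₗ[R] N := (Submodule.liftQ _ β hker).comp
    (α.quotKerEquivOfSurjective hα).symm.toLinearMap
  have hγ : Function.Surjective γ := by
    intro n
    obtain ⟨r, rfl⟩ := hβ n
    refine ⟨α r, ?_⟩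
    have h1 : (α.quotKerEquivOfSurjective hα).symm (α r) = Submodule.Quotient.mk r :=
      (LinearEquiv.symm_apply_eq _).2 rfl
    change Submodule.liftQ _ β hker ((α.quotKerEquivOfSurjective hα).symm (α r)) = β r
    rw [h1, Submodule.liftQ_apply]
  have hγ0 : γ ≠ 0 := by
    rintro h0
    obtain ⟨m, hm⟩ := hγ (f • t)
    rw [h0] at hm
    exact ht hm.symm
  exact ⟨LinearEquiv.ofBijective γ (LinearMap.bijective_of_ne_zero hγ0)⟩

end Simple

section FullSet

variable {Λ : Type w} {S : Λ → ModuleCat.{u} R} (hS : IsFullSetOfSimples S)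

lemma simple_of_fullSet {Λ : Type w} {S : Λ → ModuleCat.{u} R} (hS : IsFullSetOfSimples S)
    (l : Λ) : IsSimpleModule R (S l) := by
  have := hS.simple l
  exact isSimpleModule_of_simple (S l)

lemma exists_equiv_of_fullSet {Λ : Type w} {S : Λ → ModuleCat.{u} R} (hS : IsFullSetOfSimples S)
    (M : Type u) [AddCommGroup M] [Module R M] [IsSimpleModule R M] :
    ∃ l, Nonempty (M ≃ₗ[R] S l) := by
  obtain ⟨l, ⟨e⟩⟩ := hS.complete (ModuleCat.of R M) (simple_of_isSimpleModule (R := R) (M := M))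
  exact ⟨l, ⟨e.toLinearEquiv⟩⟩

lemma eq_of_fullSet {Λ : Type w} {S : Λ → ModuleCat.{u} R} (hS : IsFullSetOfSimples S)
    {l m : Λ} (e : S l ≃ₗ[R] S m) : l = m :=
  hS.inequiv l m ⟨e.toModuleIso⟩

/-- A finite dimensional algebra has finitely many simple modules: idempotents covering them are
linearly independent. -/
lemma finite_of_fullSet (k : Type v) [Field k] [Algebra k R] [Module.Finite k R] {Λ : Type w}
    {S : Λ → ModuleCat.{u} R} (hS : IsFullSetOfSimples S) : Finite Λ := by
  have hsim := simple_of_fullSet hS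
  have hs : ∀ l, ∃ s : S l, s ≠ 0 := fun l =>
    have := IsSimpleModule.nontrivial R (S l)
    exists_ne 0
  choose s hs using hs
  choose f hf using fun l => exists_isCoverIdem (R := R) k (hs l)
  have hli : LinearIndependent k f := by
    rw [linearIndependent_iff']
    intro F g hg l hl
    have h1 : (∑ i ∈ F, g i • f i) • s l = 0 := by rw [hg, zero_smul]
    rw [Finset.sum_smul, Finset.sum_eq_single l] at h1
    · rw [Algebra.smul_def, mul_smul, (hf l).smul_eq] at h1
      by_contra hne
      refine hs l ?_
      calc s l = algebraMap k R ((g l)⁻¹ * g l) • s l := by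
            rw [inv_mul_cancel₀ hne, map_one, one_smul]
        _ = 0 := by rw [map_mul, mul_smul, h1, smul_zero]
    · intro m _ hml
      rw [Algebra.smul_def, mul_smul]
      by_contra hne
      have h2 : f m • s l ≠ 0 := fun h => hne (by rw [h, smul_zero])
      obtain ⟨e⟩ := (hf m).nonempty_linearEquiv h2
      exact hml (eq_of_fullSet hS e)
    · exact fun h => absurd hl h
  exact hli.finite

end FullSet

/-! ### Finite dimensional algebras: blocks -/

section Blocks

lemma center_smul_comm {M : Type w} [AddCommGroup M] [Module R M] {c : R}
    (hc : c ∈ Set.center R) (r : R) (m : M) : c • r • m = r • c • m := by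
  rw [← mul_smul, ← mul_smul, (Set.mem_center_iff.1 hc).comm r]

/-- A central idempotent acts on a simple module as `0` or `1`. -/
lemma smul_eq_self_or_zero {M : Type w} [AddCommGroup M] [Module R M] [IsSimpleModule R M] {c : R}
    (hc : c ∈ Set.center R) (hc' : IsIdempotentElem c) :
    (∀ m : M, c • m = m) ∨ ∀ m : M, c • m = 0 := by
  by_cases h : ∀ m : M, c • m = 0
  · exact Or.inr h
  · left
    push Not at h
    obtain ⟨m, hm⟩ := h
    intro n
    obtain ⟨r, rfl⟩ := exists_smul_eq_of_ne_zero (R := R) hm n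
    rw [center_smul_comm hc, ← mul_smul c c, hc'.eq]

lemma Block.idem (c : Block R) : IsIdempotentElem c.1 := c.2.2.1

lemma Block.center (c : Block R) : c.1 ∈ Set.center R := c.2.1

/-- Two blocks acting as the identity on the same nonzero module agree. -/
lemma Block.eq_of_smul {M : Type w} [AddCommGroup M] [Module R M] [Nontrivial M] (c d : Block R)
    (hc : ∀ m : M, c.1 • m = m) (hd : ∀ m : M, d.1 • m = m) : c = d := by
  have hcomm : c.1 * d.1 = d.1 * c.1 := (Set.mem_center_iff.1 c.center).comm d.1
  have h1 : c.1 * d.1 ∈ Set.center R := Set.mul_mem_center c.center d.center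
  have h2 : IsIdempotentElem (c.1 * d.1) := c.idem.mul_of_commute hcomm d.idem
  have h0 : c.1 * d.1 ≠ 0 := by
    intro h
    obtain ⟨m, hm⟩ := exists_ne (0 : M)
    refine hm ?_
    rw [← hc m, ← hd m, ← mul_smul, h, zero_smul]
  have h3 := (c.2.2.2.2 _ h1 h2 (by rw [← mul_assoc, c.idem.eq])).resolve_left h0
  have h4 := (d.2.2.2.2 _ h1 h2 (by rw [hcomm, ← mul_assoc, d.idem.eq])).resolve_left h0
  exact Subtype.ext (h3.symm.trans h4)

/-- A simple module belongs to a block: take a central idempotent `c` acting as the identity with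
`c R` of minimal dimension. -/
lemma exists_block (k : Type v) [Field k] [Algebra k R] [Module.Finite k R] (M : Type w)
    [AddCommGroup M] [Module R M] [IsSimpleModule R M] :
    ∃ c : Block R, ∀ m : M, c.1 • m = m := by
  let d : R → ℕ := fun f => Module.finrank k (LinearMap.range (LinearMap.mulLeft k f))
  have hne : {c : R | c ∈ Set.center R ∧ IsIdempotentElem c ∧ ∀ m : M, c • m = m}.Nonempty :=
    ⟨1, Set.one_mem_center, IsIdempotentElem.one, one_smul R⟩
  obtain ⟨c, ⟨hc, hci, hcM⟩, hmin⟩ := WellFounded.has_min (measure d).wf _ hne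
  have key : ∀ e ∈ Set.center R, IsIdempotentElem e → c * e = e → (∀ m : M, e • m = m) →
      e = c := by
    intro e he hei hce heM
    have hle : LinearMap.range (LinearMap.mulLeft k e) ≤
        LinearMap.range (LinearMap.mulLeft k c) := by
      rintro _ ⟨x, rfl⟩
      refine ⟨e * x, ?_⟩
      simp only [LinearMap.mulLeft_apply]
      rw [← mul_assoc, hce]
    have heq := Submodule.eq_of_le_of_finrank_le hle (not_lt.1 (hmin e ⟨he, hei, heM⟩))
    have hmem : c ∈ LinearMap.range (LinearMap.mulLeft k e) := by
      rw [heq]; exact ⟨1, mul_one c⟩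
    obtain ⟨x, hx⟩ := hmem
    rw [LinearMap.mulLeft_apply] at hx
    calc e = c * e := hce.symm
      _ = e * c := (Set.mem_center_iff.1 hc).comm e
      _ = c := by rw [← hx, ← mul_assoc, hei.eq]
  have := IsSimpleModule.nontrivial R M
  refine ⟨⟨c, hc, hci, ?_, fun e he hei hce => ?_⟩, hcM⟩
  · rintro rfl
    obtain ⟨m, hm⟩ := exists_ne (0 : M)
    exact hm (by rw [← hcM m, zero_smul])
  · rcases smul_eq_self_or_zero (M := M) he hei with h | h
    · exact Or.inr (key e he hei hce h)
    · left
      have hcomm : e * c = c * e := ((Set.mem_center_iff.1 hc).comm e).symm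
      have h1 := key (c - e) (Set.mem_center_iff.2 (by
        have := Set.add_mem_center hc (Set.neg_mem_center he)
        rw [← sub_eq_add_neg] at this
        exact Set.mem_center_iff.1 this)) (by
        unfold IsIdempotentElem
        rw [mul_sub, sub_mul, sub_mul, hci.eq, hei.eq, hcomm, hce]
        noncomm_ring) (by rw [mul_sub, hci.eq, hce]) (fun m => by rw [sub_smul, hcM, h, sub_zero])
      exact sub_eq_self.1 h1

/-- Every block contains a simple module. -/
lemma Block.exists_simple {Λ : Type w} {S : Λ → ModuleCat.{u} R} (hS : IsFullSetOfSimples S)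
    (c : Block R) : ∃ l, ∀ v : S l, c.1 • v = v := by
  have hne : Ideal.span {1 - c.1} ≠ ⊤ := by
    intro h
    obtain ⟨r, hr⟩ := Ideal.mem_span_singleton'.1
      (h ▸ Submodule.mem_top : (c.1 : R) ∈ Ideal.span {1 - c.1})
    refine c.2.2.2.1 ?_
    calc c.1 = c.1 * c.1 := c.idem.eq.symm
      _ = r * (1 - c.1) * c.1 := by rw [hr]
      _ = 0 := by rw [mul_assoc, sub_mul, one_mul, c.idem.eq, sub_self, mul_zero]
  obtain ⟨m, hm, hle⟩ := Ideal.exists_le_maximal _ hne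
  have : IsSimpleModule R (R ⧸ m) := isSimpleModule_iff_isCoatom.2 hm.out
  obtain ⟨l, ⟨e⟩⟩ := exists_equiv_of_fullSet hS (R ⧸ m)
  refine ⟨l, ?_⟩
  have := simple_of_fullSet hS l
  refine (smul_eq_self_or_zero c.center c.idem).resolve_right fun h => ?_
  have h1 : c.1 • (Submodule.Quotient.mk 1 : R ⧸ m) = 0 := by
    apply e.injective
    rw [map_smul, h, map_zero]
  rw [← Submodule.Quotient.mk_smul, Submodule.Quotient.mk_eq_zero, smul_eq_mul, mul_one] at h1
  have h2 : (1 : R) ∈ m := by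
    have := add_mem h1 (hle (Ideal.mem_span_singleton_self (1 - c.1)))
    rwa [add_sub_cancel] at this
  exact hm.ne_top ((Ideal.eq_top_iff_one m).2 h2)

lemma finite_block (k : Type v) [Field k] [Algebra k R] [Module.Finite k R] {Λ : Type w}
    {S : Λ → ModuleCat.{u} R} (hS : IsFullSetOfSimples S) : Finite (Block R) := by
  have := finite_of_fullSet k hS
  choose l hl using fun c : Block R => c.exists_simple hS
  refine Finite.of_injective l fun c d h => ?_
  have := simple_of_fullSet hS (l c)
  have := IsSimpleModule.nontrivial R (S (l c))
  exact Block.eq_of_smul (M := S (l c)) c d (hl c) (by rw [h]; exact hl d)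

end Blocks

end FiniteDimensional

/-! ### Projective covers and injective hulls of simple modules -/

section FullSubcategoryCovers

variable {C : Type w} [Category.{v} C] [Abelian C] {P : ObjectProperty C}

lemma epi_hom_of_epi [P.IsClosedUnderQuotients] {X Y : P.FullSubcategory} (f : X ⟶ Y) [Epi f] :
    Epi f.hom := by
  refine Preadditive.epi_of_cokernel_zero ?_
  let Z : P.FullSubcategory := ⟨cokernel f.hom, P.prop_of_epi (cokernel.π f.hom) Y.property⟩
  let g : Y ⟶ Z := ObjectProperty.homMk (cokernel.π f.hom)
  have h : g = 0 := by
    rw [← cancel_epi f, comp_zero]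
    exact ObjectProperty.hom_ext _ (cokernel.condition f.hom)
  exact congrArg (fun h : Y ⟶ Z => h.hom) h

lemma mono_hom_of_mono [P.IsClosedUnderSubobjects] {X Y : P.FullSubcategory} (f : X ⟶ Y)
    [Mono f] : Mono f.hom := by
  refine Preadditive.mono_of_kernel_zero ?_
  let Z : P.FullSubcategory := ⟨kernel f.hom, P.prop_of_mono (kernel.ι f.hom) X.property⟩
  let g : Z ⟶ X := ObjectProperty.homMk (kernel.ι f.hom)
  have h : g = 0 := by
    rw [← cancel_mono f, zero_comp]
    exact ObjectProperty.hom_ext _ (kernel.condition f.hom)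
  exact congrArg (fun h : Z ⟶ X => h.hom) h

lemma IsProjCover.fullSubcategory [P.IsClosedUnderQuotients] {X Y : P.FullSubcategory}
    {π : X ⟶ Y} (h : IsProjCover π.hom) : IsProjCover π := by
  obtain ⟨h1, h2, h3⟩ := h
  refine ⟨⟨fun {Z W} f e he => ?_⟩, P.ι.epi_of_epi_map h2, fun Z f hf => ?_⟩
  · have := epi_hom_of_epi e
    exact ⟨ObjectProperty.homMk (Projective.factorThru f.hom e.hom),
      ObjectProperty.hom_ext _ (Projective.factorThru_comp f.hom e.hom)⟩
  · exact P.ι.epi_of_epi_map (h3 _ f.hom (epi_hom_of_epi (f ≫ π)))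

lemma IsInjHull.fullSubcategory [P.IsClosedUnderSubobjects] {X Y : P.FullSubcategory}
    {ι : X ⟶ Y} (h : IsInjHull ι.hom) : IsInjHull ι := by
  obtain ⟨h1, h2, h3⟩ := h
  refine ⟨⟨fun {Z W} f e he => ?_⟩, P.ι.mono_of_mono_map h2, fun Z f hf => ?_⟩
  · have := mono_hom_of_mono e
    exact ⟨ObjectProperty.homMk (Injective.factorThru f.hom e.hom),
      ObjectProperty.hom_ext _ (Injective.comp_factorThru f.hom e.hom)⟩
  · exact P.ι.mono_of_mono_map (h3 _ f.hom (mono_hom_of_mono (ι ≫ f)))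

end FullSubcategoryCovers

section ModuleCovers

variable {R : Type u} [Ring R]

lemma IsProjCover.surjective {P S : ModuleCat.{u} R} {π : P ⟶ S} (h : IsProjCover π) :
    Function.Surjective π.hom := (ModuleCat.epi_iff_surjective π).1 h.2.1

lemma IsProjCover.eq_top {P S : ModuleCat.{u} R} {π : P ⟶ S} (h : IsProjCover π)
    (N : Submodule R P) (hN : ∀ s : S, ∃ n ∈ N, π.hom n = s) : N = ⊤ := by
  have h1 := h.2.2 (ModuleCat.of R N) (ModuleCat.ofHom N.subtype)
    ((ModuleCat.epi_iff_surjective _).2 fun s => by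
      obtain ⟨n, hn, rfl⟩ := hN s
      exact ⟨⟨n, hn⟩, rfl⟩)
  rw [eq_top_iff]
  intro x _
  obtain ⟨n, rfl⟩ := (ModuleCat.epi_iff_surjective _).1 h1 x
  exact n.2

/-- A projective cover of a simple module is generated by any element not in the kernel. -/
lemma IsProjCover.span_eq_top {P S : ModuleCat.{u} R} [IsSimpleModule R S] {π : P ⟶ S}
    (h : IsProjCover π) {p : P} (hp : π.hom p ≠ 0) : Submodule.span R {p} = ⊤ := by
  refine h.eq_top _ fun s => ?_
  obtain ⟨r, rfl⟩ := exists_smul_eq_of_ne_zero (R := R) hp s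
  exact ⟨r • p, Submodule.smul_mem _ _ (Submodule.mem_span_singleton_self p), map_smul _ _ _⟩

lemma IsProjCover.exists_ne_zero {P S : ModuleCat.{u} R} [IsSimpleModule R S] {π : P ⟶ S}
    (h : IsProjCover π) : ∃ p : P, π.hom p ≠ 0 := by
  have := IsSimpleModule.nontrivial R S
  obtain ⟨s, hs⟩ := exists_ne (0 : S)
  obtain ⟨p, rfl⟩ := h.surjective s
  exact ⟨p, hs⟩

lemma IsProjCover.finite {P S : ModuleCat.{u} R} [IsSimpleModule R S] {π : P ⟶ S}
    (h : IsProjCover π) : Module.Finite R P := by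
  obtain ⟨p, hp⟩ := h.exists_ne_zero
  exact ⟨⟨{p}, by rw [Finset.coe_singleton]; exact h.span_eq_top hp⟩⟩

lemma IsProjCover.smul_eq {P S : ModuleCat.{u} R} {π : P ⟶ S} (h : IsProjCover π) {c : R}
    (hc : c ∈ Set.center R) (hc' : IsIdempotentElem c) (hS : ∀ s : S, c • s = s) (p : P) :
    c • p = p := by
  let N : Submodule R P :=
    { carrier := {p | c • p = p}
      zero_mem' := smul_zero c
      add_mem' := fun {p q} hp hq => by
        change c • (p + q) = p + q
        rw [smul_add, show c • p = p from hp, show c • q = q from hq]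
      smul_mem' := fun r p hp => by
        change c • r • p = r • p
        rw [center_smul_comm hc, show c • p = p from hp] }
  have hN : N = ⊤ := h.eq_top N fun s => by
    obtain ⟨p, rfl⟩ := h.surjective s
    refine ⟨c • p, ?_, ?_⟩
    · change c • c • p = c • p
      rw [← mul_smul, hc'.eq]
    · rw [map_smul, hS]
  exact (hN ▸ Submodule.mem_top : p ∈ N)

lemma IsInjHull.injective {S Q : ModuleCat.{u} R} {ι : S ⟶ Q} (h : IsInjHull ι) :
    Function.Injective ι.hom := (ModuleCat.mono_iff_injective ι).1 h.2.1

lemma IsInjHull.injective_of_comp {S Q : ModuleCat.{u} R} {ι : S ⟶ Q} (h : IsInjHull ι)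
    {Y : ModuleCat.{u} R} (f : Q ⟶ Y) (hf : Function.Injective fun s => f.hom (ι.hom s)) :
    Function.Injective f.hom :=
  (ModuleCat.mono_iff_injective f).1 (h.2.2 Y f ((ModuleCat.mono_iff_injective _).2 hf))

lemma IsInjHull.smul_eq {S Q : ModuleCat.{u} R} {ι : S ⟶ Q} (h : IsInjHull ι) {c : R}
    (hc : c ∈ Set.center R) (hc' : IsIdempotentElem c) (hS : ∀ s : S, c • s = s) (q : Q) :
    c • q = q := by
  let f : Q ⟶ Q := ModuleCat.ofHom
    { toFun := fun q => c • q
      map_add' := smul_add c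
      map_smul' := fun r q => center_smul_comm hc r q }
  have hf : Function.Injective f.hom := h.injective_of_comp f fun s t hst => by
    have h1 : c • ι.hom s = c • ι.hom t := hst
    rw [← map_smul, ← map_smul, hS, hS] at h1
    exact h.injective h1
  refine hf ?_
  change c • c • q = c • q
  rw [← mul_smul, hc'.eq]

section Dual

variable (k : Type u) [Field k] [Algebra k R]

/-- The dual `Hom_k(R, k)` of the right regular module. -/
structure RegularDual (k : Type u) (R : Type u) [Field k] [Ring R] [Algebra k R] where
  /-- the underlying linear form -/
  form : R →ₗ[k] k

/-- Identification with the space of linear forms. -/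
def RegularDual.equiv : RegularDual k R ≃ (R →ₗ[k] k) :=
  ⟨RegularDual.form, RegularDual.mk, fun _ => rfl, fun _ => rfl⟩

instance : AddCommGroup (RegularDual k R) := (RegularDual.equiv k).addCommGroup

instance : Module R (RegularDual k R) where
  smul r f := ⟨f.form ∘ₗ LinearMap.mulRight k r⟩
  one_smul f := congrArg RegularDual.mk (LinearMap.ext fun x => congrArg f.form (mul_one x))
  mul_smul r s f :=
    congrArg RegularDual.mk (LinearMap.ext fun x => congrArg f.form (mul_assoc x r s).symm)
  smul_zero _ := rfl
  smul_add _ _ _ := rfl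
  add_smul r s f := congrArg RegularDual.mk (LinearMap.ext fun x =>
    (congrArg f.form (mul_add x r s)).trans (map_add f.form _ _))
  zero_smul f := congrArg RegularDual.mk (LinearMap.ext fun x =>
    (congrArg f.form (mul_zero x)).trans (map_zero f.form))

lemma RegularDual.finite [Module.Finite k R] : Module.Finite R (RegularDual k R) := by
  let : Module k (RegularDual k R) := Module.compHom _ (algebraMap k R)
  have : IsScalarTower k R (RegularDual k R) := ⟨fun l r f => by
    rw [Algebra.smul_def, mul_smul]; rfl⟩
  let φ : RegularDual k R →ₗ[k] (R →ₗ[k] k) :=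
    { toFun := fun f => f.form
      map_add' := fun _ _ => rfl
      map_smul' := fun l f => LinearMap.ext fun x => by
        change f.form (x * algebraMap k R l) = l • f.form x
        rw [← map_smul, Algebra.smul_def, Algebra.commutes] }
  have : Module.Finite k (RegularDual k R) := Module.Finite.of_injective φ fun f g h =>
    congrArg RegularDual.mk h
  exact Module.Finite.of_restrictScalars_finite k R (RegularDual k R)

/-- Linear forms on `M` are module maps to the dual of the regular module. -/
def RegularDual.lift {M : ModuleCat.{u} R} (φ : M →ₗ[k] k) : M →ₗ[R] RegularDual k R where
  toFun m := ⟨{ toFun := fun x => φ (x • m)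
                map_add' := fun x y => by rw [add_smul, map_add]
                map_smul' := fun l x => by rw [smul_assoc, map_smul, RingHom.id_apply] }⟩
  map_add' m n := congrArg RegularDual.mk (LinearMap.ext fun x => by
    change φ (x • (m + n)) = φ (x • m) + φ (x • n)
    rw [smul_add, map_add])
  map_smul' r m := congrArg RegularDual.mk (LinearMap.ext fun x => by
    change φ (x • r • m) = φ ((x * r) • m)
    rw [mul_smul])

instance RegularDual.injective : Injective (ModuleCat.of R (RegularDual k R)) := by
  refine ⟨fun {X Y} g f hf => ?_⟩
  have hf' := (ModuleCat.mono_iff_injective f).1 hf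
  let φ : X →ₗ[k] k :=
    { toFun := fun x => (show RegularDual k R from g.hom x).form 1
      map_add' := fun x y => by rw [map_add]; rfl
      map_smul' := fun l x => by
        have : l • x = algebraMap k R l • x := rfl
        rw [this, map_smul]
        change (show RegularDual k R from g.hom x).form (1 * algebraMap k R l) = _
        rw [one_mul, Algebra.algebraMap_eq_smul_one, map_smul]
        rfl }
  let fk : X →ₗ[k] Y :=
    { toFun := f.hom
      map_add' := map_add f.hom
      map_smul' := fun l x => map_smul f.hom (algebraMap k R l) x }
  obtain ⟨g', hg'⟩ := fk.exists_leftInverse_of_injective (LinearMap.ker_eq_bot.2 hf')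
  refine ⟨ModuleCat.ofHom (RegularDual.lift k (φ ∘ₗ g')), ?_⟩
  refine ModuleCat.hom_ext (LinearMap.ext fun x => congrArg RegularDual.mk
    (LinearMap.ext fun r => ?_))
  change φ (g' (r • f.hom x)) = (show RegularDual k R from g.hom x).form r
  rw [← map_smul]
  have h1 : g' (f.hom (r • x)) = r • x := LinearMap.congr_fun hg' (r • x)
  rw [h1]
  change (show RegularDual k R from g.hom (r • x)).form 1 = _
  rw [map_smul]
  change (show RegularDual k R from g.hom x).form (1 * r) = _
  rw [one_mul]

/-- An injective hull of a simple module is finite dimensional, as it embeds into the dual of the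
regular module. -/
lemma IsInjHull.finite [Module.Finite k R] {S Q : ModuleCat.{u} R} [IsSimpleModule R S]
    {ι : S ⟶ Q} (h : IsInjHull ι) : Module.Finite R Q := by
  have := IsSimpleModule.nontrivial R S
  obtain ⟨s, hs⟩ := exists_ne (0 : S)
  obtain ⟨φ, hφ⟩ : ∃ φ : S →ₗ[k] k, φ s ≠ 0 := by
    by_contra! h0
    exact hs ((Module.forall_dual_apply_eq_zero_iff k s).1 h0)
  let i : S ⟶ ModuleCat.of R (RegularDual k R) := ModuleCat.ofHom (RegularDual.lift k φ)
  have hi : Function.Injective i.hom := by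
    refine LinearMap.injective_of_ne_zero fun h0 => hφ ?_
    have h1 := congrArg (fun g : S →ₗ[R] RegularDual k R => (g s).form 1) h0
    change φ ((1 : R) • s) = 0 at h1
    rwa [one_smul] at h1
  have := h.2.1
  let f := Injective.factorThru i ι
  have hf : Function.Injective f.hom := h.injective_of_comp f (by
    have : ∀ s, f.hom (ι.hom s) = i.hom s := fun s =>
      congrArg (fun g : S ⟶ ModuleCat.of R (RegularDual k R) => g.hom s)
        (Injective.comp_factorThru i ι)
    simpa only [this] using hi)
  have hD := RegularDual.finite (R := R) k
  have : IsNoetherianRing R := IsNoetherianRing.of_finite k R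
  exact Module.Finite.of_injective f.hom hf

end Dual

/-- An idempotent covering a simple module gives a projective cover in the categorical sense. -/
lemma IsCoverIdem.isProjCover {f : R} {S : ModuleCat.{u} R} [IsSimpleModule R S] {s : S}
    (h : IsCoverIdem f s) :
    IsProjCover (ModuleCat.ofHom ((LinearMap.toSpanSingleton R S s).comp
      (Submodule.subtype (Ideal.span {f}))) : ModuleCat.of R (Ideal.span {f}) ⟶ S) := by
  have hmem : ∀ x : Ideal.span {f}, x.1 * f = x.1 := fun x => by
    obtain ⟨r, hr⟩ := Ideal.mem_span_singleton'.1 x.2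
    rw [← hr, mul_assoc, h.idem.eq]
  have hf : f ∈ Ideal.span {f} := Ideal.mem_span_singleton_self f
  refine ⟨⟨fun {X Y} g e he => ?_⟩, ?_, fun Y g hg => ?_⟩
  · obtain ⟨y, hy⟩ := (ModuleCat.epi_iff_surjective e).1 he (g.hom ⟨f, hf⟩)
    refine ⟨ModuleCat.ofHom ((LinearMap.toSpanSingleton R X y).comp
      (Submodule.subtype (Ideal.span {f}))), ?_⟩
    refine ModuleCat.hom_ext (LinearMap.ext fun x => ?_)
    change e.hom (x.1 • y) = g.hom x
    rw [map_smul, hy, ← map_smul]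
    congr 1
    exact Subtype.ext (hmem x)
  · rw [ModuleCat.epi_iff_surjective]
    intro t
    obtain ⟨r, rfl⟩ := exists_smul_eq_of_ne_zero (R := R) h.ne_zero t
    refine ⟨⟨r * f, Ideal.mul_mem_left _ _ hf⟩, ?_⟩
    change (r * f) • s = r • s
    rw [mul_smul, h.smul_eq]
  · rw [ModuleCat.epi_iff_surjective] at hg ⊢
    obtain ⟨y, hy⟩ := hg s
    have hy' : (g.hom y).1 • s = s := hy
    obtain ⟨r, hr⟩ := h.superfluous _ hy'
    intro x
    refine ⟨(x.1 * r) • y, ?_⟩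
    rw [map_smul]
    refine Subtype.ext ?_
    change x.1 * r * (g.hom y).1 = x.1
    rw [← hmem (g.hom y), mul_assoc, ← mul_assoc r, hr, hmem]

end ModuleCovers

/-! ### Blocks of finite dimensional modules -/

section BlockCategory

open CornerRing

variable {R : Type u} [Ring R]

/-- The finite modules on which `c` acts as the identity. -/
def blockProp (c : R) : ObjectProperty (ModuleCat.{u} R) := fun V =>
  Module.Finite R V ∧ ∀ v : V, c • v = v

lemma blockProp_closedUnderSubobjects (k : Type v) [Field k] [Algebra k R]
    [Module.Finite k R] (c : R) : (blockProp c).IsClosedUnderSubobjects where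
  prop_of_mono {X Y} f hf hY := by
    have hf' := (ModuleCat.mono_iff_injective f).1 hf
    have : IsNoetherianRing R := IsNoetherianRing.of_finite k R
    have := hY.1
    exact ⟨Module.Finite.of_injective f.hom hf', fun v => hf' (by rw [map_smul, hY.2])⟩

lemma blockProp_closedUnderQuotients (c : R) : (blockProp c).IsClosedUnderQuotients where
  prop_of_epi {X Y} f hf hX := by
    have hf' := (ModuleCat.epi_iff_surjective f).1 hf
    have := hX.1
    refine ⟨Module.Finite.of_surjective f.hom hf', fun v => ?_⟩
    obtain ⟨v, rfl⟩ := hf' v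
    rw [← map_smul, hX.2]

variable {c : R} (hc : IsIdempotentElem c)

lemma finite_corner_of_finite (k : Type v) [Field k] [Algebra k R] [Module.Finite k R]
    (hc : IsIdempotentElem c) : Module.Finite k hc.Corner :=
  let φ : hc.Corner →ₗ[k] R :=
    { toFun := fun x => x.1
      map_add' := fun _ _ => rfl
      map_smul' := fun _ _ => rfl }
  Module.Finite.of_injective φ fun _ _ h => Subtype.ext h

/-- An additive bijection respecting the action is an isomorphism of modules. -/
def isoOfAddEquiv {S : Type u} [Ring S] {M N : ModuleCat.{u} S} (e : M ≃+ N)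
    (h : ∀ (r : S) (x : M), e (r • x) = r • e x) : M ≅ N :=
  LinearEquiv.toModuleIso { e with map_smul' := h }

/-- A module on which `c` acts as the identity is a module over `c R c`. -/
@[reducible] def blockModule {V : Type w} [AddCommGroup V] [Module R V]
    (hV : ∀ v : V, c • v = v) : Module hc.Corner V where
  smul h v := h.1 • v
  one_smul v := hV v
  mul_smul x y v := mul_smul x.1 y.1 v
  smul_zero x := smul_zero x.1
  smul_add x := smul_add x.1
  add_smul x y v := add_smul x.1 y.1 v
  zero_smul v := zero_smul R v

lemma smul_eq_mk_smul {V : Type w} [AddCommGroup V] [Module R V] (hV : ∀ v : V, c • v = v)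
    (x : R) (v : V) : (mk hc x).1 • v = x • v := by
  rw [val_mk, mul_smul, mul_smul, hV, hV]

/-- The functor to modules over `c R c`. -/
def blockFunctor : (blockProp c).FullSubcategory ⥤ FGModuleCat.{u} hc.Corner where
  obj V := ⟨letI := blockModule hc V.property.2; ModuleCat.of hc.Corner V.obj, by
    let := blockModule hc V.property.2
    obtain ⟨s, hs⟩ := Module.finite_def.1 V.property.1
    refine (⟨⟨s, ?_⟩⟩ : Module.Finite hc.Corner V.obj)
    rw [eq_top_iff]
    intro v _
    have hv : v ∈ Submodule.span R (s : Set V.obj) := by rw [hs]; trivial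
    induction hv using Submodule.span_induction with
    | mem x hx => exact Submodule.subset_span hx
    | zero => exact zero_mem _
    | add x y _ _ hx hy => exact add_mem (hx trivial) (hy trivial)
    | smul r x _ hx =>
      rw [← smul_eq_mk_smul hc V.property.2]
      exact Submodule.smul_mem _ (mk hc r) (hx trivial)⟩
  map {V W} f := ObjectProperty.homMk (
    letI := blockModule hc V.property.2
    letI := blockModule hc W.property.2
    ModuleCat.ofHom
      { toFun := f.hom.hom
        map_add' := map_add f.hom.hom
        map_smul' := fun r x => map_smul f.hom.hom r.1 x })

instance : (blockFunctor hc).Faithful where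
  map_injective {V W} f g h := by
    refine ObjectProperty.hom_ext _ (ModuleCat.hom_ext (LinearMap.ext fun x => ?_))
    exact congrArg (fun φ : (blockFunctor hc).obj V ⟶ (blockFunctor hc).obj W => φ.hom.hom x) h

instance : (blockFunctor hc).Full where
  map_surjective {V W} f := by
    let g : V ⟶ W := ObjectProperty.homMk (ModuleCat.ofHom
      { toFun := f.hom.hom
        map_add' := map_add f.hom.hom
        map_smul' := fun r x => by
          have h := map_smul f.hom.hom (mk hc r) (show ((blockFunctor hc).obj V).obj from x)
          have h1 : (mk hc r).1 • (show V.obj from x) = r • (show V.obj from x) :=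
            smul_eq_mk_smul hc V.property.2 r x
          have h2 : (mk hc r).1 • (show W.obj from f.hom.hom x) =
              r • (show W.obj from f.hom.hom x) := smul_eq_mk_smul hc W.property.2 r _
          exact (congrArg f.hom.hom h1).symm.trans (h.trans h2) })
    exact ⟨g, rfl⟩

/-- Truncation to `c R c` is a ring homomorphism if `c` is central. -/
def blockHom (hcen : c ∈ Set.center R) : R →+* hc.Corner where
  toFun := mk hc
  map_one' := Subtype.ext (by rw [val_mk, mul_one, hc.eq]; rfl)
  map_mul' x y := Subtype.ext (by
    rw [val_mul, val_mk, val_mk, val_mk]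
    have h := (Set.mem_center_iff.1 hcen).comm
    have h1 : c * x * c * (c * y * c) = c * x * (c * c * c) * y := by
      rw [mul_assoc c y c, ← (h y).eq]
      noncomm_ring
    rw [h1, hc.eq, hc.eq, mul_assoc (c * x), (h y).eq]
    noncomm_ring)
  map_zero' := map_zero (mkHom hc)
  map_add' := map_add (mkHom hc)

lemma blockFunctor_essSurj (k : Type v) [Field k] [Algebra k R] [Module.Finite k R]
    (hc : IsIdempotentElem c) (hcen : c ∈ Set.center R) : (blockFunctor hc).EssSurj where
  mem_essImage N := by
    let := Module.compHom N.obj (blockHom hc hcen)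
    have hN : ∀ n : N.obj, c • n = n := fun n => by
      change mk hc c • n = n
      have : mk hc c = 1 := Subtype.ext (by rw [val_mk, hc.eq, hc.eq]; rfl)
      rw [this, one_smul]
    have hfin : Module.Finite R N.obj := by
      obtain ⟨s, hs⟩ := Module.finite_def.1 N.property
      refine ⟨⟨s, ?_⟩⟩
      rw [eq_top_iff]
      intro v _
      have hv : v ∈ Submodule.span hc.Corner (s : Set N.obj) := by rw [hs]; trivial
      induction hv using Submodule.span_induction with
      | mem x hx => exact Submodule.subset_span hx
      | zero => exact zero_mem _
      | add x y _ _ hx hy => exact add_mem (hx trivial) (hy trivial)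
      | smul r x _ hx =>
        have : r • x = (r.1 : R) • x := by
          change r • x = mk hc r.1 • x
          rw [mk_val]
        rw [this]
        exact Submodule.smul_mem _ _ (hx trivial)
    let V : (blockProp c).FullSubcategory := ⟨ModuleCat.of R N.obj, hfin, hN⟩
    refine ⟨V, ⟨ObjectProperty.isoMk _ (isoOfAddEquiv (M := ((blockFunctor hc).obj V).obj)
      (N := N.obj) (AddEquiv.refl N.obj) fun r x => ?_)⟩⟩
    change mk hc r.1 • (show N.obj from x) = r • (show N.obj from x)
    rw [mk_val]

/-- The modules on which a central idempotent `c` acts as the identity are the modules over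
`c R c`. -/
def blockEquivalence (k : Type v) [Field k] [Algebra k R] [Module.Finite k R]
    (hc : IsIdempotentElem c) (hcen : c ∈ Set.center R) :
    (blockProp c).FullSubcategory ≌ FGModuleCat.{u} hc.Corner :=
  letI := blockFunctor_essSurj k hc hcen
  letI : (blockFunctor hc).IsEquivalence := {}
  (blockFunctor hc).asEquivalence

end BlockCategory

section TruncationBlocks

open CornerRing LocallyUnital

variable {k A J : Type u} [Field k] [NonUnitalRing A] [Module k A]
  [IsScalarTower k A A] [SMulCommClass k A A]

namespace WeaklyTriangular

variable {E : LocallyUnital k A J} {I : Type t} [PartialOrder I] (T : WeaklyTriangular E I)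

instance (a : I) (c : T.Abar a) : (T.fdProp a c).IsClosedUnderSubobjects :=
  blockProp_closedUnderSubobjects k c

instance (a : I) (c : T.Abar a) : (T.fdProp a c).IsClosedUnderQuotients :=
  blockProp_closedUnderQuotients c

variable {T}

/-- If `c` is a central idempotent, the stratum is the category of finite dimensional modules over
`c Ā_a c`. -/
lemma IsStratum.exists_finite_algebra {B : Type w} {Λ : Type w'} [PartialOrder Λ]
    {L : B → E.Lfdmod} {ρ : B → Λ} {l : Λ} {a : I} {c : T.Abar a} (H : T.IsStratum L ρ l a c)
    (hc : IsIdempotentElem c) (hcen : c ∈ Set.center (T.Abar a)) :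
    ∃ (S : Type u) (_ : Ring S) (_ : Algebra k S),
      Module.Finite k S ∧ StratumEquivFdmod k L ρ l S := by
  refine ⟨hc.Corner, inferInstance, inferInstance, finite_corner_of_finite k hc,
    H.stratumEquivFdmod (blockEquivalence k hc hcen) ?_ ?_⟩
  · exact ⟨fun {X Y f g} => rfl⟩
  · refine ⟨fun {X Y} f r => ?_⟩
    refine ModuleCat.hom_ext (LinearMap.ext fun x => ?_)
    refine Subtype.ext ?_
    let y : Y.obj.obj := Tr.lin f x.1
    have hy : c.1 • y = y := congrArg Subtype.val (Y.fdProp_corner.2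
      (cornerMap (T.oneBar_idem a) (Tr.linQuot f) x))
    change T.qmk a (algebraMap k E.Uni r) • y = (r • c.1) • y
    rw [Algebra.smul_def, mul_smul, hy]
    rfl

end WeaklyTriangular

end TruncationBlocks

/-! ### The irreducible modules -/

section Irreducible

open CornerRing LocallyUnital

variable {k A J : Type u} [Field k] [NonUnitalRing A] [Module k A]
  [IsScalarTower k A A] [SMulCommClass k A A]

namespace WeaklyTriangular

variable {E : LocallyUnital k A J} {I : Type t} [PartialOrder I] (T : WeaklyTriangular E I)
variable {a : I}

/-- The largest submodule of `j_! V` whose truncation is contained in `K`. -/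
def rad (V : ModuleCat.{u} (T.Abar a)) (K : Submodule (T.Abar a) V) :
    Submodule E.Uni (T.standardize a V) where
  carrier := {z | ∀ x : E.Uni, Induced.proj (T.oneBar_idem a) (T.qmk a x •
    (show Induced (T.oneBar_idem a) V from z)) ∈ K}
  zero_mem' x := by
    have : T.qmk a x • (0 : Induced (T.oneBar_idem a) V) = 0 := smul_zero _
    change Induced.proj (T.oneBar_idem a) (T.qmk a x • (0 : Induced (T.oneBar_idem a) V)) ∈ K
    rw [this, map_zero]
    exact zero_mem K
  add_mem' {z w} hz hw x := by
    change Induced.proj (T.oneBar_idem a) (T.qmk a x • ((show Induced (T.oneBar_idem a) V from z) +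
      (show Induced (T.oneBar_idem a) V from w))) ∈ K
    rw [smul_add, map_add]
    exact add_mem (hz x) (hw x)
  smul_mem' y z hz x := by
    have h := hz (x * y)
    rw [map_mul, mul_smul] at h
    exact h

lemma mem_rad {V : ModuleCat.{u} (T.Abar a)} {K : Submodule (T.Abar a) V}
    {z : Induced (T.oneBar_idem a) V} :
    z ∈ (show Set (Induced (T.oneBar_idem a) V) from (T.rad V K).carrier) ↔
      ∀ r : T.quotLE a, Induced.proj (T.oneBar_idem a) (r • z) ∈ K := by
  refine ⟨fun h r => ?_, fun h x => h _⟩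
  obtain ⟨x, rfl⟩ := T.qmk_surjective a r
  exact h x

lemma ten_one_mem_rad {V : ModuleCat.{u} (T.Abar a)} {K : Submodule (T.Abar a) V} {v : V} :
    (show T.standardize a V from Induced.ten (T.oneBar_idem a) 1 v) ∈ T.rad V K ↔ v ∈ K := by
  refine (T.mem_rad (z := Induced.ten (T.oneBar_idem a) 1 v)).trans ⟨fun h => ?_, fun h r => ?_⟩
  · have h1 := h 1
    rwa [one_smul, Induced.proj_ten_one] at h1
  · rw [Induced.smul_ten, mul_one, Induced.proj_ten]
    exact K.smul_mem _ h

/-- A proper submodule of `j_! V` is contained in the radical, provided `V` is generated by any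
element outside `K`. -/
lemma le_rad {V : ModuleCat.{u} (T.Abar a)} {K : Submodule (T.Abar a) V}
    (hK : ∀ V' : Submodule (T.Abar a) V, ¬ V' ≤ K → V' = ⊤)
    {N : Submodule E.Uni (T.standardize a V)} (hN : N ≠ ⊤) : N ≤ T.rad V K := by
  let ten1 : V → T.standardize a V := fun v => Induced.ten (T.oneBar_idem a) 1 v
  let V' : Submodule (T.Abar a) V :=
    { carrier := {v | ten1 v ∈ N}
      zero_mem' := by
        change ten1 0 ∈ N
        have : ten1 0 = 0 := Induced.ten_zero _ _
        rw [this]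
        exact zero_mem N
      add_mem' := fun {v w} hv hw => by
        change ten1 (v + w) ∈ N
        have : ten1 (v + w) = ten1 v + ten1 w := Induced.ten_add _ _ _ _
        rw [this]
        exact add_mem hv hw
      smul_mem' := fun h v hv => by
        obtain ⟨x, hx⟩ := T.qmk_surjective a h.1
        have : ten1 (h • v) = x • ten1 v := by
          change Induced.ten (T.oneBar_idem a) 1 (h • v) =
            T.qmk a x • Induced.ten (T.oneBar_idem a) 1 v
          rw [hx, Induced.smul_ten, mul_one, ← Induced.ten_mul_corner, one_mul]
        change ten1 (h • v) ∈ N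
        rw [this]
        exact N.smul_mem x hv }
  intro z hz
  by_contra hne
  have hne' : ¬ ∀ r : T.quotLE a, Induced.proj (T.oneBar_idem a)
      (r • (show Induced (T.oneBar_idem a) V from z)) ∈ K := fun h => hne (T.mem_rad.2 h)
  push Not at hne'
  obtain ⟨r, hr⟩ := hne'
  obtain ⟨x, rfl⟩ := T.qmk_surjective a r
  have hV' : V' = ⊤ := by
    refine hK V' fun hle => hr (hle ?_)
    have h1 := Induced.e_smul_eq (T.oneBar_idem a)
      (T.qmk a x • (show Induced (T.oneBar_idem a) V from z))
    change (show T.standardize a V from Induced.ten (T.oneBar_idem a) 1 _) ∈ N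
    rw [← h1]
    exact N.smul_mem (T.one a) (N.smul_mem x hz)
  refine hN (eq_top_iff.2 fun w _ => ?_)
  have key : ∀ w : Induced (T.oneBar_idem a) V, (show T.standardize a V from w) ∈ N := by
    intro w
    induction w using Induced.induction with
    | zero => exact zero_mem N
    | add z w hz hw => exact add_mem hz hw
    | ten x v =>
      obtain ⟨y, rfl⟩ := T.qmk_surjective a x
      have hv : ten1 v ∈ N := (hV' ▸ Submodule.mem_top : v ∈ V')
      rw [Induced.ten_eq_smul]
      exact N.smul_mem y hv
  exact key w

lemma rad_ne_top {V : ModuleCat.{u} (T.Abar a)} {K : Submodule (T.Abar a) V} (hK : K ≠ ⊤) :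
    T.rad V K ≠ ⊤ := by
  intro h
  refine hK (eq_top_iff.2 fun v _ => T.ten_one_mem_rad.1 ?_)
  rw [h]
  trivial

/-- The radical is the unique maximal submodule of `j_! V`. -/
lemma isCoatom_iff {V : ModuleCat.{u} (T.Abar a)} {K : Submodule (T.Abar a) V} (hK' : K ≠ ⊤)
    (hK : ∀ V' : Submodule (T.Abar a) V, ¬ V' ≤ K → V' = ⊤)
    (N : Submodule E.Uni (T.standardize a V)) : IsCoatom N ↔ N = T.rad V K := by
  have h1 : ∀ N, N ≠ ⊤ → N ≤ T.rad V K := fun N hN => T.le_rad hK hN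
  have h2 := T.rad_ne_top hK'
  constructor
  · intro hN
    exact ((hN.le_iff).1 (h1 N hN.1)).resolve_left h2 |>.symm
  · rintro rfl
    exact ⟨h2, fun N hN => by_contra fun hne => hN.not_ge (h1 N hne)⟩

/-- The map `j_! V → j_! W` over `A`. -/
def standardizeMap {V W : ModuleCat.{u} (T.Abar a)} (f : V →ₗ[T.Abar a] W) :
    T.standardize a V →ₗ[E.Uni] T.standardize a W where
  toFun := Induced.map (T.oneBar_idem a) f
  map_add' := map_add (Induced.map (T.oneBar_idem a) f)
  map_smul' x := map_smul (Induced.map (T.oneBar_idem a) f) (T.qmk a x)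

lemma rad_comap {V W : ModuleCat.{u} (T.Abar a)} (f : V →ₗ[T.Abar a] W)
    (K : Submodule (T.Abar a) W) :
    (T.rad W K).comap (T.standardizeMap f) = T.rad V (K.comap f) := by
  have key : ∀ (z : Induced (T.oneBar_idem a) V) (r : T.quotLE a),
      Induced.proj (T.oneBar_idem a) (r • Induced.map (T.oneBar_idem a) f z) =
        f (Induced.proj (T.oneBar_idem a) (r • z)) := fun z r => by
    rw [← map_smul, Induced.proj_map]
  ext z
  refine (T.mem_rad (z := Induced.map (T.oneBar_idem a) f z)).trans
    (Iff.trans (forall_congr' fun r => ?_)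
      (T.mem_rad (z := (show Induced (T.oneBar_idem a) V from z))).symm)
  exact iff_of_eq (congrArg (· ∈ K) (key z r))

/-- The quotients of `j_! V` and of `j_! W` by their radicals agree if `V` maps onto `W`. -/
def quotRadEquiv {V W : ModuleCat.{u} (T.Abar a)} (f : V →ₗ[T.Abar a] W)
    (hf : Function.Surjective f) (K : Submodule (T.Abar a) W) :
    (T.standardize a V ⧸ T.rad V (K.comap f)) ≃ₗ[E.Uni] (T.standardize a W ⧸ T.rad W K) :=
  (Submodule.quotEquivOfEq _ _ (by
    rw [← T.rad_comap, LinearMap.ker_comp, Submodule.ker_mkQ])).trans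
    (((T.rad W K).mkQ.comp (T.standardizeMap f)).quotKerEquivOfSurjective
      (((T.rad W K).mkQ_surjective).comp (Induced.map_surjective (T.oneBar_idem a) f hf)))

section Simple

variable (S : ModuleCat.{u} (T.Abar a)) [hS : IsSimpleModule (T.Abar a) S]

lemma finite_of_isSimpleModule {R : Type v} [Ring R] (M : Type w) [AddCommGroup M] [Module R M]
    [IsSimpleModule R M] : Module.Finite R M := by
  have := IsSimpleModule.nontrivial R M
  obtain ⟨s, hs⟩ := exists_ne (0 : M)
  refine ⟨⟨{s}, eq_top_iff.2 fun t _ => ?_⟩⟩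
  obtain ⟨r, rfl⟩ := exists_smul_eq_of_ne_zero (R := R) hs t
  exact Submodule.smul_mem _ r (Submodule.subset_span (by simp))

/-- The irreducible module `L(λ)`: the quotient of `j_! S` by its radical. -/
def irr (S : ModuleCat.{u} (T.Abar a)) [IsSimpleModule (T.Abar a) S] : E.Lfdmod :=
  Lfdmod.quo ⟨T.standardize a S, T.isLfd_standardize a S (finite_of_isSimpleModule S)⟩
    (T.rad S ⊥)

lemma forall_eq_top_of_simple (V' : Submodule (T.Abar a) S) (h : ¬ V' ≤ ⊥) : V' = ⊤ :=
  (eq_bot_or_eq_top V').resolve_left fun h' => h h'.le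

/-- The projection `j_! S → L`. -/
def irrπ : T.standardize a S →ₗ[E.Uni] (T.irr S).obj := (T.rad S ⊥).mkQ

lemma irrπ_surjective : Function.Surjective (T.irrπ S) := Submodule.mkQ_surjective _

lemma irr_simple : IsSimpleModule E.Uni (T.irr S).obj := by
  have := IsSimpleModule.nontrivial (T.Abar a) S
  exact isSimpleModule_iff_isCoatom.2
    ((T.isCoatom_iff bot_ne_top (T.forall_eq_top_of_simple S) _).2 rfl)

lemma killed_irr : T.Killed a (T.irr S).obj := by
  rintro x hx m
  obtain ⟨z, rfl⟩ := T.irrπ_surjective S m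
  rw [← map_smul, T.killed_standardize a S x hx, map_zero]

/-- The map `S → 1_a L`. -/
def irrIncl (s : S) : (T.irr S).obj := T.irrπ S (Induced.ten (T.oneBar_idem a) 1 s)

lemma irrIncl_add (s t : S) : T.irrIncl S (s + t) = T.irrIncl S s + T.irrIncl S t :=
  (congrArg (T.irrπ S) (Induced.ten_add (T.oneBar_idem a) 1 s t)).trans (map_add (T.irrπ S) _ _)

lemma irrIncl_eq_zero {s : S} : T.irrIncl S s = 0 ↔ s = 0 :=
  ((Submodule.Quotient.mk_eq_zero _).trans T.ten_one_mem_rad).trans (Submodule.mem_bot _)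

lemma irrIncl_smul (x : E.Uni) (h : T.Abar a) (hx : T.qmk a x = h.1) (s : S) :
    T.irrIncl S (h • s) = x • T.irrIncl S s := by
  refine Eq.trans ?_ (map_smul (T.irrπ S) x (Induced.ten (T.oneBar_idem a) 1 s))
  refine congrArg (T.irrπ S) ?_
  change Induced.ten (T.oneBar_idem a) 1 (h • s) = T.qmk a x • Induced.ten (T.oneBar_idem a) 1 s
  rw [hx, Induced.smul_ten, mul_one, ← Induced.ten_mul_corner, one_mul]

lemma one_smul_irrIncl (s : S) : T.one a • T.irrIncl S s = T.irrIncl S s := by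
  rw [← T.irrIncl_smul S (T.one a) 1 rfl, one_smul]

lemma exists_irrIncl (m : (T.irr S).obj) : ∃ s, T.irrIncl S s = T.one a • m := by
  obtain ⟨z, rfl⟩ := T.irrπ_surjective S m
  refine ⟨Induced.proj (T.oneBar_idem a) z, ?_⟩
  rw [← map_smul]
  exact congrArg (T.irrπ S) (Induced.e_smul_eq (T.oneBar_idem a) z).symm

/-- `L(λ)` lies in the truncated category given by any element acting as the identity on `S`. -/
lemma truncProp_irr {c : T.Abar a} (hc : ∀ s : S, c • s = s) :
    T.truncProp a c (T.irr S) :=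
  T.truncProp_of_surjective (X := ⟨T.standardize a S, _⟩) (Y := T.irr S)
    (Lfdmod.ofLin (T.irrπ S)) (T.irrπ_surjective S)
    (T.truncProp_standardize (c := c) S ⟨finite_of_isSimpleModule S, hc⟩)

/-- `L(λ)` as an object of the truncated category. -/
def irrTr {c : T.Abar a} (hc : ∀ s : S, c • s = s) : T.Tr a c := ⟨T.irr S, T.truncProp_irr S hc⟩

/-- `S ≅ 1_a L` as additive groups. -/
def irrAddEquiv {c : T.Abar a} (hc : ∀ s : S, c • s = s) :
    S ≃+ cornerPart (T.oneBar_idem a) (T.irrTr S hc).obj.obj :=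
  AddEquiv.ofBijective (AddMonoidHom.mk' (fun s => ⟨T.irrIncl S s, T.one_smul_irrIncl S s⟩)
      fun s t => Subtype.ext (T.irrIncl_add S s t))
    ⟨by
      rw [injective_iff_map_eq_zero]
      exact fun s hs => (T.irrIncl_eq_zero S).1 (congrArg Subtype.val hs),
    fun m => by
      obtain ⟨s, hs⟩ := T.exists_irrIncl S m.1
      exact ⟨s, Subtype.ext (hs.trans m.2)⟩⟩

/-- `1_a L ≅ S`. -/
def truncIrrIso {c : T.Abar a} (hc : ∀ s : S, c • s = s) :
    (T.trunc a c).obj (T.irrTr S hc) ≅ ⟨S, finite_of_isSimpleModule S, hc⟩ :=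
  (ObjectProperty.isoMk _ (isoOfAddEquiv (M := S) (N := (T.irrTr S hc).corner)
    (T.irrAddEquiv S hc)
    fun h s => by
      obtain ⟨x, hx⟩ := T.qmk_surjective a h.1
      refine Subtype.ext ((T.irrIncl_smul S x h hx s).trans ?_)
      change T.qmk a x • (show (T.irrTr S hc).obj.obj from T.irrIncl S s) =
        h.1 • (show (T.irrTr S hc).obj.obj from T.irrIncl S s)
      rw [hx])).symm

end Simple

end WeaklyTriangular

end Irreducible

/-! ### Classification of the irreducible modules -/

section Classification

open CornerRing LocallyUnital

variable {k A J : Type u} [Field k] [NonUnitalRing A] [Module k A]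
  [IsScalarTower k A A] [SMulCommClass k A A]

namespace WeaklyTriangular

variable {E : LocallyUnital k A J} {I : Type t} [PartialOrder I] (T : WeaklyTriangular E I)

lemma exists_eU_smul_ne_zero (X : E.Lfdmod) {m : X.obj} (hm : m ≠ 0) :
    ∃ d, E.eU d • m ≠ 0 := by
  by_contra! h
  obtain ⟨s, hs⟩ := X.property.1 m
  refine hm ?_
  rw [← hs, Finset.sum_smul]
  exact Finset.sum_eq_zero fun d _ => h d

lemma one_smul_eU_smul {M : Type v} [AddCommGroup M] [Module E.Uni M] {d : J} {a : I}
    (hd : T.cls d = a) (m : M) : T.one a • E.eU d • m = E.eU d • m := by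
  rw [← mul_smul, T.one_mul_eU hd]

lemma exists_eU_of_one_smul_ne_zero {M : Type v} [AddCommGroup M] [Module E.Uni M] {a : I} {m : M}
    (hm : T.one a • m ≠ 0) : ∃ d, T.cls d = a ∧ E.eU d • m ≠ 0 := by
  by_contra! h
  refine hm ?_
  rw [one, Finset.sum_smul]
  exact Finset.sum_eq_zero fun d hd => h d (T.mem_class.1 hd)

lemma one_smul_eq_zero_of_killed {a b : I} {M : Type v} [AddCommGroup M] [Module E.Uni M]
    (h : T.Killed a M) (hb : ¬ b ≤ a) (m : M) : T.one b • m = 0 := by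
  by_contra hm
  obtain ⟨d, rfl, hd⟩ := T.exists_eU_of_one_smul_ne_zero hm
  exact hd (T.killed_iff.1 h d hb m)

lemma truncProp_one_iff {a : I} (X : E.Lfdmod) : T.truncProp a 1 X ↔ T.Killed a X.obj := by
  refine ⟨fun h => h.1, fun h => ⟨h, fun x hx m => ?_⟩⟩
  rw [← sub_eq_zero, ← sub_smul]
  refine h _ (T.qmk_eq_zero_iff.1 ?_) m
  rw [map_sub, hx, sub_eq_zero]
  rfl

lemma exists_smul_eq_of_simple {X : E.Lfdmod} (hX : IsSimpleModule E.Uni X.obj) {m : X.obj}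
    (hm : m ≠ 0) (n : X.obj) : ∃ u : E.Uni, u • m = n := exists_smul_eq_of_ne_zero hm n

/-- For a maximal class `a` not killing a simple module, the module lives over `A_{≤ a}`. -/
lemma exists_killed_of_simple {X : E.Lfdmod} (hX : IsSimpleModule E.Uni X.obj) :
    ∃ a, T.Killed a X.obj ∧ ∃ m : X.obj, T.one a • m ≠ 0 := by
  have := IsSimpleModule.nontrivial E.Uni X.obj
  obtain ⟨m, hm⟩ := exists_ne (0 : X.obj)
  obtain ⟨d, hd⟩ := exists_eU_smul_ne_zero X hm
  have hne : {a : I | ∃ d, T.cls d = a ∧ ∃ m : X.obj, E.eU d • m ≠ 0}.Nonempty :=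
    ⟨_, d, rfl, m, hd⟩
  obtain ⟨a, ⟨d, rfl, m, hm⟩, hmax⟩ := T.wellFounded_gt.has_min _ hne
  refine ⟨T.cls d, T.killed_iff.2 fun h hh x => ?_, E.eU d • m, ?_⟩
  · by_contra hx
    obtain ⟨u, hu⟩ := exists_smul_eq_of_simple hX hx m
    refine hm ?_
    rw [← hu]
    refine T.eU_smul_smul_eU_smul (fun g hg hg' y => ?_) u x
    by_contra hy
    have h1 := hmax (T.cls g) ⟨g, rfl, y, hy⟩
    exact hh (by rw [eq_of_le_of_not_lt hg h1]; exact hg')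
  · rwa [T.one_smul_eU_smul rfl]

lemma isSimpleModule_corner {a : I} {c : T.Abar a} (X : T.Tr a c)
    (hX : IsSimpleModule E.Uni X.obj.obj) (hm : ∃ m : X.obj.obj, T.one a • m ≠ 0) :
    IsSimpleModule (T.Abar a) X.corner := by
  obtain ⟨m, hm⟩ := hm
  have : Nontrivial X.corner :=
    ⟨(⟨T.one a • m, T.one_smul_one_smul a m⟩ : cornerPart (T.oneBar_idem a) X.obj.obj), 0,
      fun h => hm (congrArg (fun z : cornerPart (T.oneBar_idem a) X.obj.obj => z.1) h)⟩
  refine (isSimpleModule_iff _ _).2 { eq_bot_or_eq_top := fun N => ?_ }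
  by_cases hN : N = ⊥
  · exact Or.inl hN
  · right
    obtain ⟨w, hw, hw0⟩ := N.exists_mem_ne_zero_of_ne_bot hN
    have hw1 : (show cornerPart (T.oneBar_idem a) X.obj.obj from w).1 ≠ 0 := fun h =>
      hw0 (Subtype.ext h)
    rw [eq_top_iff]
    intro v _
    obtain ⟨u, hu⟩ := exists_smul_eq_of_simple hX hw1
      (show cornerPart (T.oneBar_idem a) X.obj.obj from v).1
    have h1 : v = (CornerRing.mk (T.oneBar_idem a) (T.qmk a u) : T.Abar a) • w := by
      refine Subtype.ext ?_
      change (show cornerPart (T.oneBar_idem a) X.obj.obj from v).1 =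
        (T.oneBar a * T.qmk a u * T.oneBar a) •
          (show cornerPart (T.oneBar_idem a) X.obj.obj from w).1
      rw [mul_smul, mul_smul, e_smul_cornerPart (T.oneBar_idem a)
        (show cornerPart (T.oneBar_idem a) X.obj.obj from w), qmk_smul, hu,
        e_smul_cornerPart (T.oneBar_idem a) (show cornerPart (T.oneBar_idem a) X.obj.obj from v)]
    rw [h1]
    exact N.smul_mem _ hw

/-- A simple module in the truncated category is determined by its truncation. -/
lemma nonempty_iso_irr {a : I} {c : T.Abar a} (X : T.Tr a c)
    (hX : IsSimpleModule E.Uni X.obj.obj) (S : ModuleCat.{u} (T.Abar a))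
    [IsSimpleModule (T.Abar a) S] (e : S ≃ₗ[T.Abar a] X.corner) :
    Nonempty (X.obj ≅ T.irr S) := by
  have hcX := X.fdProp_corner.2
  have hc : ∀ s : S, c • s = s := fun s => e.injective (by rw [map_smul, hcX])
  let V : T.Fd a c := ⟨S, finite_of_isSimpleModule S, hc⟩
  let f := (T.shriekEquiv V X).symm (ObjectProperty.homMk (ModuleCat.ofHom e.toLinearMap))
  let φ : T.standardize a S →ₗ[E.Uni] X.obj.obj := Tr.lin f
  have hφ : ∀ s : S, φ (Induced.ten (T.oneBar_idem a) 1 s) =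
      (show cornerPart (T.oneBar_idem a) X.obj.obj from e s).1 := fun s =>
    congrArg (fun g : V ⟶ (T.trunc a c).obj X =>
      (show cornerPart (T.oneBar_idem a) X.obj.obj from g.hom.hom s).1)
      ((T.shriekEquiv V X).apply_symm_apply
        (ObjectProperty.homMk (ModuleCat.ofHom e.toLinearMap)))
  have hφ0 : φ ≠ 0 := by
    intro h0
    have := IsSimpleModule.nontrivial (T.Abar a) S
    obtain ⟨s, hs⟩ := exists_ne (0 : S)
    refine hs (e.injective ?_)
    rw [map_zero]
    refine Subtype.ext ((hφ s).symm.trans ?_)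
    rw [h0]
    rfl
  have hsurj : Function.Surjective φ := (LinearMap.surjective_or_eq_zero φ).resolve_right hφ0
  have hco : IsCoatom (LinearMap.ker φ) :=
    isSimpleModule_iff_isCoatom.1 (IsSimpleModule.congr (φ.quotKerEquivOfSurjective hsurj))
  have := IsSimpleModule.nontrivial (T.Abar a) S
  have hker := (T.isCoatom_iff bot_ne_top (T.forall_eq_top_of_simple S) _).1 hco
  exact ⟨(Lfdmod.isoOfLin (X := T.irr S) ((Submodule.quotEquivOfEq _ _ hker.symm).trans
    (φ.quotKerEquivOfSurjective hsurj))).symm⟩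

section FullSet

variable {T} {Λ : I → Type w} {S : ∀ a, Λ a → ModuleCat.{u} (T.Abar a)}

/-- The irreducible modules `L(λ)`. -/
def simples (hS : ∀ a, IsFullSetOfSimples (S a)) (p : Σ a, Λ a) : E.Lfdmod :=
  letI := simple_of_fullSet (hS p.1) p.2
  T.irr (S p.1 p.2)

lemma simples_simple (hS : ∀ a, IsFullSetOfSimples (S a)) (p : Σ a, Λ a) :
    IsSimpleModule E.Uni (simples hS p).obj :=
  letI := simple_of_fullSet (hS p.1) p.2
  T.irr_simple (S p.1 p.2)

lemma killed_simples (hS : ∀ a, IsFullSetOfSimples (S a)) (p : Σ a, Λ a) :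
    T.Killed p.1 (simples hS p).obj :=
  letI := simple_of_fullSet (hS p.1) p.2
  T.killed_irr (S p.1 p.2)

lemma exists_one_smul_simples (hS : ∀ a, IsFullSetOfSimples (S a)) (p : Σ a, Λ a) :
    ∃ m : (simples hS p).obj, T.one p.1 • m = m ∧ m ≠ 0 := by
  let := simple_of_fullSet (hS p.1) p.2
  have := IsSimpleModule.nontrivial (T.Abar p.1) (S p.1 p.2)
  obtain ⟨s, hs⟩ := exists_ne (0 : S p.1 p.2)
  exact ⟨T.irrIncl (S p.1 p.2) s, T.one_smul_irrIncl _ s, fun h => hs ((T.irrIncl_eq_zero _).1 h)⟩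

lemma le_of_one_smul_simples (hS : ∀ a, IsFullSetOfSimples (S a)) {p : Σ a, Λ a} {b : I}
    {m : (simples hS p).obj}
    (hm : T.one b • m ≠ 0) : b ≤ p.1 := by
  by_contra h
  exact hm (T.one_smul_eq_zero_of_killed (killed_simples hS p) h m)

lemma le_of_iso_simples (hS : ∀ a, IsFullSetOfSimples (S a)) {p q : Σ a, Λ a}
    (e : simples hS p ≅ simples hS q) : p.1 ≤ q.1 := by
  obtain ⟨m, hm, hm0⟩ := exists_one_smul_simples hS p
  refine le_of_one_smul_simples hS (p := q) (m := Lfdmod.linOfIso e m) ?_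
  rw [← map_smul, hm]
  exact fun h => hm0 ((Lfdmod.linOfIso e).injective (by rw [h, map_zero]))

/-- The `L(λ)` form a full set of pairwise inequivalent irreducible objects. -/
theorem isFullSetOfSimples_simples (hS : ∀ a, IsFullSetOfSimples (S a)) :
    IsFullSetOfSimples (simples hS) where
  simple p := Lfdmod.simple_iff.2 (simples_simple hS p)
  inequiv := by
    rintro ⟨a, l⟩ ⟨b, m⟩ ⟨e⟩
    obtain rfl : a = b := le_antisymm (le_of_iso_simples hS e) (le_of_iso_simples hS e.symm)
    obtain rfl : l = m := by
      let := simple_of_fullSet (hS a) l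
      let := simple_of_fullSet (hS a) m
      have h1 : ∀ (m : Λ a) (s : S a m), (1 : T.Abar a) • s = s := fun m s => one_smul _ s
      let e' : T.irrTr (S a l) (h1 l) ≅ T.irrTr (S a m) (h1 m) := ObjectProperty.isoMk _ e
      let i := (T.truncIrrIso (S a l) (h1 l)).symm ≪≫ (T.trunc a 1).mapIso e' ≪≫
        T.truncIrrIso (S a m) (h1 m)
      exact (hS a).inequiv l m ⟨(T.fdProp a 1).ι.mapIso i⟩
    rfl
  complete X hX := by
    have hX' := Lfdmod.simple_iff.1 hX
    obtain ⟨a, ha, hm⟩ := T.exists_killed_of_simple hX'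
    let Y : T.Tr a 1 := ⟨X, (T.truncProp_one_iff X).2 ha⟩
    have := T.isSimpleModule_corner Y hX' hm
    obtain ⟨l, ⟨e⟩⟩ := exists_equiv_of_fullSet (hS a) Y.corner
    let := simple_of_fullSet (hS a) l
    exact ⟨⟨a, l⟩, T.nonempty_iso_irr Y hX' (S a l) e.symm⟩

end FullSet

end WeaklyTriangular

end Classification

/-! ### The Serre subcategories attached to a labelling -/

section Labels

open CornerRing LocallyUnital

variable {k A J : Type u} [Field k] [NonUnitalRing A] [Module k A]
  [IsScalarTower k A A] [SMulCommClass k A A]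

namespace WeaklyTriangular

variable {E : LocallyUnital k A J} {I : Type t} [PartialOrder I] {T : WeaklyTriangular E I}
  {Λ : I → Type w} {S : ∀ a, Λ a → ModuleCat.{u} (T.Abar a)}

/-- The lower sets of the label `l` consist of the labels over `b < a` together with those of the
simple `Ā_a`-modules on which `c` acts as the identity. -/
structure IsLabel (S : ∀ a, Λ a → ModuleCat.{u} (T.Abar a)) {Λ' : Type w'} [PartialOrder Λ']
    (ρ : (Σ a, Λ a) → Λ') (l : Λ') (a : I) (c : T.Abar a) : Prop where
  idem : IsIdempotentElem c
  center : c ∈ Set.center (T.Abar a)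
  le_iff : ∀ p, ρ p ≤ l ↔ p.1 < a ∨ ∃ μ : Λ a, p = ⟨a, μ⟩ ∧ ∀ v : S a μ, c • v = v
  lt_iff : ∀ p, ρ p < l ↔ p.1 < a

lemma isLabel_fst (a : I) : IsLabel S (fun p => p.1) a a (1 : T.Abar a) where
  idem := IsIdempotentElem.one
  center := Set.one_mem_center
  le_iff := by
    rintro ⟨b, μ⟩
    refine le_iff_lt_or_eq.trans (or_congr_right ⟨?_, ?_⟩)
    · rintro rfl
      exact ⟨μ, rfl, one_smul _⟩
    · rintro ⟨ν, h, -⟩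
      exact congrArg Sigma.fst h
  lt_iff p := Iff.rfl

lemma isLabel_block (hS : ∀ a, IsFullSetOfSimples (S a)) (β : ∀ a, Λ a → Block (T.Abar a))
    (hβ : ∀ a l (v : S a l), (β a l).1 • v = v) (ω : T.BlockPoset) :
    IsLabel S (fun p => (⟨p.1, β p.1 p.2⟩ : T.BlockPoset)) ω ω.idx ω.blk.1 where
  idem := ω.blk.idem
  center := ω.blk.center
  le_iff := by
    obtain ⟨a, c⟩ := ω
    rintro ⟨b, μ⟩
    rw [or_comm]
    refine or_congr_left ⟨fun h => ?_, ?_⟩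
    · injection h with h1 h2
      subst h1
      refine ⟨μ, rfl, fun v => ?_⟩
      rw [← eq_of_heq h2]
      exact hβ b μ v
    · rintro ⟨ν, h, hv⟩
      obtain ⟨rfl, h⟩ := Sigma.mk.inj_iff.1 h
      obtain rfl := eq_of_heq h
      have := simple_of_fullSet (hS b) μ
      have := IsSimpleModule.nontrivial (T.Abar b) (S b μ)
      exact congrArg (BlockPoset.mk b) (Block.eq_of_smul (M := S b μ) _ _ (hβ b μ) hv)
  lt_iff := by
    obtain ⟨a, c⟩ := ω
    rintro ⟨b, μ⟩
    refine lt_iff_le_and_ne.trans ⟨?_, fun h => ⟨Or.inr h, fun h' => ?_⟩⟩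
    · rintro ⟨h | h, hne⟩
      · exact absurd h hne
      · exact h
    · exact h.ne (congrArg BlockPoset.idx h')

lemma exists_simples_subquotient (hS : ∀ a, IsFullSetOfSimples (S a)) (X : E.Lfdmod) {x : X.obj}
    (hx : x ≠ 0) : ∃ (p : Σ a, Λ a) (N : Submodule E.Uni X.obj)
      (q : N →ₗ[E.Uni] (simples hS p).obj) (hxN : x ∈ N),
      Function.Surjective q ∧ q ⟨x, hxN⟩ ≠ 0 := by
  let N := Submodule.span E.Uni {x}
  have hxN : x ∈ N := Submodule.mem_span_singleton_self x
  have hgen : ∀ M : Submodule E.Uni N, (⟨x, hxN⟩ : N) ∈ M → M = ⊤ := by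
    intro M hM
    rw [eq_top_iff]
    rintro ⟨y, hy⟩ -
    obtain ⟨r, rfl⟩ := Submodule.mem_span_singleton.1 hy
    exact M.smul_mem r hM
  have hnt : Nontrivial N := ⟨⟨x, hxN⟩, 0, fun h => hx (congrArg (fun z : N => z.1) h)⟩
  have hfin : Module.Finite E.Uni N := Module.Finite.span_singleton E.Uni x
  obtain ⟨M, hM⟩ := IsCoatomic.exists_coatom (Submodule E.Uni N)
  let Y := (X.sub N).quo M
  have hY : IsSimpleModule E.Uni Y.obj := isSimpleModule_iff_isCoatom.2 hM
  obtain ⟨p, ⟨e⟩⟩ := (isFullSetOfSimples_simples hS).complete Y (Lfdmod.simple_iff.2 hY)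
  refine ⟨p, N, (Lfdmod.linOfIso e).toLinearMap.comp M.mkQ, hxN,
    (Lfdmod.linOfIso e).surjective.comp M.mkQ_surjective, fun h => hM.1 (hgen M ?_)⟩
  have h1 : M.mkQ ⟨x, hxN⟩ = 0 :=
    (Lfdmod.linOfIso e).injective (Eq.trans h (map_zero (Lfdmod.linOfIso e)).symm)
  exact (Submodule.Quotient.mk_eq_zero M).1 h1

lemma Killed.smul_congr {a : I} {M : Type v} [AddCommGroup M] [Module E.Uni M]
    (h : T.Killed a M) {x y : E.Uni} (hxy : T.qmk a x = T.qmk a y) (m : M) : x • m = y • m := by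
  rw [← sub_eq_zero, ← sub_smul]
  refine h _ (T.qmk_eq_zero_iff.1 ?_) m
  rw [map_sub, hxy, sub_self]

lemma truncProp_of_isSubquotient {a : I} {c : T.Abar a} {X Y : E.Lfdmod}
    (h : IsSubquotient Y X) (hX : T.truncProp a c X) : T.truncProp a c Y := by
  obtain ⟨Z, i, q, hi, hq⟩ := h
  exact T.truncProp_of_surjective q ((Lfdmod.epi_iff q).1 hq)
    (T.truncProp_of_injective i ((Lfdmod.mono_iff i).1 hi) hX)

variable {Λ' : Type w'} [PartialOrder Λ'] {ρ : (Σ a, Λ a) → Λ'} {l : Λ'} {a : I} {c : T.Abar a}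

lemma IsLabel.fst_le (h : IsLabel S ρ l a c) {p : Σ a, Λ a} (hp : ρ p ≤ l) : p.1 ≤ a := by
  rcases (h.le_iff p).1 hp with h | ⟨μ, rfl, -⟩
  · exact h.le
  · exact le_rfl

/-- The Serre subcategories attached to a label. -/
theorem IsLabel.isStratum (hS : ∀ a, IsFullSetOfSimples (S a)) (h : IsLabel S ρ l a c) :
    T.IsStratum (simples hS) ρ l a c := by
  have hle : ∀ X, serreLE (simples hS) ρ l X ↔ T.truncProp a c X := by
    intro X
    constructor
    · intro hX
      have hk : T.Killed a X.obj := by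
        refine T.killed_iff.2 fun d hd x => ?_
        by_contra hx
        obtain ⟨p, N, q, hxN, hq, hne⟩ := exists_simples_subquotient hS X hx
        have h1 : T.one (T.cls d) • q ⟨E.eU d • x, hxN⟩ = q ⟨E.eU d • x, hxN⟩ := by
          rw [← map_smul]
          exact congrArg q (Subtype.ext (T.one_smul_eU_smul rfl x))
        have h2 := le_of_one_smul_simples hS (p := p) (by rw [h1]; exact hne)
        exact hd (h2.trans (h.fst_le (hX p (Lfdmod.isSubquotient_of_sub N q hq))))
      refine ⟨hk, fun x hx m => ?_⟩
      by_contra hne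
      have hy : T.one a • m - x • m ≠ 0 := fun h0 => hne (sub_eq_zero.1 h0).symm
      have e1 : T.one a • x • m = x • m := by
        rw [← mul_smul]
        refine hk.smul_congr ?_ m
        rw [map_mul, hx]
        exact e_mul (T.oneBar_idem a) c
      have e2 : x • T.one a • m = x • m := by
        rw [← mul_smul]
        refine hk.smul_congr ?_ m
        rw [map_mul, hx]
        exact mul_e (T.oneBar_idem a) c
      have e3 : x • x • m = x • m := by
        rw [← mul_smul]
        refine hk.smul_congr ?_ m
        rw [map_mul, hx]
        exact congrArg Subtype.val h.idem.eq
      obtain ⟨p, N, q, hxN, hq, hq0⟩ := exists_simples_subquotient hS X hy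
      set y := q ⟨_, hxN⟩
      have h1 : T.one a • y = y := by
        rw [← map_smul]
        refine congrArg q (Subtype.ext ?_)
        change T.one a • (T.one a • m - x • m) = _
        rw [smul_sub, T.one_smul_one_smul, e1]
      have h2 : x • y = 0 := by
        rw [← map_smul, ← map_zero q]
        refine congrArg q (Subtype.ext ?_)
        change x • (T.one a • m - x • m) = 0
        rw [smul_sub, e2, e3, sub_self]
      have h3 := le_of_one_smul_simples hS (p := p) (b := a) (m := y) (by rw [h1]; exact hq0)
      have h4 := (h.le_iff p).1 (hX p (Lfdmod.isSubquotient_of_sub N q hq))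
      obtain ⟨μ, rfl, hμ⟩ := h4.resolve_left fun h5 => h5.not_ge h3
      let := simple_of_fullSet (hS a) μ
      have h5 := (T.truncProp_irr (S a μ) hμ).2 x hx y
      exact hq0 (by rw [← h1]; exact h5.symm.trans h2)
    · intro hX p hp
      have h1 := truncProp_of_isSubquotient hp hX
      obtain ⟨m, hm, hm0⟩ := exists_one_smul_simples hS p
      have h2 : p.1 ≤ a := by
        by_contra hlt
        exact hm0 (by rw [← hm, T.one_smul_eq_zero_of_killed h1.1 hlt])
      refine (h.le_iff p).2 ?_
      obtain ⟨b, μ⟩ := p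
      rcases h2.lt_or_eq with h3 | rfl
      · exact Or.inl h3
      · refine Or.inr ⟨μ, rfl, fun v => ?_⟩
        let := simple_of_fullSet (hS b) μ
        obtain ⟨x, hx⟩ := T.qmk_surjective b c.1
        rw [← sub_eq_zero, ← T.irrIncl_eq_zero, sub_eq_add_neg, T.irrIncl_add,
          T.irrIncl_smul (S b μ) x c hx]
        have h4 : x • T.irrIncl (S b μ) v = T.irrIncl (S b μ) v :=
          (h1.2 x hx (T.irrIncl (S b μ) v)).trans (T.one_smul_irrIncl _ v)
        rw [h4, ← T.irrIncl_add, ← sub_eq_add_neg, sub_self, T.irrIncl_eq_zero]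
  refine ⟨hle, fun X hX => ⟨fun hlt m hm => ?_, fun h0 p hp => ?_⟩⟩
  · by_contra hne
    obtain ⟨p, N, q, hxN, hq, hq0⟩ := exists_simples_subquotient hS X hne
    have h1 : T.one a • q ⟨m, hxN⟩ = q ⟨m, hxN⟩ := by
      rw [← map_smul]
      exact congrArg q (Subtype.ext hm)
    have h2 := le_of_one_smul_simples hS (p := p) (b := a) (by rw [h1]; exact hq0)
    exact ((h.lt_iff p).1 (hlt p (Lfdmod.isSubquotient_of_sub N q hq))).not_ge h2
  · have h1 := h.fst_le ((hle X).2 hX p hp)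
    rw [h.lt_iff]
    refine lt_of_le_of_ne h1 fun h2 => ?_
    obtain ⟨m, hm, hm0⟩ := exists_one_smul_simples hS p
    obtain ⟨N, q, hq⟩ := Lfdmod.exists_sub_of_isSubquotient hp
    obtain ⟨n, rfl⟩ := hq m
    rw [h2] at hm
    have h3 : T.one a • n = 0 := Subtype.ext (h0 _ (T.one_smul_one_smul a n.1))
    exact hm0 (by rw [← hm, ← map_smul, h3, map_zero])

/-- The idempotent of the label of a simple module acts on it as the identity. -/
lemma IsLabel.smul_eq {l : Λ a} (h : IsLabel S ρ (ρ ⟨a, l⟩) a c) (v : S a l) : c • v = v := by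
  rcases (h.le_iff ⟨a, l⟩).1 le_rfl with h1 | ⟨μ, h1, hμ⟩
  · exact absurd h1 (lt_irrefl _)
  · obtain rfl := eq_of_heq (Sigma.mk.inj_iff.1 h1).2
    exact hμ v

/-- `j_! V` as an object of `A`-lfdmod. -/
def std (V : ModuleCat.{u} (T.Abar a)) (hV : Module.Finite (T.Abar a) V) : E.Lfdmod :=
  ⟨T.standardize a V, T.isLfd_standardize a V hV⟩

/-- `j_* V` as an object of `A`-lfdmod. -/
def costd (V : ModuleCat.{u} (T.Abar a)) (hV : Module.Finite (T.Abar a) V) : E.Lfdmod :=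
  ⟨T.costandardize a V, T.isLfd_costandardize a V hV⟩

section Standard

variable {l : Λ a}

lemma finite_simple (hS : ∀ a, IsFullSetOfSimples (S a)) (l : Λ a) :
    Module.Finite (T.Abar a) (S a l) :=
  letI := simple_of_fullSet (hS a) l
  finite_of_isSimpleModule (S a l)

lemma IsLabel.serreLE (hS : ∀ a, IsFullSetOfSimples (S a)) (h : IsLabel S ρ (ρ ⟨a, l⟩) a c) :
    serreLE (simples hS) ρ (ρ ⟨a, l⟩) (simples hS ⟨a, l⟩) :=
  letI := simple_of_fullSet (hS a) l
  ((h.isStratum hS).le_iff _).2 (T.truncProp_irr (S a l) h.smul_eq)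

/-- The truncation of `L(λ)`. -/
def IsLabel.truncIso (hS : ∀ a, IsFullSetOfSimples (S a)) (h : IsLabel S ρ (ρ ⟨a, l⟩) a c) :
    (T.trunc a c).obj ((h.isStratum hS).toTr (h.serreLE hS)) ≅
      ⟨S a l, finite_simple hS l, h.smul_eq⟩ :=
  letI := simple_of_fullSet (hS a) l
  T.truncIrrIso (S a l) h.smul_eq

lemma IsLabel.isProperStandard (hS : ∀ a, IsFullSetOfSimples (S a))
    (h : IsLabel S ρ (ρ ⟨a, l⟩) a c) (hfin : Module.Finite (T.Abar a) (S a l)) :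
    IsProperStandard (simples hS) ρ ⟨a, l⟩ (std (S a l) hfin) :=
  (h.isStratum hS).isProperStandard (h.serreLE hS) (h.truncIso hS)

lemma IsLabel.isProperCostandard (hS : ∀ a, IsFullSetOfSimples (S a))
    (h : IsLabel S ρ (ρ ⟨a, l⟩) a c) (hfin : Module.Finite (T.Abar a) (S a l)) :
    IsProperCostandard (simples hS) ρ ⟨a, l⟩ (costd (S a l) hfin) :=
  (h.isStratum hS).isProperCostandard (h.serreLE hS) (h.truncIso hS)

lemma IsLabel.isStandard (hS : ∀ a, IsFullSetOfSimples (S a))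
    (h : IsLabel S ρ (ρ ⟨a, l⟩) a c) {P : ModuleCat.{u} (T.Abar a)} {π : P ⟶ S a l}
    (hπ : IsProjCover π) (hfin : Module.Finite (T.Abar a) P) :
    IsStandard (simples hS) ρ ⟨a, l⟩ (std P hfin) := by
  let V : T.Fd a c := ⟨P, hfin, hπ.smul_eq h.center h.idem h.smul_eq⟩
  let W : T.Fd a c := ⟨S a l, finite_simple hS l, h.smul_eq⟩
  let π' : V ⟶ W := ObjectProperty.homMk π
  exact (h.isStratum hS).isStandard (h.serreLE hS) (h.truncIso hS) (π := π')
    (IsProjCover.fullSubcategory (π := π') hπ)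

lemma IsLabel.isCostandard (hS : ∀ a, IsFullSetOfSimples (S a))
    (h : IsLabel S ρ (ρ ⟨a, l⟩) a c) {Q : ModuleCat.{u} (T.Abar a)} {ι : S a l ⟶ Q}
    (hι : IsInjHull ι) (hfin : Module.Finite (T.Abar a) Q) :
    IsCostandard (simples hS) ρ ⟨a, l⟩ (costd Q hfin) := by
  let V : T.Fd a c := ⟨Q, hfin, hι.smul_eq h.center h.idem h.smul_eq⟩
  let W : T.Fd a c := ⟨S a l, finite_simple hS l, h.smul_eq⟩
  let ι' : W ⟶ V := ObjectProperty.homMk ι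
  exact (h.isStratum hS).isCostandard (h.serreLE hS) (h.truncIso hS) (ι := ι')
    (IsInjHull.fullSubcategory (ι := ι') hι)

end Standard

lemma isStratification (hS : ∀ a, IsFullSetOfSimples (S a))
    (h : ∀ l : Λ', ∃ (a : I) (c : T.Abar a), IsLabel S ρ l a c) :
    IsStratification k (simples hS) ρ where
  fullSet := isFullSetOfSimples_simples hS
  finite_fibre l := by
    obtain ⟨a, c, h⟩ := h l
    have := finite_of_fullSet k (hS a)
    refine (Set.finite_range fun μ : Λ a => (⟨a, μ⟩ : Σ a, Λ a)).subset ?_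
    intro p hp
    have hp' : ρ p = l := hp
    rcases (h.le_iff p).1 hp'.le with h1 | ⟨μ, h1, -⟩
    · exact absurd hp' ((h.lt_iff p).2 h1).ne
    · exact ⟨μ, h1.symm⟩
  finite_stratum l := by
    obtain ⟨a, c, h⟩ := h l
    exact (h.isStratum hS).exists_finite_algebra h.idem h.center
  exists_shriek l := by
    obtain ⟨a, c, h⟩ := h l
    exact (h.isStratum hS).isRightAdjoint
  exists_star l := by
    obtain ⟨a, c, h⟩ := h l
    exact (h.isStratum hS).isLeftAdjoint

end WeaklyTriangular

end Labels

/-! ### Filtrations -/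

section Flags

open scoped ZeroObject

variable {C : Type w} [Category.{v} C] [Abelian C] {S : C → Prop}

lemma HasFiniteFlag.of_iso {X Y : C} (h : HasFiniteFlag S X) (e : X ≅ Y) : HasFiniteFlag S Y := by
  cases h with
  | zero _ hX => exact .zero _ (hX.of_iso e.symm)
  | step T hT h₁ h₃ =>
    let T' : ShortComplex C := ShortComplex.mk (T.f ≫ e.hom) (e.inv ≫ T.g) (by simp)
    let i : T ≅ T' := ShortComplex.isoMk (Iso.refl _) e (Iso.refl _) (by simp [T']) (by simp [T'])
    exact HasFiniteFlag.step T' (ShortComplex.shortExact_of_iso i hT) h₁ h₃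

lemma HasFiniteFlag.of_section {X : C} (hX : S X) : HasFiniteFlag S X := by
  let T : ShortComplex C := ShortComplex.mk (0 : (0 : C) ⟶ X) (𝟙 X) (by simp)
  have hT : T.ShortExact :=
    { exact := (T.exact_iff_mono rfl).2 (by change Mono (𝟙 X); infer_instance)
      mono_f := ⟨fun _ _ _ => (isZero_zero C).eq_of_tgt _ _⟩
      epi_g := by change Epi (𝟙 X); infer_instance }
  exact HasFiniteFlag.step T hT (.zero _ (isZero_zero C)) hX

end Flags

section LfdmodFlags

open LocallyUnital

variable {k A J : Type u} [Field k] [NonUnitalRing A] [Module k A]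
  [IsScalarTower k A A] [SMulCommClass k A A] {E : LocallyUnital k A J}

lemma LocallyUnital.Lfdmod.exists_of_shortExact {T : ShortComplex E.Lfdmod} (hT : T.ShortExact)
    (x : T.X₂.obj) (hx : Lfdmod.lin T.g x = 0) : ∃ y, Lfdmod.lin T.f y = x := by
  have := hT.mono_f
  let i := T.X₂.subι (LinearMap.ker (Lfdmod.lin T.g))
  have hi : i ≫ T.g = 0 := Lfdmod.hom_ext_lin fun y => y.2
  refine ⟨Lfdmod.lin (hT.exact.lift i hi) ⟨x, hx⟩, ?_⟩
  exact congrArg (fun g : T.X₂.sub (LinearMap.ker (Lfdmod.lin T.g)) ⟶ T.X₂ => Lfdmod.lin g ⟨x, hx⟩)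
    (hT.exact.lift_f i hi)

/-- Filtrations can be concatenated. -/
lemma HasFiniteFlag.of_ker {S : E.Lfdmod → Prop} {Y : E.Lfdmod} (hY : HasFiniteFlag S Y) :
    ∀ (X : E.Lfdmod) (g : X.obj →ₗ[E.Uni] Y.obj), Function.Surjective g →
      HasFiniteFlag S (X.sub (LinearMap.ker g)) → HasFiniteFlag S X := by
  induction hY with
  | zero Y hY =>
    intro X g hg hX
    have hk : LinearMap.ker g = ⊤ := by
      rw [eq_top_iff]
      intro x _
      exact Lfdmod.isZero_iff.1 hY (g x)
    exact hX.of_iso (Lfdmod.isoOfLin (LinearEquiv.ofTop _ hk))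
  | step T hT h₁ h₃ ih =>
    intro X g hg hX
    have hf : Function.Injective (Lfdmod.lin T.f) := (Lfdmod.mono_iff _).1 hT.mono_f
    have hTg : Function.Surjective (Lfdmod.lin T.g) := (Lfdmod.epi_iff _).1 hT.epi_g
    let g' : X.obj →ₗ[E.Uni] T.X₃.obj := (Lfdmod.lin T.g).comp g
    have hg' : Function.Surjective g' := hTg.comp hg
    let e := LinearEquiv.ofInjective (Lfdmod.lin T.f) hf
    let h : LinearMap.ker g' →ₗ[E.Uni] T.X₁.obj := e.symm.toLinearMap.comp
      (LinearMap.codRestrict _ (g.comp (LinearMap.ker g').subtype) fun z =>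
        Lfdmod.exists_of_shortExact hT (g z.1) z.2)
    have hh : ∀ z, Lfdmod.lin T.f (h z) = g z.1 := fun z => by
      have := e.apply_symm_apply ⟨g z.1, Lfdmod.exists_of_shortExact hT (g z.1) z.2⟩
      exact congrArg Subtype.val this
    have hTfg : ∀ y, Lfdmod.lin T.g (Lfdmod.lin T.f y) = 0 := fun y =>
      congrArg (fun φ : T.X₁ ⟶ T.X₃ => Lfdmod.lin φ y) T.zero
    have hsurj : Function.Surjective h := by
      intro y
      obtain ⟨x, hx⟩ := hg (Lfdmod.lin T.f y)
      refine ⟨⟨x, ?_⟩, hf ?_⟩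
      · change Lfdmod.lin T.g (g x) = 0
        rw [hx, hTfg]
      · rw [hh, hx]
    have hker : HasFiniteFlag S ((X.sub (LinearMap.ker g')).sub (LinearMap.ker h)) := by
      refine hX.of_iso (Lfdmod.isoOfLin (LinearEquiv.ofBijective
        (LinearMap.codRestrict (LinearMap.ker h) (LinearMap.codRestrict (LinearMap.ker g')
          (LinearMap.ker g).subtype fun z => ?_) fun z => ?_) ⟨?_, ?_⟩))
      · change Lfdmod.lin T.g (g z.1) = 0
        rw [show g z.1 = 0 from z.2, map_zero]
      · exact hf ((hh _).trans ((show g z.1 = 0 from z.2).trans (map_zero _).symm))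
      · intro z w hzw
        exact Subtype.ext (congrArg (fun y : LinearMap.ker h => y.1.1) hzw)
      · rintro ⟨⟨x, hx⟩, hx'⟩
        refine ⟨⟨x, ?_⟩, rfl⟩
        change g x = 0
        rw [← hh ⟨x, hx⟩, show h ⟨x, hx⟩ = 0 from hx', map_zero]
    have hN := ih (X.sub (LinearMap.ker g')) h hsurj hker
    exact HasFiniteFlag.step (ShortComplex.mk (X.subι (LinearMap.ker g')) (Lfdmod.ofLin g')
      (Lfdmod.hom_ext_lin fun y => y.2)) (Lfdmod.shortExact_of_lin _
        (Submodule.injective_subtype _) hg' fun x hx => ⟨⟨x, hx⟩, rfl⟩) hN h₃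

/-- Filtrations can be concatenated along a short exact sequence. -/
lemma HasFiniteFlag.of_exact {S : E.Lfdmod → Prop} {X Y Z : E.Lfdmod}
    (f : X.obj →ₗ[E.Uni] Y.obj) (g : Y.obj →ₗ[E.Uni] Z.obj) (hf : Function.Injective f)
    (hg : Function.Surjective g) (hfg : ∀ y, g y = 0 ↔ ∃ x, f x = y)
    (hX : HasFiniteFlag S X) (hZ : HasFiniteFlag S Z) : HasFiniteFlag S Y := by
  refine hZ.of_ker Y g hg (hX.of_iso (Lfdmod.isoOfLin (LinearEquiv.ofBijective
    (LinearMap.codRestrict (LinearMap.ker g) f fun x => (hfg _).2 ⟨x, rfl⟩) ⟨?_, ?_⟩)))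
  · intro x y hxy
    exact hf (congrArg Subtype.val hxy)
  · rintro ⟨y, hy⟩
    obtain ⟨x, rfl⟩ := (hfg y).1 hy
    exact ⟨x, rfl⟩

lemma HasFiniteFlag.of_le {S : E.Lfdmod → Prop} (M : E.Lfdmod) {N U : Submodule E.Uni M.obj}
    (hle : N ≤ U) (h₁ : HasFiniteFlag S (M.sub N))
    (h₂ : HasFiniteFlag S ((M.quo N).sub (U.map N.mkQ))) : HasFiniteFlag S (M.sub U) := by
  let g : U →ₗ[E.Uni] U.map N.mkQ :=
    LinearMap.codRestrict _ (N.mkQ.comp U.subtype) fun x => Submodule.mem_map_of_mem x.2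
  refine HasFiniteFlag.of_exact (X := M.sub N) (Y := M.sub U) (Z := (M.quo N).sub (U.map N.mkQ))
    (Submodule.inclusion hle) g (Submodule.inclusion_injective hle) ?_ ?_ h₁ h₂
  · rintro ⟨_, x, hx, rfl⟩
    exact ⟨⟨x, hx⟩, rfl⟩
  · intro y
    have h : g y = 0 ↔ y.1 ∈ N := by
      rw [← Submodule.Quotient.mk_eq_zero, ← Subtype.val_inj]
      rfl
    refine h.trans ⟨fun hy => ⟨⟨y.1, hy⟩, rfl⟩, ?_⟩
    rintro ⟨x, rfl⟩
    exact x.2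

end LfdmodFlags

/-! ### Filtrations of standardized modules -/

section StandardFlags

open CornerRing LocallyUnital

variable {k A J : Type u} [Field k] [NonUnitalRing A] [Module k A]
  [IsScalarTower k A A] [SMulCommClass k A A]

namespace WeaklyTriangular

variable {E : LocallyUnital k A J} {I : Type t} [PartialOrder I] {T : WeaklyTriangular E I}
  {a : I}

lemma standardizeMap_injective {V W : ModuleCat.{u} (T.Abar a)} (i : V →ₗ[T.Abar a] W)
    (hi : Function.Injective i) : Function.Injective (T.standardizeMap i) :=
  (T.coords a).map_injective i hi

lemma standardizeMap_surjective {V W : ModuleCat.{u} (T.Abar a)} (f : V →ₗ[T.Abar a] W)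
    (hf : Function.Surjective f) : Function.Surjective (T.standardizeMap f) :=
  Induced.map_surjective (T.oneBar_idem a) f hf

lemma standardizeMap_eq_zero_iff {V V' W : ModuleCat.{u} (T.Abar a)}
    (i : V' →ₗ[T.Abar a] V) (f : V →ₗ[T.Abar a] W) (hf : Function.Surjective f)
    (hif : ∀ v, f v = 0 ↔ ∃ x, i x = v) (z : T.standardize a V) :
    T.standardizeMap f z = 0 ↔ ∃ y, T.standardizeMap i y = z := by
  refine ⟨fun hz => Induced.ker_map_le (T.oneBar_idem a) i f hf (fun v => (hif v).1) z hz, ?_⟩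
  rintro ⟨y, rfl⟩
  have key : ∀ y : Induced (T.oneBar_idem a) V', Induced.map (T.oneBar_idem a) f
      (Induced.map (T.oneBar_idem a) i y) = 0 := by
    intro y
    induction y using Induced.induction with
    | zero => rw [map_zero, map_zero]
    | add z w hz hw => rw [map_add, map_add, hz, hw, add_zero]
    | ten x v =>
      rw [Induced.map_ten, Induced.map_ten, (hif _).2 ⟨v, rfl⟩, Induced.ten_zero]
  exact key y

/-- The functor `j_!` is exact; hence a filtration of the two ends of an exact sequence induces
one of `j_!` of its middle term. -/
lemma hasFiniteFlag_std_of_exact {P : E.Lfdmod → Prop} {V V' W : ModuleCat.{u} (T.Abar a)}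
    {hV : Module.Finite (T.Abar a) V} {hV' : Module.Finite (T.Abar a) V'}
    {hW : Module.Finite (T.Abar a) W}
    (i : V' →ₗ[T.Abar a] V) (f : V →ₗ[T.Abar a] W) (hi : Function.Injective i)
    (hf : Function.Surjective f) (hif : ∀ v, f v = 0 ↔ ∃ x, i x = v)
    (h₁ : HasFiniteFlag P (std V' hV')) (h₃ : HasFiniteFlag P (std W hW)) :
    HasFiniteFlag P (std V hV) :=
  HasFiniteFlag.of_exact (X := std V' hV') (Z := std W hW) (T.standardizeMap i)
    (T.standardizeMap f) (standardizeMap_injective i hi) (standardizeMap_surjective f hf)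
    (standardizeMap_eq_zero_iff i f hf hif) h₁ h₃

lemma hasFiniteFlag_std_of_subsingleton {P : E.Lfdmod → Prop} {V : ModuleCat.{u} (T.Abar a)}
    (hV : Module.Finite (T.Abar a) V) (h : Subsingleton V) : HasFiniteFlag P (std V hV) := by
  refine .zero _ (Lfdmod.isZero_iff.2 fun z => ?_)
  have key : ∀ z : Induced (T.oneBar_idem a) V, z = 0 := by
    intro z
    induction z using Induced.induction with
    | zero => rfl
    | add z w hz hw => rw [hz, hw, add_zero]
    | ten x v => rw [Subsingleton.elim v 0, Induced.ten_zero]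
  exact key z

variable {Λ : I → Type w} {S : ∀ a, Λ a → ModuleCat.{u} (T.Abar a)}
  {Λ' : Type w'} [PartialOrder Λ'] {ρ : (Σ a, Λ a) → Λ'}

lemma IsLabel.eq_fst {q : Σ a, Λ a} {c : T.Abar a} (h : IsLabel S ρ (ρ q) a c) : q.1 = a := by
  rcases (h.le_iff q).1 le_rfl with h1 | ⟨μ, rfl, -⟩
  · exact absurd ((h.lt_iff q).2 h1) (lt_irrefl _)
  · rfl

lemma exists_isLabel (h : ∀ l : Λ', ∃ (a : I) (c : T.Abar a), IsLabel S ρ l a c) (l : Λ a) :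
    ∃ c : T.Abar a, IsLabel S ρ (ρ ⟨a, l⟩) a c := by
  obtain ⟨b, c, hb⟩ := h (ρ ⟨a, l⟩)
  obtain rfl : a = b := hb.eq_fst
  exact ⟨c, hb⟩

/-- The sections allowed in a flag below the label `p`. -/
abbrev IsSection (hS : ∀ a, IsFullSetOfSimples (S a)) (ρ : (Σ a, Λ a) → Λ') (ε : Λ' → Sgn)
    (p : Σ a, Λ a) (X : E.Lfdmod) : Prop :=
  ∃ q, ρ p ≤ ρ q ∧ IsSignedStandard (simples hS) ρ ε q X

variable {ε : Λ' → Sgn} {p : Σ a, Λ a}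

/-- In a negative stratum, `j_!` of any finite dimensional module is filtered by proper standard
objects. -/
lemma hasFiniteFlag_std_of_minus (hS : ∀ a, IsFullSetOfSimples (S a)) {l : Λ a} {c : T.Abar a}
    (h : IsLabel S ρ (ρ ⟨a, l⟩) a c) (hε : ε (ρ ⟨a, l⟩) = Sgn.minus) (hp : ρ p ≤ ρ ⟨a, l⟩)
    (V : ModuleCat.{u} (T.Abar a)) (hV : Module.Finite (T.Abar a) V) (hc : ∀ v : V, c • v = v) :
    HasFiniteFlag (IsSection hS ρ ε p) (std V hV) := by
  have : IsArtinianRing (T.Abar a) := IsArtinianRing.of_finite k (T.Abar a)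
  induction hn : Module.length (T.Abar a) V using WellFoundedLT.induction generalizing V with
  | _ n ih =>
    subst hn
    rcases subsingleton_or_nontrivial V with h0 | h0
    · exact hasFiniteFlag_std_of_subsingleton hV h0
    obtain ⟨M, hM⟩ := IsCoatomic.exists_coatom (Submodule (T.Abar a) V)
    have : IsSimpleModule (T.Abar a) (V ⧸ M) := isSimpleModule_iff_isCoatom.2 hM
    obtain ⟨ν, ⟨e⟩⟩ := exists_equiv_of_fullSet (hS a) (V ⧸ M)
    let f : V →ₗ[T.Abar a] S a ν := e.toLinearMap.comp M.mkQ
    have hf : Function.Surjective f := e.surjective.comp M.mkQ_surjective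
    have hν : ∀ s : S a ν, c • s = s := by
      intro s
      obtain ⟨v, rfl⟩ := hf s
      rw [← map_smul, hc]
    have hρ : ρ ⟨a, ν⟩ = ρ ⟨a, l⟩ := by
      refine ((h.le_iff ⟨a, ν⟩).2 (Or.inr ⟨ν, rfl, hν⟩)).eq_of_not_lt fun hlt => ?_
      exact lt_irrefl a ((h.lt_iff _).1 hlt)
    refine hasFiniteFlag_std_of_exact (V' := ModuleCat.of (T.Abar a) M)
      (hV' := inferInstanceAs (Module.Finite (T.Abar a) M)) (hW := finite_simple hS ν)
      M.subtype f M.injective_subtype hf (fun v => ⟨fun hv => ?_, ?_⟩)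
      (ih _ (Submodule.length_lt hM.1) _ _ (fun v => Subtype.ext (hc v.1)) rfl)
      (HasFiniteFlag.of_section ⟨⟨a, ν⟩, hp.trans hρ.ge, ?_⟩)
    · have h1 : M.mkQ v = 0 := e.injective (hv.trans (map_zero e).symm)
      exact ⟨⟨v, (Submodule.Quotient.mk_eq_zero M).1 h1⟩, rfl⟩
    · rintro ⟨x, rfl⟩
      have h1 : M.mkQ x.1 = 0 := (Submodule.Quotient.mk_eq_zero M).2 x.2
      exact (congrArg e h1).trans (map_zero e)
    · have h1 : ε (ρ ⟨a, ν⟩) = Sgn.minus := by rw [hρ, hε]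
      simp only [IsSignedStandard, h1]
      rw [← hρ] at h
      exact h.isProperStandard hS _

/-- `j_!` of an indecomposable projective module has a flag in either sign. -/
lemma hasFiniteFlag_std_cover (hS : ∀ a, IsFullSetOfSimples (S a)) {l : Λ a} {c : T.Abar a}
    (h : IsLabel S ρ (ρ ⟨a, l⟩) a c) (hp : ρ p ≤ ρ ⟨a, l⟩) {P : ModuleCat.{u} (T.Abar a)}
    {π : P ⟶ S a l} (hπ : IsProjCover π) (hP : Module.Finite (T.Abar a) P) :
    HasFiniteFlag (IsSection hS ρ ε p) (std P hP) := by
  cases hε : ε (ρ ⟨a, l⟩) with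
  | plus =>
    refine HasFiniteFlag.of_section ⟨⟨a, l⟩, hp, ?_⟩
    simp only [IsSignedStandard, hε]
    exact h.isStandard hS hπ hP
  | minus =>
    exact hasFiniteFlag_std_of_minus hS h hε hp P hP (hπ.smul_eq h.center h.idem h.smul_eq)

/-- `j_!` of a finite dimensional projective module has a flag, for any signs. -/
lemma hasFiniteFlag_std_of_projective (hS : ∀ a, IsFullSetOfSimples (S a))
    (hρ : ∀ l : Λ', ∃ (a : I) (c : T.Abar a), IsLabel S ρ l a c)
    (hp : ∀ l : Λ a, ρ p ≤ ρ ⟨a, l⟩) (V : ModuleCat.{u} (T.Abar a))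
    (hV : Module.Finite (T.Abar a) V) (hVp : Module.Projective (T.Abar a) V) :
    HasFiniteFlag (IsSection hS ρ ε p) (std V hV) := by
  have : IsArtinianRing (T.Abar a) := IsArtinianRing.of_finite k (T.Abar a)
  induction hn : Module.length (T.Abar a) V using WellFoundedLT.induction generalizing V with
  | _ n ih =>
    subst hn
    rcases subsingleton_or_nontrivial V with h0 | h0
    · exact hasFiniteFlag_std_of_subsingleton hV h0
    obtain ⟨M, hM⟩ := IsCoatomic.exists_coatom (Submodule (T.Abar a) V)
    have : IsSimpleModule (T.Abar a) (V ⧸ M) := isSimpleModule_iff_isCoatom.2 hM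
    obtain ⟨ν, ⟨e⟩⟩ := exists_equiv_of_fullSet (hS a) (V ⧸ M)
    let q : V →ₗ[T.Abar a] S a ν := e.toLinearMap.comp M.mkQ
    have hq : Function.Surjective q := e.surjective.comp M.mkQ_surjective
    have hsimple := simple_of_fullSet (hS a) ν
    have := IsSimpleModule.nontrivial (T.Abar a) (S a ν)
    obtain ⟨s, hs⟩ := exists_ne (0 : S a ν)
    obtain ⟨f, hf⟩ := exists_isCoverIdem (R := T.Abar a) k hs
    have hπ := hf.isProjCover
    set π : ModuleCat.of (T.Abar a) (Ideal.span {f}) ⟶ S a ν := ModuleCat.ofHom _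
    -- The quotient map to a simple module lifts to its projective cover, which splits off.
    obtain ⟨h, hh⟩ := Module.projective_lifting_property π.hom q hπ.surjective
    have hhs : Function.Surjective h := by
      refine LinearMap.range_eq_top.1 (hπ.eq_top _ fun t => ?_)
      obtain ⟨v, rfl⟩ := hq t
      exact ⟨h v, ⟨v, rfl⟩, LinearMap.congr_fun hh v⟩
    have hPp : Module.Projective (T.Abar a) (ModuleCat.of (T.Abar a) (Ideal.span {f})) :=
      (IsProjective.iff_projective _).2 hπ.1
    obtain ⟨σ, hσ⟩ := Module.projective_lifting_property h LinearMap.id hhs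
    have hσ' : ∀ x, h (σ x) = x := LinearMap.congr_fun hσ
    let K := LinearMap.ker h
    let r : V →ₗ[T.Abar a] K := LinearMap.codRestrict K (LinearMap.id - σ.comp h) fun v => by
      change h (v - σ (h v)) = 0
      rw [map_sub, hσ', sub_self]
    have hK : Module.Projective (T.Abar a) K := Module.Projective.of_split K.subtype r
      (LinearMap.ext fun v => Subtype.ext (by
        change v.1 - σ (h v.1) = v.1
        rw [show h v.1 = 0 from v.2, map_zero, sub_zero]))
    have hne : K ≠ ⊤ := by
      intro htop
      refine hs ?_
      obtain ⟨v, hv⟩ := hq s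
      have h1 : h v = 0 := (htop ▸ Submodule.mem_top : v ∈ K)
      rw [← hv, ← hh, LinearMap.comp_apply, h1, map_zero]
    obtain ⟨c, hc⟩ := exists_isLabel hρ ν
    exact hasFiniteFlag_std_of_exact (V' := ModuleCat.of (T.Abar a) K)
      (W := ModuleCat.of (T.Abar a) (Ideal.span {f}))
      (hV' := inferInstanceAs (Module.Finite (T.Abar a) K)) (hW := hπ.finite)
      K.subtype h K.injective_subtype hhs (fun v => ⟨fun hv => ⟨⟨v, hv⟩, rfl⟩, by
        rintro ⟨x, rfl⟩; exact x.2⟩)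
      (ih _ (Submodule.length_lt hne) _ _ hK rfl)
      (hasFiniteFlag_std_cover hS hc (hp ν) hπ _)

end WeaklyTriangular

end StandardFlags

/-! ### Layers of cyclic modules -/

section Layers

open CornerRing LocallyUnital

variable {k A J : Type u} [Field k] [NonUnitalRing A] [Module k A]
  [IsScalarTower k A A] [SMulCommClass k A A]

namespace WeaklyTriangular

variable {E : LocallyUnital k A J} {I : Type t} [PartialOrder I] (T : WeaklyTriangular E I)
  {g : I}

section

variable {M : Type v} [AddCommGroup M] [Module E.Uni M]

/-- If everything above `g` kills `M`, then `1_g A 1_b` kills `M` for `b ≰ g`. -/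
lemma one_smul_smul_of_mem_idealNotLE
    (hM : ∀ d, g < T.cls d → ∀ m : M, E.eU d • m = 0) {x : E.Uni} (hx : x ∈ T.idealNotLE g)
    (m : M) :
    T.one g • x • m = 0 := by
  unfold idealNotLE at hx
  rw [TwoSidedIdeal.mem_span_iff_mem_addSubgroup_closure] at hx
  induction hx using AddSubgroup.closure_induction with
  | mem x hx =>
    obtain ⟨_, ⟨u, -, _, ⟨b, hb, rfl⟩, rfl⟩, u', -, rfl⟩ := hx
    change T.one g • (u * T.one b * u') • m = 0
    rw [mul_smul, mul_smul, one, one, Finset.sum_smul]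
    refine Finset.sum_eq_zero fun d hd => ?_
    rw [Finset.sum_smul, Finset.smul_sum, Finset.smul_sum]
    refine Finset.sum_eq_zero fun d' hd' => ?_
    rw [T.mem_class] at hd hd'
    refine T.eU_smul_smul_eU_smul (fun h h1 h2 m => hM h (lt_of_le_of_ne (hd ▸ h1) ?_) m) u _
    rintro rfl
    exact hb (hd' ▸ h2)
  | zero => rw [zero_smul, smul_zero]
  | add x y _ _ hx hy => rw [add_smul, smul_add, hx, hy, add_zero]
  | neg x _ hx => rw [neg_smul, smul_neg, hx, neg_zero]

/-- The submodule generated by `1_g M`. -/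
def layerSub (g : I) (M : Type v) [AddCommGroup M] [Module E.Uni M] : Submodule E.Uni M :=
  Submodule.span E.Uni (Set.range fun m : M => T.one g • m)

lemma one_smul_mem_layerSub (g : I) (m : M) : T.one g • m ∈ T.layerSub g M :=
  Submodule.subset_span ⟨m, rfl⟩

lemma killed_layerSub (hM : ∀ d, g < T.cls d → ∀ m : M, E.eU d • m = 0) :
    T.Killed g (T.layerSub g M) := by
  refine T.killed_iff.2 fun d hd ⟨m, hm⟩ => Subtype.ext ?_
  change E.eU d • m = 0
  unfold layerSub at hm
  refine Submodule.closure_induction (p := fun m _ => E.eU d • m = 0) (smul_zero _) ?_ ?_ hm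
  · intro x y _ _ hx hy
    rw [smul_add, hx, hy, add_zero]
  · rintro u _ ⟨m, rfl⟩
    change E.eU d • u • T.one g • m = 0
    rw [one, Finset.sum_smul, Finset.smul_sum, Finset.smul_sum]
    refine Finset.sum_eq_zero fun d' hd' => ?_
    rw [T.mem_class] at hd'
    refine T.eU_smul_smul_eU_smul (fun h h1 h2 m => hM h (lt_of_le_of_ne (hd' ▸ h2) ?_) m) u _
    rintro rfl
    exact hd h1

end

/-- The submodule generated by `1_g M`, as an object of the truncated category. -/
def layerTr (M : E.Lfdmod) (hM : ∀ d, g < T.cls d → ∀ m : M.obj, E.eU d • m = 0) : T.Tr g 1 :=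
  ⟨M.sub (T.layerSub g M.obj), (T.truncProp_one_iff _).2 (T.killed_layerSub hM)⟩

/-- The layer at `g` of a cyclic module `A f` is `j_!` of a projective module. -/
theorem exists_std_iso_layerSub (M : E.Lfdmod)
    (hM : ∀ d, g < T.cls d → ∀ m : M.obj, E.eU d • m = 0) {f : E.Uni} {v : M.obj}
    (hv : ∀ m : M.obj, ∃ x : E.Uni, x • v = m) (hfv : f • v = v)
    (φ : M.obj →ₗ[E.Uni] T.quotLE g) (hφ : φ v = T.qmk g f) :
    ∃ (W : ModuleCat.{u} (T.Abar g)) (hW : Module.Finite (T.Abar g) W),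
      Module.Projective (T.Abar g) W ∧
        Nonempty (std W hW ≅ M.sub (T.layerSub g M.obj)) := by
  let N := T.layerSub g M.obj
  have hk : T.Killed g N := T.killed_layerSub hM
  have h0 : ∀ {x : E.Uni}, x ∈ T.idealNotLE g → ∀ m : M.obj, T.one g • x • m = 0 :=
    fun hx m => T.one_smul_smul_of_mem_idealNotLE hM hx m
  have h0' : ∀ {x y : E.Uni}, T.qmk g x = T.qmk g y → ∀ m : M.obj,
      T.one g • x • m = T.one g • y • m := fun {x y} hxy m => by
    rw [← sub_eq_zero, ← smul_sub, ← sub_smul]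
    exact h0 (T.qmk_eq_zero_iff.1 (by rw [map_sub, hxy, sub_self])) m
  have hφ' : ∀ x : E.Uni, φ (x • v) = T.qmk g (x * f) := fun x => by
    rw [map_smul, hφ]; rfl
  let φX : (T.layerTr M hM).obj.obj →ₗ[T.quotLE g] T.quotLE g :=
    { toFun := fun n => φ (show N from n).1
      map_add' := fun x y => map_add φ (show N from x).1 (show N from y).1
      map_smul' := fun r n => by
        obtain ⟨x, rfl⟩ := T.qmk_surjective g r
        exact map_smul φ x (show N from n).1 }
  have hinj : ∀ n ∈ cornerPart (T.oneBar_idem g) (T.layerTr M hM).obj.obj, φX n = 0 → n = 0 := by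
    intro n hn hn0
    refine Subtype.ext ?_
    have hn1 : T.one g • (show N from n).1 = (show N from n).1 :=
      congrArg (fun z : N => z.1) (show T.one g • (show N from n) = n from hn)
    obtain ⟨x, hx⟩ := hv (show N from n).1
    have h1 : T.qmk g (x * f) = 0 := by rw [← hφ', hx]; exact hn0
    have h2 := h0 (T.qmk_eq_zero_iff.1 h1) v
    rw [mul_smul, hfv, hx, hn1] at h2
    exact h2
  -- The retraction of the inclusion of `1_g N` into `1_g A_{≤ g}`.
  let s : T.quotLE g → N := fun r =>
    ⟨T.one g • Function.surjInv (T.qmk_surjective g) r • v, T.one_smul_mem_layerSub g _⟩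
  have hs : ∀ x : E.Uni, (s (T.qmk g x)).1 = T.one g • x • v := fun x =>
    h0' (Function.surjInv_eq (T.qmk_surjective g) _) v
  have hs1 : ∀ r, s r ∈ cornerPart (T.oneBar_idem g) (T.layerTr M hM).obj.obj := fun r => by
    obtain ⟨x, rfl⟩ := T.qmk_surjective g r
    refine Subtype.ext ?_
    change T.one g • (s (T.qmk g x)).1 = (s (T.qmk g x)).1
    rw [hs, T.one_smul_one_smul]
  let σ : cornerPart (T.oneBar_idem g) (T.quotLE g) →ₗ[T.Abar g] (T.layerTr M hM).corner :=
    { toFun := fun r => (⟨s r.1, hs1 r.1⟩ : cornerPart (T.oneBar_idem g) (T.layerTr M hM).obj.obj)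
      map_add' := fun r r' => Subtype.ext (Subtype.ext (by
        obtain ⟨x, hx⟩ := T.qmk_surjective g r.1
        obtain ⟨y, hy⟩ := T.qmk_surjective g r'.1
        change (s (r.1 + r'.1)).1 = (s r.1).1 + (s r'.1).1
        rw [← hx, ← hy, ← map_add, hs, hs, hs, add_smul, smul_add]))
      map_smul' := fun h r => Subtype.ext (Subtype.ext (by
        obtain ⟨x, hx⟩ := T.qmk_surjective g r.1
        obtain ⟨y, hy⟩ := T.qmk_surjective g h.1
        change (s (h.1 * r.1)).1 =
          ((show N from h.1 • (show (T.layerTr M hM).obj.obj from s r.1)) : N).1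
        rw [← hx, ← hy, ← map_mul, hs]
        have h1 : ((show N from T.qmk g y •
            (show (T.layerTr M hM).obj.obj from s (T.qmk g x))) : N).1 =
            y • (s (T.qmk g x)).1 := rfl
        rw [h1, hs, mul_smul]
        have h2 : T.qmk g y = T.qmk g (y * T.one g) := by
          rw [map_mul, hy]
          exact (mul_e (T.oneBar_idem g) h).symm
        have h3 : T.qmk g (T.one g * y) = T.qmk g y := by
          rw [map_mul, hy]
          exact e_mul (T.oneBar_idem g) h
        have h4 := congrArg (fun z : N => z.1)
          (hk.smul_congr h3 ⟨T.one g • x • v, T.one_smul_mem_layerSub g _⟩)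
        refine (h0' h2 _).trans ?_
        rw [mul_smul]
        exact (mul_smul (T.one g) y (T.one g • x • v)).symm.trans h4)) }
  have hsplit : σ.comp (cornerMap (T.oneBar_idem g) φX) = LinearMap.id := by
    refine LinearMap.ext fun n => Subtype.ext (Subtype.ext ?_)
    have hn1 : T.one g • (show N from n.1).1 = (show N from n.1).1 :=
      congrArg (fun z : N => z.1) (show T.one g • (show N from n.1) = n.1 from n.2)
    obtain ⟨x, hx⟩ := hv (show N from n.1).1
    change (s (φ (show N from n.1).1)).1 = (show N from n.1).1
    rw [← hx, hφ', hs, mul_smul, hfv, hx, hn1]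
  have hproj : Module.Projective (T.Abar g) (T.layerTr M hM).corner := by
    have := (T.coords g).projective_cornerPart
    exact Module.Projective.of_split _ σ hsplit
  refine ⟨(T.layerTr M hM).corner, (T.layerTr M hM).finite_corner, hproj, ⟨?_⟩⟩
  let L := Induced.lift (T.oneBar_idem g) (M := (T.layerTr M hM).obj.obj)
    (LinearMap.id : cornerPart (T.oneBar_idem g) (T.layerTr M hM).obj.obj →ₗ[T.Abar g] _)
  have hL : Function.Injective L := (T.coords g).lift_injective_of_injective φX hinj
  have hL' : ∀ n : M.obj, ∀ hn : n ∈ N, ∃ z, L z = (⟨n, hn⟩ : N) := by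
    intro n hn
    refine Submodule.closure_induction (p := fun n hn => ∃ z, L z = (⟨n, hn⟩ : N))
      ⟨0, map_zero L⟩ ?_ ?_ hn
    · rintro x y hx hy ⟨z, hz⟩ ⟨w, hw⟩
      exact ⟨z + w, (map_add L z w).trans (congrArg₂ (· + ·) hz hw)⟩
    · rintro u _ ⟨m, rfl⟩
      have hm : (⟨T.one g • m, T.one_smul_mem_layerSub g m⟩ : N) ∈
          (show Set N from (cornerPart (T.oneBar_idem g) (T.layerTr M hM).obj.obj).carrier) :=
        Subtype.ext (T.one_smul_one_smul g m)
      exact ⟨Induced.ten (T.oneBar_idem g) (T.qmk g u) ⟨_, hm⟩, Induced.lift_ten _ _ _ _⟩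
  let L' : (std (T.layerTr M hM).corner (T.layerTr M hM).finite_corner).obj →ₗ[E.Uni] N :=
    { toFun := fun z => (show N from L z)
      map_add' := fun z w => map_add L z w
      map_smul' := fun x z => map_smul L (T.qmk g x)
        (show Induced (T.oneBar_idem g) (T.layerTr M hM).corner from z) }
  exact Lfdmod.isoOfLin (Y := M.sub N) (LinearEquiv.ofBijective L' ⟨hL, fun n => hL' n.1 n.2⟩)

end WeaklyTriangular

end Layers

/-! ### Projective objects with a flag -/

section ProjectiveFlags

open CornerRing LocallyUnital

variable {k A J : Type u} [Field k] [NonUnitalRing A] [Module k A]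
  [IsScalarTower k A A] [SMulCommClass k A A]

namespace WeaklyTriangular

variable {E : LocallyUnital k A J} {I : Type t} [PartialOrder I] (T : WeaklyTriangular E I)
  {a : I}

/-- Idempotents of `Ā_a` lift to `A`. -/
lemma exists_idempotent_lift {h : T.Abar a} (hh : IsIdempotentElem h) :
    ∃ f : E.Uni, IsIdempotentElem f ∧ f * T.one a = f ∧ T.one a * f = f ∧ T.qmk a f = h.1 := by
  obtain ⟨y, hy⟩ := T.cornerQmk_surjective a h
  obtain ⟨p, h0, h1, hp⟩ := exists_idempotent_aeval (k := k) y
  refine ⟨(Polynomial.aeval y p).1, congrArg Subtype.val hp, mul_e (T.one_idem a) _,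
    e_mul (T.one_idem a) _, ?_⟩
  have h2 : T.cornerQmk a (Polynomial.aeval y p) = h := by
    rw [← Polynomial.aeval_algHom_apply, hy, aeval_idempotent hh h0 h1]
  exact congrArg Subtype.val h2

/-- The left ideal generated by `f`, as a module. -/
def spanMod (f : E.Uni) : ModuleCat.{u} E.Uni := ModuleCat.of E.Uni (Ideal.span {f})

/-- The inclusion of the left ideal generated by `f`. -/
def spanVal (f : E.Uni) : spanMod f →ₗ[E.Uni] E.Uni := Submodule.subtype (Ideal.span {f})

lemma spanVal_injective (f : E.Uni) : Function.Injective (spanVal f) :=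
  Submodule.injective_subtype _

lemma isLfd_span {f : E.Uni} (hf : f * T.one a = f) : E.isLfd (spanMod f) := by
  have hmem : ∀ m : spanMod f, spanVal f m * T.one a = spanVal f m := fun m => by
    obtain ⟨r, hr⟩ := Ideal.mem_span_singleton'.1 (show Ideal.span {f} from m).2
    change (show Ideal.span {f} from m).1 * T.one a = (show Ideal.span {f} from m).1
    rw [← hr, mul_assoc, hf]
  refine ⟨fun m => ?_, fun p => ?_⟩
  · obtain ⟨x, hx⟩ : ∃ x : A, spanVal f m = (x : E.Uni) := by
      have h1 : ∀ d, ∃ x : A, spanVal f m * E.eU d = (x : E.Uni) := fun d =>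
        exists_mul_inr (E := E) _ (E.e d)
      choose x hx using h1
      refine ⟨∑ d ∈ (T.finite_class a).toFinset, x d, ?_⟩
      rw [← hmem, one, Finset.mul_sum, Finset.sum_congr rfl fun d _ => hx d]
      exact (map_sum (Unitization.inrHom k k A) _ _).symm
    obtain ⟨s, hs⟩ := E.exists_sum_mul_eq x
    refine ⟨s, spanVal_injective f ?_⟩
    rw [map_smul, hx]
    exact hs
  · classical
    let N : Submodule k E.Uni := (T.finite_class a).toFinset.sup fun q =>
      (E.hom p q).map (Unitization.inrHom k k A)
    have hN : Module.Finite k N := by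
      rw [Module.Finite.iff_fg]
      exact Submodule.fg_finset_sup _ _ fun q _ =>
        Submodule.FG.map _ (Module.Finite.iff_fg.1 (E.finite p q))
    let φ : spanMod f →ₗ[k] E.Uni := (spanVal f).restrictScalars k
    have hφ : ∀ m ∈ LinearMap.range (Algebra.lsmul k k (spanMod f) (E.eU p)), φ m ∈ N := by
      rintro _ ⟨m, rfl⟩
      have h1 : φ (Algebra.lsmul k k (spanMod f) (E.eU p) m) = E.eU p * spanVal f m :=
        map_smul (spanVal f) (E.eU p) m
      rw [h1, ← hmem, one, Finset.mul_sum, Finset.mul_sum]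
      refine Submodule.sum_mem _ fun q hq => ?_
      obtain ⟨z, hz, h2⟩ := exists_mem_hom (E := E) p q (spanVal f m)
      rw [h2]
      exact Finset.le_sup (f := fun q => (E.hom p q).map (Unitization.inrHom k k A)) hq
        ⟨z, hz, rfl⟩
    refine Module.Finite.of_injective (φ.restrict hφ) fun x y h => Subtype.ext ?_
    exact spanVal_injective f (congrArg (fun z : N => z.1) h)

/-- The module `A f`. -/
def spanObj {f : E.Uni} (hf : f * T.one a = f) : E.Lfdmod :=
  ⟨spanMod f, T.isLfd_span hf⟩

/-- The generator of `A f`. -/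
def spanGen {f : E.Uni} (hf : f * T.one a = f) : (T.spanObj hf).obj :=
  (⟨f, Ideal.mem_span_singleton_self f⟩ : Ideal.span {f})

lemma exists_smul_spanGen {f : E.Uni} (hf : f * T.one a = f) (m : (T.spanObj hf).obj) :
    ∃ x : E.Uni, x • T.spanGen hf = m := by
  obtain ⟨r, hr⟩ := Ideal.mem_span_singleton'.1 (show Ideal.span {f} from m).2
  exact ⟨r, Subtype.ext hr⟩

lemma projective_spanObj {f : E.Uni} (hf : f * T.one a = f) (hf' : IsIdempotentElem f) :
    Projective (T.spanObj hf) := by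
  refine Lfdmod.projective_of_module _ fun {Y Z} p φ hp => ?_
  obtain ⟨y, hy⟩ := hp (φ (T.spanGen hf))
  refine ⟨(LinearMap.toSpanSingleton E.Uni Y y).comp (spanVal f),
    fun m => ?_⟩
  obtain ⟨x, rfl⟩ := T.exists_smul_spanGen hf m
  change p ((x * f) • y) = _
  rw [map_smul, hy, map_smul, mul_smul, ← map_smul]
  congr 2
  exact Subtype.ext hf'

/-- The submodule generated by the `1_h M`, `h ∈ F`. -/
def upSub (F : Finset I) (M : Type v) [AddCommGroup M] [Module E.Uni M] : Submodule E.Uni M :=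
  ⨆ h ∈ F, T.layerSub h M

lemma layerSub_le_upSub {F : Finset I} {h : I} (hh : h ∈ F) (M : Type v) [AddCommGroup M]
    [Module E.Uni M] : T.layerSub h M ≤ T.upSub F M :=
  le_iSup₂_of_le h hh le_rfl

lemma upSub_le_iff {F : Finset I} {M : Type v} [AddCommGroup M] [Module E.Uni M]
    {N : Submodule E.Uni M} : T.upSub F M ≤ N ↔ ∀ h ∈ F, ∀ m : M, T.one h • m ∈ N := by
  refine iSup₂_le_iff.trans (forall₂_congr fun h _ => Submodule.span_le.trans ?_)
  exact Set.range_subset_iff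

/-- The quotient by `upSub F` is killed by the idempotents in `F`. -/
lemma eU_smul_quotient_upSub {F : Finset I} {M : Type v} [AddCommGroup M] [Module E.Uni M]
    {d : J} (hd : T.cls d ∈ F) (m : M ⧸ T.upSub F M) : E.eU d • m = 0 := by
  obtain ⟨m, rfl⟩ := Submodule.mkQ_surjective _ m
  rw [← map_smul]
  refine (Submodule.Quotient.mk_eq_zero _).2 (T.layerSub_le_upSub hd M ?_)
  rw [← T.one_smul_eU_smul rfl]
  exact T.one_smul_mem_layerSub _ _

section

variable {T} {Λ : I → Type w} {S : ∀ a, Λ a → ModuleCat.{u} (T.Abar a)}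
  {Λ' : Type w'} [PartialOrder Λ'] {ρ : (Σ a, Λ a) → Λ'} {ε : Λ' → Sgn} {p : Σ a, Λ a}

lemma map_upSub (M : Type v) [AddCommGroup M] [Module E.Uni M] {F : Finset I} {g : I}
    (hg : g ∈ F) {N : Submodule E.Uni M} (hN : ∀ h ∈ F, h ≠ g → T.layerSub h M ≤ N) :
    (T.upSub F M).map N.mkQ = T.layerSub g (M ⧸ N) := by
  refine le_antisymm (Submodule.map_le_iff_le_comap.2 (T.upSub_le_iff.2 fun h hh m => ?_))
    (Submodule.span_le.2 ?_)
  · change N.mkQ (T.one h • m) ∈ T.layerSub g (M ⧸ N)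
    by_cases hgh : h = g
    · subst hgh
      rw [map_smul]
      exact T.one_smul_mem_layerSub _ _
    · have h3 : N.mkQ (T.one h • m) = 0 := (Submodule.Quotient.mk_eq_zero N).2
        (hN h hh hgh (T.one_smul_mem_layerSub h m))
      rw [h3]
      exact zero_mem _
  · rintro _ ⟨m, rfl⟩
    obtain ⟨m, rfl⟩ := N.mkQ_surjective m
    exact ⟨T.one g • m, T.layerSub_le_upSub hg _ (T.one_smul_mem_layerSub g m),
      map_smul N.mkQ _ _⟩

/-- A submodule generated by weight spaces has a filtration if the layer at `g` and the submodule
generated by the other weight spaces have one. -/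
lemma hasFiniteFlag_upSub_step {P : E.Lfdmod → Prop} (M : E.Lfdmod) {F F' : Finset I} {g : I}
    (hg : g ∈ F) (hF' : F' ⊆ F) (hF : ∀ h ∈ F, h ≠ g → h ∈ F')
    (h₁ : HasFiniteFlag P (M.sub (T.upSub F' M.obj)))
    (h₂ : HasFiniteFlag P ((M.quo (T.upSub F' M.obj)).sub
      (T.layerSub g (M.obj ⧸ T.upSub F' M.obj)))) :
    HasFiniteFlag P (M.sub (T.upSub F M.obj)) := by
  refine HasFiniteFlag.of_le M (T.upSub_le_iff.2 fun h hh m =>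
    T.layerSub_le_upSub (hF' hh) _ (T.one_smul_mem_layerSub h m)) h₁ ?_
  rw [map_upSub _ hg fun h hh hne => T.layerSub_le_upSub (hF h hh hne) _]
  exact h₂

/-- The projection `A f → A_{≤ g}`. -/
def spanMk (f : E.Uni) (g : I) : spanMod f →ₗ[E.Uni] T.quotLE g :=
  (Submodule.mkQ (T.idealNotLE g).asIdeal).comp (spanVal f)

lemma upSub_le_ker_spanMk (f : E.Uni) {F : Finset I} {g : I} (hF : ∀ h ∈ F, ¬ h ≤ g) :
    T.upSub F (spanMod f) ≤ LinearMap.ker (spanMk (T := T) f g) :=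
  T.upSub_le_iff.2 fun h hh m => by
    have h1 : spanMk (T := T) f g (T.one h • m) = T.qmk g (T.one h * spanVal f m) :=
      congrArg (T.qmk g) (map_smul (spanVal f) _ m)
    exact h1.trans (T.qmk_eq_zero_iff.2 (TwoSidedIdeal.mul_mem_right _ _ _
      (TwoSidedIdeal.subset_span ⟨h, hF h hh, rfl⟩)))

/-- The layer at a minimal element of an upper set is `j_!` of a projective module. -/
lemma exists_std_iso_layerSub_span {f : E.Uni} (hf : f * T.one a = f)
    (hf' : IsIdempotentElem f) {F : Finset I} {g : I} (hF : ∀ h ∈ F, ¬ h ≤ g)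
    (hup : ∀ h, g < h → h ∈ F) :
    ∃ (W : ModuleCat.{u} (T.Abar g)) (hW : Module.Finite (T.Abar g) W),
      Module.Projective (T.Abar g) W ∧
        Nonempty (std W hW ≅ ((T.spanObj hf).quo (T.upSub F (T.spanObj hf).obj)).sub
          (T.layerSub g ((T.spanObj hf).obj ⧸ T.upSub F (T.spanObj hf).obj))) := by
  refine T.exists_std_iso_layerSub ((T.spanObj hf).quo (T.upSub F (T.spanObj hf).obj))
    (fun d hd m => T.eU_smul_quotient_upSub (hup _ hd) m) (f := f)
    (v := (T.upSub F (T.spanObj hf).obj).mkQ (T.spanGen hf)) (fun m => ?_) ?_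
    (Submodule.liftQ _ (spanMk f g) (upSub_le_ker_spanMk f hF)) (Submodule.liftQ_apply _ _ _)
  · obtain ⟨m, rfl⟩ := Submodule.mkQ_surjective _ m
    obtain ⟨x, rfl⟩ := T.exists_smul_spanGen hf m
    exact ⟨x, (map_smul (Submodule.mkQ _) x _).symm⟩
  · rw [← map_smul]
    exact congrArg _ (spanVal_injective f hf')

/-- The part of `A f` generated by its weight spaces in a finite upper set has a flag: by
induction, the weight spaces at a minimal element generate a standardized projective module,
modulo the part above. -/
lemma hasFiniteFlag_upSub (hS : ∀ a, IsFullSetOfSimples (S a))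
    (hρ : ∀ l : Λ', ∃ (a : I) (c : T.Abar a), IsLabel S ρ l a c)
    {f : E.Uni} (hf : f * T.one a = f) (hf' : IsIdempotentElem f) (n : ℕ) (F : Finset I)
    (hn : F.card = n) (hF : ∀ h ∈ F, ∀ l : Λ h, ρ p ≤ ρ ⟨h, l⟩)
    (hup : ∀ h ∈ F, ∀ h', h < h' → h' ∈ F) :
    HasFiniteFlag (IsSection hS ρ ε p)
      ((T.spanObj hf).sub (T.upSub F (T.spanObj hf).obj)) := by
  classical
  induction n generalizing F with
  | zero =>
    obtain rfl := Finset.card_eq_zero.1 hn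
    refine .zero _ (Lfdmod.isZero_iff.2 fun z => Subtype.ext ?_)
    have h1 : T.upSub ∅ (T.spanObj hf).obj ≤ ⊥ := T.upSub_le_iff.2 fun h hh => by simp at hh
    exact (Submodule.mem_bot E.Uni).1 (h1 z.2)
  | succ n ih =>
    obtain ⟨g, hg⟩ := F.exists_minimal (Finset.card_pos.1 (by rw [hn]; exact n.succ_pos))
    have h1 := ih (F.erase g) (by rw [Finset.card_erase_of_mem hg.1, hn, Nat.add_sub_cancel])
      (fun h hh => hF h (Finset.mem_of_mem_erase hh)) (fun h hh h' hlt =>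
        Finset.mem_erase.2 ⟨by
          rintro rfl
          exact hg.not_lt (Finset.mem_of_mem_erase hh) hlt,
          hup h (Finset.mem_of_mem_erase hh) h' hlt⟩)
    obtain ⟨W, hW, hWp, ⟨e⟩⟩ := exists_std_iso_layerSub_span hf hf' (F := F.erase g) (g := g)
      (fun h hh hle => hg.not_lt (Finset.mem_of_mem_erase hh)
        (lt_of_le_of_ne hle (Finset.ne_of_mem_erase hh)))
      (fun h hlt => Finset.mem_erase.2 ⟨hlt.ne', hup g hg.1 h hlt⟩)
    exact hasFiniteFlag_upSub_step (T.spanObj hf) hg.1 (Finset.erase_subset g F)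
      (fun h hh hne => Finset.mem_erase.2 ⟨hne, hh⟩) h1
      ((hasFiniteFlag_std_of_projective hS hρ (hF g hg.1) W hW hWp).of_iso e)

/-- The map `A f → j_! (Ā_a h)`, where `h` is the image of `f`. -/
def spanToStd (f : E.Uni) (h : T.Abar a) :
    spanMod f →ₗ[E.Uni] T.standardize a (ModuleCat.of (T.Abar a) (Ideal.span {h})) where
  toFun m := T.qmk a (spanVal f m) • (Induced.ten (T.oneBar_idem a) 1
    (⟨h, Ideal.mem_span_singleton_self h⟩ : Ideal.span {h}))
  map_add' m n := by
    rw [map_add, map_add]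
    exact add_smul (T.qmk a (spanVal f m)) (T.qmk a (spanVal f n)) (Induced.ten (T.oneBar_idem a) 1
      (⟨h, Ideal.mem_span_singleton_self h⟩ : Ideal.span {h}))
  map_smul' x m := by
    rw [map_smul, smul_eq_mul, map_mul]
    exact mul_smul (T.qmk a x) (T.qmk a (spanVal f m)) (Induced.ten (T.oneBar_idem a) 1
      (⟨h, Ideal.mem_span_singleton_self h⟩ : Ideal.span {h}))

end

end WeaklyTriangular

end ProjectiveFlags

/-! ### Existence of projective flags -/

section HasProjectiveFlags

open CornerRing LocallyUnital

variable {k A J : Type u} [Field k] [NonUnitalRing A] [Module k A]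
  [IsScalarTower k A A] [SMulCommClass k A A]

namespace WeaklyTriangular

variable {E : LocallyUnital k A J} {I : Type t} [PartialOrder I] {T : WeaklyTriangular E I}
  {a : I}

section SpanToStd

variable {f : E.Uni} {h : T.Abar a}

lemma spanToStd_surjective (hf : T.qmk a f = h.1) (hh : IsIdempotentElem h) :
    Function.Surjective (spanToStd (T := T) f h) := by
  rw [← LinearMap.range_eq_top, eq_top_iff]
  intro z _
  have key : ∀ z : Induced (T.oneBar_idem a) (Ideal.span {h}),
      (show T.standardize a (ModuleCat.of (T.Abar a) (Ideal.span {h})) from z) ∈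
        LinearMap.range (spanToStd (T := T) f h) := by
    intro z
    induction z using Induced.induction with
    | zero => exact zero_mem _
    | add z w hz hw => exact add_mem hz hw
    | ten x y =>
      obtain ⟨r, hr⟩ := Ideal.mem_span_singleton'.1 y.2
      obtain ⟨u, hu⟩ := T.qmk_surjective a (x * r.1)
      refine ⟨(⟨u * f, Ideal.mul_mem_left _ u (Ideal.mem_span_singleton_self f)⟩ :
        Ideal.span {f}), ?_⟩
      change T.qmk a (u * f) • Induced.ten (T.oneBar_idem a) 1 _ = Induced.ten (T.oneBar_idem a) x y
      rw [map_mul, hu, hf, Induced.smul_ten, mul_one, mul_assoc]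
      refine (Induced.ten_mul_corner (T.oneBar_idem a) x (r * h) _).trans ?_
      congr 1
      refine Subtype.ext ?_
      change r * h * h = y.1
      rw [mul_assoc, hh.eq, hr]
  exact key z

lemma spanToStd_eq_zero_iff (hf : T.qmk a f = h.1) (hf' : IsIdempotentElem f)
    (hfa : T.one a * f = f) {F : Finset I} (hF : ∀ g, g ∈ F ↔ a < g) (m : spanMod f) :
    spanToStd (T := T) f h m = 0 ↔ m ∈ T.upSub F (spanMod f) := by
  constructor
  · intro hm
    let gen : spanMod f := (⟨f, Ideal.mem_span_singleton_self f⟩ : Ideal.span {f})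
    have hgen : ∀ m : spanMod f, spanVal f m • gen = m := fun m => by
      obtain ⟨r, hr⟩ := Ideal.mem_span_singleton'.1 (show Ideal.span {f} from m).2
      refine spanVal_injective f ?_
      rw [map_smul]
      change (show Ideal.span {f} from m).1 * f = (show Ideal.span {f} from m).1
      rw [← hr, mul_assoc, hf'.eq]
    let ι : Ideal.span {h} →ₗ[T.Abar a] cornerPart (T.oneBar_idem a) (T.quotLE a) :=
      { toFun := fun y => ⟨y.1.1, e_mul (T.oneBar_idem a) y.1⟩
        map_add' := fun _ _ => rfl
        map_smul' := fun _ _ => rfl }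
    have h1 := congrArg (Induced.lift (T.oneBar_idem a) ι) (show T.qmk a (spanVal f m) •
      Induced.ten (T.oneBar_idem a) 1 (⟨h, Ideal.mem_span_singleton_self h⟩ : Ideal.span {h}) = 0
      from hm)
    rw [map_zero, map_smul, Induced.lift_ten, one_smul] at h1
    have h2 : T.qmk a (spanVal f m) = 0 := by
      have h3 : spanVal f m * f = spanVal f m := by
        conv_rhs => rw [← hgen m, map_smul]
        rfl
      rw [← h3, map_mul, hf]
      exact h1
    let Q := spanMod f ⧸ T.upSub F (spanMod f)
    have hk : T.Killed a (T.layerSub a Q) :=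
      T.killed_layerSub fun d hd m => T.eU_smul_quotient_upSub ((hF _).2 hd) m
    have h4 : T.one a • (T.upSub F (spanMod f)).mkQ gen = (T.upSub F (spanMod f)).mkQ gen := by
      rw [← map_smul]
      exact congrArg _ (spanVal_injective f hfa)
    have h5 := congrArg Subtype.val (hk _ (T.qmk_eq_zero_iff.1 h2)
      ⟨_, T.one_smul_mem_layerSub a ((T.upSub F (spanMod f)).mkQ gen)⟩)
    have h6 : spanVal f m • T.one a • (T.upSub F (spanMod f)).mkQ gen = 0 := h5
    rw [h4, ← map_smul, hgen] at h6
    exact (Submodule.Quotient.mk_eq_zero _).1 h6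
  · intro hm
    have hle : T.upSub F (spanMod f) ≤ LinearMap.ker (spanToStd (T := T) f h) :=
      T.upSub_le_iff.2 fun g hg m => by
        change spanToStd (T := T) f h (T.one g • m) = 0
        rw [map_smul]
        exact T.killed_standardize a _ _
          (TwoSidedIdeal.subset_span ⟨g, ((hF g).1 hg).not_ge, rfl⟩) _
    exact hle hm

end SpanToStd

variable {Λ : I → Type w} {S : ∀ a, Λ a → ModuleCat.{u} (T.Abar a)}
  {Λ' : Type w'} [PartialOrder Λ'] {ρ : (Σ a, Λ a) → Λ'}

/-- If `j_! (Ā_a h)`, modulo a quotient `Z`, has a flag, so does `A f`, modulo `Z`. -/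
lemma exists_shortExact_spanObj {P : E.Lfdmod → Prop} {f : E.Uni} {h : T.Abar a}
    (hf : T.qmk a f = h.1) (hh : IsIdempotentElem h) (hf' : IsIdempotentElem f)
    (hfa : T.one a * f = f) (hfa' : f * T.one a = f) {F : Finset I} (hF : ∀ g, g ∈ F ↔ a < g)
    (hup : HasFiniteFlag P ((T.spanObj hfa').sub (T.upSub F (T.spanObj hfa').obj)))
    {Z : E.Lfdmod}
    (q : T.standardize a (ModuleCat.of (T.Abar a) (Ideal.span {h})) →ₗ[E.Uni] Z.obj)
    (hq : Function.Surjective q) {K : E.Lfdmod} (hK : HasFiniteFlag P K)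
    (i : K.obj →ₗ[E.Uni] T.standardize a (ModuleCat.of (T.Abar a) (Ideal.span {h})))
    (hi : Function.Injective i) (hiq : ∀ z, q z = 0 ↔ ∃ y, i y = z) :
    ∃ S : ShortComplex E.Lfdmod, S.ShortExact ∧ Projective S.X₂ ∧ S.X₃ = Z ∧
      HasFiniteFlag P S.X₁ := by
  let θ : (T.spanObj hfa').obj →ₗ[E.Uni] _ := spanToStd (T := T) f h
  have hθ : Function.Surjective θ := spanToStd_surjective hf hh
  have hθ0 : ∀ m, θ m = 0 ↔ m ∈ T.upSub F (T.spanObj hfa').obj :=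
    spanToStd_eq_zero_iff hf hf' hfa hF
  let g : (T.spanObj hfa').obj →ₗ[E.Uni] Z.obj := q.comp θ
  let N := LinearMap.ker g
  refine ⟨ShortComplex.mk ((T.spanObj hfa').subι N) (Lfdmod.ofLin g)
    (Lfdmod.hom_ext_lin fun y => y.2), Lfdmod.shortExact_of_lin _ N.injective_subtype
    (hq.comp hθ) fun x hx => ⟨⟨x, hx⟩, rfl⟩, T.projective_spanObj hfa' hf', rfl, ?_⟩
  let e := LinearEquiv.ofInjective i hi
  let r : N →ₗ[E.Uni] K.obj := e.symm.toLinearMap.comp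
    (LinearMap.codRestrict (LinearMap.range i) (θ.comp N.subtype) fun n => (hiq _).1 n.2)
  have hr : ∀ n : N, i (r n) = θ n.1 := fun n =>
    congrArg Subtype.val (e.apply_symm_apply ⟨θ n.1, (hiq _).1 n.2⟩)
  have hle : T.upSub F (T.spanObj hfa').obj ≤ N := fun m hm => by
    change q (θ m) = 0
    rw [(hθ0 m).2 hm, map_zero]
  refine HasFiniteFlag.of_exact (Y := (T.spanObj hfa').sub N) (Submodule.inclusion hle) r
    (Submodule.inclusion_injective hle) (fun y => ?_) (fun n => ?_) hup hK
  · obtain ⟨m, hm⟩ := hθ (i y)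
    refine ⟨⟨m, ?_⟩, hi ((hr _).trans hm)⟩
    change q (θ m) = 0
    rw [hm]
    exact (hiq _).2 ⟨y, rfl⟩
  · have h1 : r n = 0 ↔ θ n.1 = 0 := by
      rw [← hr, map_eq_zero_iff i hi]
    refine (h1.trans (hθ0 n.1)).trans ⟨fun hn => ⟨⟨n.1, hn⟩, rfl⟩, ?_⟩
    rintro ⟨x, rfl⟩
    exact x.2

/-- The projective objects `A f`, where `f` lifts a primitive idempotent of `Ā_a`, have the
flags required in a fully stratified category. -/
theorem hasProjectiveFlags (hS : ∀ a, IsFullSetOfSimples (S a))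
    (hρ : ∀ l : Λ', ∃ (a : I) (c : T.Abar a), IsLabel S ρ l a c) (ε : Λ' → Sgn) :
    HasProjectiveFlags (simples hS) ρ ε := by
  rintro ⟨a, l⟩
  have hsimple := simple_of_fullSet (hS a) l
  have := IsSimpleModule.nontrivial (T.Abar a) (S a l)
  obtain ⟨s, hs⟩ := exists_ne (0 : S a l)
  obtain ⟨h, hh⟩ := exists_isCoverIdem (R := T.Abar a) k hs
  obtain ⟨f, hf, hfa, hfa', hfh⟩ := T.exists_idempotent_lift hh.idem
  have hπ := hh.isProjCover
  set π : ModuleCat.of (T.Abar a) (Ideal.span {h}) ⟶ S a l := ModuleCat.ofHom _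
  obtain ⟨c, hc⟩ := exists_isLabel hρ l
  have hfin : {g | a < g}.Finite := (T.upper_finite a).subset fun g (hg : a < g) => hg.le
  have hF : ∀ g, g ∈ hfin.toFinset ↔ a < g := fun g => hfin.mem_toFinset
  have hup := hasFiniteFlag_upSub (ε := ε) (p := ⟨a, l⟩) hS hρ hfa hf _ hfin.toFinset rfl
    (fun g hg μ => by
      obtain ⟨d, hd⟩ := exists_isLabel hρ μ
      exact (hd.le_iff _).2 (Or.inl ((hF g).1 hg)))
    (fun g hg g' hlt => (hF g').2 (((hF g).1 hg).trans hlt))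
  cases hε : ε (ρ ⟨a, l⟩) with
  | plus =>
    obtain ⟨S', h1, h2, h3, h4⟩ := exists_shortExact_spanObj hfh hh.idem hf hfa' hfa hF hup
      (Z := std _ hπ.finite) LinearMap.id Function.surjective_id
      (HasFiniteFlag.zero ((std _ hπ.finite).sub ⊥) (Lfdmod.isZero_iff.2 fun x =>
        Subtype.ext ((Submodule.mem_bot _).1 x.2)))
      (Submodule.subtype ⊥) (Submodule.injective_subtype _)
      (fun z => ⟨fun hz => ⟨0, hz.symm⟩, by
        rintro ⟨y, rfl⟩
        exact (Submodule.mem_bot E.Uni).1 y.2⟩)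
    refine ⟨S', h1, h2, ?_, h4⟩
    simp only [IsSignedStandard, hε, h3]
    exact hc.isStandard hS hπ hπ.finite
  | minus =>
    let K := LinearMap.ker π.hom
    have hPfin : Module.Finite (T.Abar a) (Ideal.span {h}) := hπ.finite
    have : IsArtinianRing (T.Abar a) := IsArtinianRing.of_finite k (T.Abar a)
    have hKfin : Module.Finite (T.Abar a) K := inferInstance
    have hex : ∀ v, π.hom v = 0 ↔ ∃ x, K.subtype x = v := fun v =>
      ⟨fun hv => ⟨⟨v, hv⟩, rfl⟩, by rintro ⟨x, rfl⟩; exact x.2⟩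
    have hK := hasFiniteFlag_std_of_minus (p := ⟨a, l⟩) hS hc hε le_rfl
      (ModuleCat.of (T.Abar a) K) hKfin
      (fun v => Subtype.ext (hπ.smul_eq hc.center hc.idem hc.smul_eq v.1))
    obtain ⟨S', h1, h2, h3, h4⟩ := exists_shortExact_spanObj hfh hh.idem hf hfa' hfa hF hup
      (Z := std _ (finite_simple hS l)) (T.standardizeMap π.hom)
      (standardizeMap_surjective _ hπ.surjective) hK
      (T.standardizeMap (V := ModuleCat.of (T.Abar a) K) K.subtype)
      (standardizeMap_injective _ K.injective_subtype)
      (standardizeMap_eq_zero_iff (V' := ModuleCat.of (T.Abar a) K) _ _ hπ.surjective hex)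
    refine ⟨S', h1, h2, ?_, h4⟩
    simp only [IsSignedStandard, hε, h3]
    exact hc.isProperStandard hS _

end WeaklyTriangular

end HasProjectiveFlags

/-! ### Semisimple strata -/

section SemisimpleBlocks

variable {R : Type u} [Ring R]

/-- A decomposition of a ring into two-sided ideals is given by a central idempotent. -/
lemma exists_central_idempotent {I I' : Ideal R} (hI : I.IsTwoSided) (hI' : I'.IsTwoSided)
    (h : IsCompl I I') : ∃ e ∈ Set.center R, IsIdempotentElem e ∧ (∀ x ∈ I, e * x = x) ∧
      ∀ x ∈ I', e * x = 0 := by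
  have h0 : ∀ x, x ∈ I → x ∈ I' → x = 0 := fun x hx hx' =>
    (Submodule.mem_bot R).1 (h.disjoint.le_bot ⟨hx, hx'⟩)
  obtain ⟨e, he, f, hf, hef⟩ := Submodule.mem_sup.1
    (h.codisjoint.eq_top ▸ Submodule.mem_top : (1 : R) ∈ I ⊔ I')
  have hf' : f = 1 - e := by rw [← hef, add_sub_cancel_left]
  have h1 : ∀ x ∈ I, e * x = x := fun x hx => by
    have h2 : f * x = 0 := h0 _ (I.mul_mem_left f hx) (I'.mul_mem_right x hf)
    rwa [hf', sub_mul, one_mul, sub_eq_zero, eq_comm] at h2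
  refine ⟨e, ?_, h1 e he, h1, fun x hx => h0 _ (I.mul_mem_right x he) (I'.mul_mem_left e hx)⟩
  refine Semigroup.mem_center_iff.2 fun x => ?_
  have h2 : x * e - e * x = f * x - x * f := by rw [hf']; noncomm_ring
  refine sub_eq_zero.1 (h0 _ (sub_mem (I.mul_mem_left x he) (I.mul_mem_right x he)) ?_)
  rw [h2]
  exact sub_mem (I'.mul_mem_right x hf) (I'.mul_mem_left x hf)

/-- Over a semisimple ring, a block contains only one simple module. -/
lemma Block.nonempty_linearEquiv [IsSemisimpleRing R] (c : Block R) (M N : Type u) [AddCommGroup M]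
    [Module R M] [IsSimpleModule R M] [AddCommGroup N] [Module R N] [IsSimpleModule R N]
    (hM : ∀ m : M, c.1 • m = m) (hN : ∀ n : N, c.1 • n = n) : Nonempty (N ≃ₗ[R] M) := by
  by_contra hne
  obtain ⟨L, ⟨φ⟩⟩ := IsSemisimpleRing.exists_linearEquiv_ideal_of_isSimpleModule R M
  obtain ⟨L', ⟨φ'⟩⟩ := IsSemisimpleRing.exists_linearEquiv_ideal_of_isSimpleModule R N
  have hL := IsSimpleModule.congr φ.symm
  have hL' := IsSimpleModule.congr φ'.symm
  let I : Ideal R := isotypicComponent R R L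
  have hImem : I ∈ isotypicComponents R R := ⟨L, hL, rfl⟩
  let I' : Ideal R := sSup (isotypicComponents R R \ {I})
  have hI : I.IsTwoSided :=
    isFullyInvariant_iff_isTwoSided.1 (Submodule.IsFullyInvariant.isotypicComponent R R L)
  have hI' : I'.IsTwoSided := isFullyInvariant_iff_isTwoSided.1
    (isFullyInvariant_iff_sSup_isotypicComponents.2 ⟨_, Set.sdiff_subset, rfl⟩)
  have hcompl : IsCompl I I' := by
    refine ⟨sSupIndep_isotypicComponents R R hImem, codisjoint_iff.2 ?_⟩
    rw [eq_top_iff, ← sSup_isotypicComponents R R]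
    refine sSup_le fun m hm => ?_
    by_cases h : m = I
    · exact h ▸ le_sup_left
    · exact (le_sSup (Set.mem_sdiff_of_mem hm h)).trans le_sup_right
  obtain ⟨e, he, hei, he1, he0⟩ := exists_central_idempotent hI hI' hcompl
  have hLI : L ≤ I := Submodule.le_isotypicComponent L
  have hLI' : L' ≤ I' := by
    have hmem : isotypicComponent R R L' ∈ isotypicComponents R R := ⟨L', hL', rfl⟩
    refine (Submodule.le_isotypicComponent L').trans (le_sSup (Set.mem_sdiff_of_mem hmem fun h =>
      hne ?_))
    have h1 : L' ≤ isotypicComponent R R L :=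
      (Submodule.le_isotypicComponent L').trans (le_of_eq h)
    obtain ⟨ψ⟩ := isIsotypicOfType_submodule_iff.1 (.isotypicComponent R R L) L' h1
    exact ⟨φ'.trans (ψ.trans φ.symm)⟩
  have heM : ∀ m : M, e • m = m := fun m => φ.injective (by
    rw [map_smul]
    exact Subtype.ext (he1 _ (hLI (φ m).2)))
  have heN : ∀ n : N, e • n = 0 := fun n => φ'.injective (by
    rw [map_smul, map_zero]
    exact Subtype.ext (he0 _ (hLI' (φ' n).2)))
  have := IsSimpleModule.nontrivial R M
  have := IsSimpleModule.nontrivial R N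
  obtain ⟨m, hm⟩ := exists_ne (0 : M)
  obtain ⟨n, hn⟩ := exists_ne (0 : N)
  have hcomm : c.1 * e = e * c.1 := (Set.mem_center_iff.1 c.center).comm e
  rcases c.2.2.2.2 (c.1 * e) (Set.mul_mem_center c.center he) (c.idem.mul_of_commute hcomm hei)
    (by rw [← mul_assoc, c.idem.eq]) with h | h
  · refine hm ?_
    rw [← hM m, ← heM m, ← mul_smul, h, zero_smul]
  · refine hn ?_
    rw [← hN n, ← h, mul_smul, heN, smul_zero]

end SemisimpleBlocks

section HomFunctor

variable {R : Type u} [Ring R] (S : ModuleCat.{u} R) {P : ObjectProperty (ModuleCat.{u} R)}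

/-- Coordinates on a multiple of `S`. -/
lemma exists_sum_comp (hP : ∀ V, P V ↔ ∃ n : ℕ, Nonempty (V ≃ₗ[R] (Fin n → S)))
    {V : ModuleCat.{u} R} (hV : P V) : ∃ (n : ℕ) (i : Fin n → (S →ₗ[R] V))
    (p : Fin n → (V →ₗ[R] S)), ∀ v, ∑ j, i j (p j v) = v := by
  classical
  obtain ⟨n, ⟨e⟩⟩ := (hP V).1 hV
  refine ⟨n, fun j => e.symm.toLinearMap.comp (LinearMap.single R (fun _ => S) j),
    fun j => (LinearMap.proj j).comp e.toLinearMap, fun v => e.injective ?_⟩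
  rw [map_sum]
  refine funext fun j => ?_
  simp [Pi.single_apply]

variable (k : Type u) [Field k] [Algebra k R] [Module.Finite k R] [IsSimpleModule R S]

lemma finite_of_simple : Module.Finite k S := by
  have := WeaklyTriangular.finite_of_isSimpleModule (R := R) S
  exact Module.Finite.trans R S

variable [IsAlgClosed k] (hP : ∀ V, P V ↔ ∃ n : ℕ, Nonempty (V ≃ₗ[R] (Fin n → S)))

lemma exists_smul_eq_of_end (g : S →ₗ[R] S) : ∃ l : k, ∀ s, g s = l • s := by
  have := finite_of_simple S k
  obtain ⟨l, hl⟩ := (IsSimpleModule.algebraMap_end_bijective_of_isAlgClosed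
    (A := R) (V := S) k).2 g
  exact ⟨l, fun s => (LinearMap.congr_fun hl s).symm⟩

/-- The functor `V ↦ Hom(S, V)`. -/
def homFunctor : P.FullSubcategory ⥤ FGModuleCat.{u} k where
  obj V := ⟨ModuleCat.of k (S →ₗ[R] V.obj), by
    obtain ⟨n, ⟨e⟩⟩ := (hP V.obj).1 V.property
    have := finite_of_simple S k
    have : Module.Finite k V.obj := Module.Finite.equiv (e.restrictScalars k).symm
    exact Module.Finite.of_injective (LinearMap.restrictScalarsₗ k R S V.obj k)
      (LinearMap.restrictScalars_injective k)⟩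
  map {V W} f := ObjectProperty.homMk (ModuleCat.ofHom
    { toFun := fun g => f.hom.hom.comp g
      map_add' := fun g h => LinearMap.comp_add g h f.hom.hom
      map_smul' := fun l g => LinearMap.ext fun s =>
        map_smul (f.hom.hom.restrictScalars k) l (g s) })

instance : (homFunctor S k hP).Additive where
  map_add := rfl

instance : (homFunctor S k hP).Linear k where
  map_smul _ _ := rfl

instance : (homFunctor S k hP).Faithful where
  map_injective {V W} f g h := by
    obtain ⟨n, i, p, hip⟩ := exists_sum_comp S hP V.property
    refine ObjectProperty.hom_ext _ (ModuleCat.hom_ext (LinearMap.ext fun v => ?_))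
    have h1 : ∀ j s, f.hom.hom (i j s) = g.hom.hom (i j s) := fun j s =>
      LinearMap.congr_fun (congrArg (fun φ :
          (homFunctor S k hP).obj V ⟶ (homFunctor S k hP).obj W =>
        (show S →ₗ[R] W.obj from φ.hom.hom (i j))) h) s
    rw [← hip v, map_sum, map_sum]
    exact Finset.sum_congr rfl fun j _ => h1 j _

instance : (homFunctor S k hP).Full where
  map_surjective {V W} φ := by
    obtain ⟨n, i, p, hip⟩ := exists_sum_comp S hP V.property
    let φ' : (S →ₗ[R] V.obj) →ₗ[k] (S →ₗ[R] W.obj) := φ.hom.hom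
    refine ⟨ObjectProperty.homMk (ModuleCat.ofHom (∑ j, (φ' (i j)).comp (p j))), ?_⟩
    refine ObjectProperty.hom_ext _ (ModuleCat.hom_ext (LinearMap.ext fun g => ?_))
    change (∑ j, (φ' (i j)).comp (p j)).comp (show S →ₗ[R] V.obj from g) = φ' g
    -- `p j ∘ g` is a scalar by Schur's lemma.
    choose l hl using fun j => exists_smul_eq_of_end S k ((p j).comp (show S →ₗ[R] V.obj from g))
    have hg : (show S →ₗ[R] V.obj from g) = ∑ j, l j • i j := LinearMap.ext fun s => by
      rw [← hip ((show S →ₗ[R] V.obj from g) s), LinearMap.sum_apply]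
      refine Finset.sum_congr rfl fun j _ => ?_
      exact (congrArg (i j) (hl j s)).trans (map_smul ((i j).restrictScalars k) (l j) s)
    have hg' : φ' g = ∑ j, l j • φ' (i j) := by
      refine (congrArg φ' hg).trans ?_
      rw [map_sum]
      exact Finset.sum_congr rfl fun j _ => map_smul φ' _ _
    rw [hg']
    refine LinearMap.ext fun s => ?_
    rw [LinearMap.comp_apply, LinearMap.sum_apply, LinearMap.sum_apply]
    refine Finset.sum_congr rfl fun j _ => ?_
    exact (congrArg (φ' (i j)) (hl j s)).trans (map_smul ((φ' (i j)).restrictScalars k) (l j) s)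

instance : (homFunctor S k hP).EssSurj where
  mem_essImage W := by
    have hW : Module.Finite k W.obj := W.property
    let n := Module.finrank k W.obj
    let V : P.FullSubcategory :=
      ⟨ModuleCat.of R (Fin n → S), (hP _).2 ⟨n, ⟨LinearEquiv.refl R (Fin n → S)⟩⟩⟩
    have hfin := finite_of_simple S k
    let e₁ : k ≃ₗ[k] (S →ₗ[R] S) := LinearEquiv.ofBijective
      (Algebra.linearMap k (Module.End R S))
      (IsSimpleModule.algebraMap_end_bijective_of_isAlgClosed (A := R) (V := S) k)
    let e₂ : (S →ₗ[R] (Fin n → S)) ≃ₗ[k] W.obj :=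
      ((LinearEquiv.linearMapPi k (R := R) (M₂ := S) (φ := fun _ : Fin n => S)).symm.trans
        (LinearEquiv.piCongrRight fun _ => e₁.symm)).trans
        (Module.finBasis k W.obj).equivFun.symm
    exact ⟨V, ⟨ObjectProperty.isoMk _ (LinearEquiv.toModuleIso e₂)⟩⟩

instance : (homFunctor S k hP).IsEquivalence where

end HomFunctor

/-! ### Strata of semisimple blocks -/

section SemisimpleStrata

open CornerRing LocallyUnital

variable {k A J : Type u} [Field k] [NonUnitalRing A] [Module k A]
  [IsScalarTower k A A] [SMulCommClass k A A]

namespace WeaklyTriangular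

variable {E : LocallyUnital k A J} {I : Type t} [PartialOrder I] {T : WeaklyTriangular E I}
  {a : I}

instance (c : T.Abar a) : (T.trunc a c).Additive where
  map_add := rfl

instance (c : T.Abar a) : (T.trunc a c).Linear k where
  map_smul {X Y} f r := by
    refine ObjectProperty.hom_ext _ (ModuleCat.hom_ext (LinearMap.ext fun x => Subtype.ext ?_))
    exact (Tr.coe_smul_corner Y r (cornerMap (T.oneBar_idem a) (Tr.linQuot f) x)).symm

/-- Over a semisimple algebra, the modules in a block are the multiples of its simple module. -/
lemma fdProp_iff_of_isSemisimpleRing [IsSemisimpleRing (T.Abar a)] (c : Block (T.Abar a))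
    (S : ModuleCat.{u} (T.Abar a)) [IsSimpleModule (T.Abar a) S] (hS : ∀ s : S, c.1 • s = s)
    (V : ModuleCat.{u} (T.Abar a)) :
    T.fdProp a c.1 V ↔ ∃ n : ℕ, Nonempty (V ≃ₗ[T.Abar a] (Fin n → S)) := by
  have := finite_of_isSimpleModule (R := T.Abar a) S
  constructor
  · rintro ⟨hfin, hV⟩
    have h : IsIsotypicOfType (T.Abar a) V S := fun m hm =>
      c.nonempty_linearEquiv S m hS fun v => Subtype.ext (hV v.1)
    exact h.linearEquiv_fun
  · rintro ⟨n, ⟨e⟩⟩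
    refine ⟨Module.Finite.equiv e.symm, fun v => e.injective ?_⟩
    rw [map_smul]
    exact funext fun i => hS (e v i)

/-- The strata attached to the blocks of semisimple algebras are simple. -/
lemma IsStratum.stratumEquivFdmod_of_isSemisimpleRing [IsAlgClosed k] {B : Type w} {Λ : Type w'}
    [PartialOrder Λ] {L : B → E.Lfdmod} {ρ : B → Λ} {l : Λ} [IsSemisimpleRing (T.Abar a)]
    (c : Block (T.Abar a)) (H : T.IsStratum L ρ l a c.1) (S : ModuleCat.{u} (T.Abar a))
    [IsSimpleModule (T.Abar a) S] (hS : ∀ s : S, c.1 • s = s) : StratumEquivFdmod k L ρ l k := by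
  let F := homFunctor S k (fdProp_iff_of_isSemisimpleRing c S hS)
  refine H.stratumEquivFdmod F.asEquivalence ?_ ?_
  · exact inferInstanceAs (T.trunc a c.1 ⋙ F ⋙ (ModuleCat.isFG.{u} k).ι).Additive
  · exact inferInstanceAs ((T.trunc a c.1 ⋙ F ⋙ (ModuleCat.isFG.{u} k).ι).Linear k)

end WeaklyTriangular

end SemisimpleStrata

/-! ### The two stratifications of `A`-lfdmod -/

section Stratifications

open LocallyUnital

namespace WeaklyTriangular

variable {k A J : Type u} [Field k] [NonUnitalRing A] [Module k A]
  [IsScalarTower k A A] [SMulCommClass k A A] {E : LocallyUnital k A J} {I : Type t}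
  [PartialOrder I] {T : WeaklyTriangular E I} {Λ : I → Type w}
  {S : ∀ a, Λ a → ModuleCat.{u} (T.Abar a)}

theorem isUpperFiniteFullyStratified (hS : ∀ a, IsFullSetOfSimples (S a)) {Λ' : Type w'}
    [PartialOrder Λ'] {ρ : (Σ a, Λ a) → Λ'} (hfin : ∀ l : Λ', {m | l ≤ m}.Finite)
    (hρ : ∀ l : Λ', ∃ (a : I) (c : T.Abar a), IsLabel S ρ l a c) :
    IsUpperFiniteFullyStratified k (simples hS) ρ where
  schurian := ⟨A, J, inferInstance, inferInstance, inferInstance, inferInstance, E,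
    CategoryTheory.Equivalence.refl, inferInstanceAs (𝟭 E.Lfdmod).Additive,
    inferInstanceAs ((𝟭 E.Lfdmod).Linear k)⟩
  upper_finite := hfin
  stratification := isStratification hS hρ
  flags := hasProjectiveFlags hS hρ

lemma finite_le_blockPoset (hS : ∀ a, IsFullSetOfSimples (S a)) (ω : T.BlockPoset) :
    {ω' : T.BlockPoset | ω ≤ ω'}.Finite := by
  have hf := (T.upper_finite ω.idx).to_subtype
  have (b : {b | ω.idx ≤ b}) : Finite (Block (T.Abar b.1)) := finite_block k (hS b.1)
  refine (Set.finite_range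
    fun x : Σ b : {b | ω.idx ≤ b}, Block (T.Abar b.1) => (⟨x.1.1, x.2⟩ : T.BlockPoset)).subset ?_
  rintro ⟨b, c⟩ h
  have hb : ω.idx ≤ b := by
    rcases h with rfl | h
    · exact le_rfl
    · exact h.le
  exact ⟨⟨⟨b, hb⟩, c⟩, rfl⟩

/-- `j_!` of a projective cover of `S` has `L` as its unique irreducible quotient. -/
lemma exists_isCoatom_standardize (hS : ∀ a, IsFullSetOfSimples (S a)) {a : I} {l : Λ a}
    {P : ModuleCat.{u} (T.Abar a)} {π : P ⟶ S a l} (hπ : IsProjCover π) :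
    ∃ N : Submodule E.Uni (T.standardize a P), (∀ N', IsCoatom N' ↔ N' = N) ∧
      Nonempty ((simples hS ⟨a, l⟩).obj ≅ ModuleCat.of E.Uni (T.standardize a P ⧸ N)) := by
  let := simple_of_fullSet (hS a) l
  have hnt := IsSimpleModule.nontrivial (T.Abar a) (S a l)
  let K : Submodule (T.Abar a) P := (⊥ : Submodule (T.Abar a) (S a l)).comap π.hom
  have hK' : K ≠ ⊤ := by
    intro h
    obtain ⟨p, hp⟩ := hπ.exists_ne_zero
    exact hp (h ▸ Submodule.mem_top : p ∈ K)
  have hK : ∀ V' : Submodule (T.Abar a) P, ¬ V' ≤ K → V' = ⊤ := by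
    intro V' hV'
    refine hπ.eq_top V' fun s => ?_
    have h1 : V'.map π.hom = ⊤ := (eq_bot_or_eq_top _).resolve_left fun h =>
      hV' (Submodule.map_le_iff_le_comap.1 h.le)
    obtain ⟨n, hn, h2⟩ := (h1 ▸ Submodule.mem_top : s ∈ V'.map π.hom)
    exact ⟨n, hn, h2⟩
  exact ⟨T.rad P K, T.isCoatom_iff hK' hK,
    ⟨(T.quotRadEquiv π.hom hπ.surjective ⊥).symm.toModuleIso⟩⟩

end WeaklyTriangular

open WeaklyTriangular

theorem theorem3p9 {k A J : Type u} [Field k] [IsAlgClosed k] [NonUnitalRing A] [Module k A]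
    [IsScalarTower k A A] [SMulCommClass k A A] (E : LocallyUnital k A J)
    {I : Type t} [PartialOrder I] (T : WeaklyTriangular E I)
    {Λ : I → Type w} (S : ∀ a, Λ a → ModuleCat.{u} (T.Abar a))
    (hS : ∀ a, IsFullSetOfSimples (S a)) :
    ∃ (L : (Σ a, Λ a) → E.Lfdmod) (β : ∀ a, Λ a → Block (T.Abar a)),
      -- `β a l` is the block of `Ā_a` to which the irreducible module `S a l` belongs
      (∀ a l (v : S a l), (β a l).1 • v = v) ∧
      -- `L l` is the unique irreducible quotient of the standard module `Δ(l)`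
      (∀ a l (P : ModuleCat.{u} (T.Abar a)) (π : P ⟶ S a l), IsProjCover π →
        ∃ N : Submodule E.Uni (T.standardize a P), (∀ N', IsCoatom N' ↔ N' = N) ∧
          Nonempty ((L ⟨a, l⟩).obj ≅ ModuleCat.of E.Uni (T.standardize a P ⧸ N))) ∧
      -- `A`-lfdmod is fully stratified by `I`, and by the blocks of the algebras `Ā_a`
      IsUpperFiniteFullyStratified k L (fun l => l.1) ∧
      IsUpperFiniteFullyStratified k L (fun l => (⟨l.1, β l.1 l.2⟩ : T.BlockPoset)) ∧
      -- the standard, proper standard, costandard and proper costandard objects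
      (∀ a l (P : ModuleCat.{u} (T.Abar a)) (π : P ⟶ S a l), IsProjCover π →
        ∃ X : E.Lfdmod, Nonempty (X.obj ≅ T.standardize a P) ∧
          IsStandard L (fun l => l.1) ⟨a, l⟩ X ∧
          IsStandard L (fun l => (⟨l.1, β l.1 l.2⟩ : T.BlockPoset)) ⟨a, l⟩ X) ∧
      (∀ a l, ∃ X : E.Lfdmod, Nonempty (X.obj ≅ T.standardize a (S a l)) ∧
          IsProperStandard L (fun l => l.1) ⟨a, l⟩ X ∧
          IsProperStandard L (fun l => (⟨l.1, β l.1 l.2⟩ : T.BlockPoset)) ⟨a, l⟩ X) ∧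
      (∀ a l (Q : ModuleCat.{u} (T.Abar a)) (ι : S a l ⟶ Q), IsInjHull ι →
        ∃ X : E.Lfdmod, Nonempty (X.obj ≅ T.costandardize a Q) ∧
          IsCostandard L (fun l => l.1) ⟨a, l⟩ X ∧
          IsCostandard L (fun l => (⟨l.1, β l.1 l.2⟩ : T.BlockPoset)) ⟨a, l⟩ X) ∧
      (∀ a l, ∃ X : E.Lfdmod, Nonempty (X.obj ≅ T.costandardize a (S a l)) ∧
          IsProperCostandard L (fun l => l.1) ⟨a, l⟩ X ∧
          IsProperCostandard L (fun l => (⟨l.1, β l.1 l.2⟩ : T.BlockPoset)) ⟨a, l⟩ X) ∧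
      -- the semisimple case
      ((∀ a, IsSemisimpleRing (T.Abar a)) →
        IsUpperFiniteHighestWeight k L (fun l => (⟨l.1, β l.1 l.2⟩ : T.BlockPoset))) := by
  have hsim := fun a l => simple_of_fullSet (hS a) l
  choose β hβ using fun a l => exists_block (R := T.Abar a) k (S a l)
  have hI : ∀ a : I, IsLabel S (fun p => p.1) a a (1 : T.Abar a) := isLabel_fst
  have hB : ∀ ω : T.BlockPoset, IsLabel S (fun p => (⟨p.1, β p.1 p.2⟩ : T.BlockPoset)) ω ω.idx
    ω.blk.1 := isLabel_block hS β hβ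
  have hI' := isUpperFiniteFullyStratified hS T.upper_finite fun a => ⟨a, 1, hI a⟩
  have hB' := isUpperFiniteFullyStratified hS (finite_le_blockPoset hS) fun ω => ⟨_, _, hB ω⟩
  refine ⟨simples hS, β, hβ, fun a l P π hπ => exists_isCoatom_standardize hS hπ, hI', hB',
    fun a l P π hπ => ?_, fun a l => ?_, fun a l Q ι hι => ?_, fun a l => ?_, fun hss => ?_⟩
  · exact ⟨std P hπ.finite, ⟨Iso.refl _⟩, (hI a).isStandard hS hπ _, (hB _).isStandard hS hπ _⟩
  · exact ⟨std (S a l) (finite_simple hS l), ⟨Iso.refl _⟩, (hI a).isProperStandard hS _,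
      (hB _).isProperStandard hS _⟩
  · exact ⟨costd Q (hι.finite k), ⟨Iso.refl _⟩, (hI a).isCostandard hS hι _,
      (hB _).isCostandard hS hι _⟩
  · exact ⟨costd (S a l) (finite_simple hS l), ⟨Iso.refl _⟩, (hI a).isProperCostandard hS _,
      (hB _).isProperCostandard hS _⟩
  · refine ⟨hB', fun ω => ?_⟩
    obtain ⟨l, hl⟩ := ω.blk.exists_simple (hS ω.idx)
    have := hss ω.idx
    exact ((hB ω).isStratum hS).stratumEquivFdmod_of_isSemisimpleRing ω.blk (S ω.idx l) hl

end Stratifications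

end
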